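/- Let $\Bbbk$ be a commutative ring and $n\ge 0$. Let $\Omega=\Omega_n^{epi}$ be the category of pruned trees. Its objects are the sequences $\underline\tau=\{t_0\xrightarrow{\tau_1}t_1\to\cdots\xrightarrow{\tau_n}t_n=*\}$ of nondecreasing surjections between finite ordinals. A morphism $u:\underline\tau\to\underline\sigma$ is a sequence of surjections $t_i\to s_i$ commuting with the structure maps and nondecreasing on each fibre of $\tau_{i+1}$. Put $\deg\underline\tau=t_0+\dots+t_{n-1}$ and $\deg u=\deg\underline\tau-\deg\underline\sigma$. To a morphism $v$ of degree $1$ one associates a sign $\operatorname{sgn}(v)$: give each vertex of level $<n$ the degree $1$, order the vertices of a tree by following the edges from the root upwards and then from left to right, and take the sign of the permutations of tensors that move the two vertices merged by $v$ to the front of the tensor of all vertices of the source and, after their fusion into one factor, put the factors into the order of the target. A diagram is a covariant functor from $\Omega$ to $\mathbb Z$-graded chain complexes of $\Bbbk$-modules (dg-modules). It is dg-cofibrant if its values are cofibrant in the projective model structure on dg-modules. Write $\mathrm{Hom}_\Omega(S,T)$ for the end of the dg-modules $\mathrm{Hom}(S(\underline\tau),T(\underline\tau))$. Define $\mathrm{Ext}^i_\Omega(S,T)=H_{-i}(\mathrm{Hom}_\Omega(Q,T))$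 for a cofibrant replacement $q:Q\xrightarrow{\sim}S$ in the projective model category of diagrams. The Koszul cocategory $K(\Omega)$ has $K(\Omega)(\underline\tau,\underline\sigma)=\bigoplus_{u:\underline\tau\to\underline\sigma}\Bbbk\{u\}$ with $\{u\}$ of degree $\deg u$. The Koszul complex $K(\Omega,\Omega,S)$ is the diagram $$\underline\varphi\mapsto\bigoplus_{\underline\tau,\underline\sigma}\Bbbk[\mathrm{Mor}_\Omega(\underline\sigma,\underline\varphi)]\otimes K(\Omega)(\underline\tau,\underline\sigma)\otimes S(\underline\tau)$$ with the differential that takes $x\otimes\{u\}\otimes y$ to $$(-1)^{\deg u}x\otimes\{u\}\otimes\delta y+\sum_{\substack{u=vw\\ \deg v=1}}\operatorname{sgn}(v)\,xv\otimes\{w\}\otimes y+\sum_{\substack{u=vw\\ \deg w=1}}(-1)^{\deg u}\operatorname{sgn}(w)\,x\otimes\{v\}\otimes w_*y .$$ The augmentation $\epsilon:K(\Omega,\Omega,S)\to S$ takes $x\otimes\{u\}\otimes y$ to $(xu)_*y$ if $\deg u=0$ and to $0$ otherwise. **Theorem.** Let $S$ and $T$ be dg-cofibrant diagrams. The differential of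 $K(\Omega,\Omega,S)$ has square zero, $S$ has a cofibrant replacement, and for all $i\in\mathbb Z$ $$\mathrm{Ext}^{i}_{\Omega}(S,T)\cong H_{-i}\bigl(\mathrm{Hom}_{\Omega}(K(\Omega,\Omega,S),T)\bigr).$$ More precisely, for every cofibrant replacement $q:Q\to S$ there is a morphism $c:Q\to K(\Omega,\Omega,S)$ with $\epsilon c=q$. Every such $c$ induces, by precomposition, an isomorphism from the right-hand side to $H_{-i}(\mathrm{Hom}_\Omega(Q,T))$, and this isomorphism does not depend on $c$. The complex is minimal in the following sense: if the internal differentials of $S$ and $T$ vanish and all morphisms of nonzero degree act by zero on $S$ and on $T$, then the differential of $\mathrm{Hom}_\Omega(K(\Omega,\Omega,S),T)$ is zero. -/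

import Mathlib

open CategoryTheory

universe u

/-! ### The category of pruned trees -/

/-- A pruned tree with levels `0, …, n`: a sequence of nondecreasing surjections
`t₀ → t₁ → ⋯ → tₙ = *` between the ordered sets `tᵢ = {1 < ⋯ < card i}` (modelled on `Fin (card i)`).
For uniform indexing, the sequence is continued by one-point sets beyond the level `n`,
which adds no data. -/
structure PrunedTree (n : ℕ) where
  card : ℕ → ℕ
  map : ∀ i, Fin (card i) → Fin (card (i + 1))
  mono : ∀ i, Monotone (map i)
  surj : ∀ i, Function.Surjective (map i)
  card_eq_one : ∀ i, n ≤ i → card i = 1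

namespace PrunedTree

variable {n : ℕ}

/-- A morphism of pruned trees: surjections `tᵢ → sᵢ` commuting with the structure maps and
nondecreasing on each fibre of `tᵢ → tᵢ₊₁`. -/
@[ext]
structure Hom (τ σ : PrunedTree n) where
  app : ∀ i, Fin (τ.card i) → Fin (σ.card i)
  surj : ∀ i, Function.Surjective (app i)
  comm : ∀ i a, σ.map i (app i a) = app (i + 1) (τ.map i a)
  mono : ∀ i a b, τ.map i a = τ.map i b → a ≤ b → app i a ≤ app i b

instance : Category (PrunedTree n) where
  Hom := Hom
  id τ :=
    { app := fun _ a => a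
      surj := fun _ a => ⟨a, rfl⟩
      comm := fun _ _ => rfl
      mono := fun _ _ _ _ h => h }
  comp f g :=
    { app := fun i a => g.app i (f.app i a)
      surj := fun i => (g.surj i).comp (f.surj i)
      comm := fun i a => by rw [g.comm, f.comm]
      mono := fun i a b h hab =>
        g.mono i _ _ (by rw [f.comm, f.comm, h]) (f.mono i a b h hab) }

@[ext]
lemma hom_ext {τ σ : PrunedTree n} {u v : τ ⟶ σ} (h : ∀ i a, u.app i a = v.app i a) : u = v :=
  Hom.ext (funext fun i => funext fun a => h i a)

/-- The degree `t₀ + ⋯ + tₙ₋₁` of a pruned tree: its number of vertices of level `< n`. -/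
def degree (τ : PrunedTree n) : ℤ := ∑ i ∈ Finset.range n, (τ.card i : ℤ)

/-- The degree of a morphism `τ ⟶ σ` is `deg τ - deg σ`. -/
def Hom.deg {τ σ : PrunedTree n} (_ : τ ⟶ σ) : ℤ := τ.degree - σ.degree

/-- The vertices of level `< n` of a pruned tree. -/
abbrev Vertex (τ : PrunedTree n) : Type := Σ i : Fin n, Fin (τ.card i)

/-- The vertex of level `j ≥ i` lying below a given vertex of level `i`. -/
def below (τ : PrunedTree n) {i j : ℕ} (h : i ≤ j) : Fin (τ.card i) → Fin (τ.card j) :=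
  Nat.leRecOn (C := fun l => Fin (τ.card l)) h fun {l} => τ.map l

/-- The total order on the vertices in which the tree is traversed vertex by vertex, following the
edges from bottom to top (the root being the level `n`) and then from left to right: `x` precedes
`y` if `x` is at the left of `y`, or if `x` lies (strictly) below `y`. Positions are compared at the
lowest of the two levels, which is the one with the largest index. -/
def Precedes (τ : PrunedTree n) (x y : τ.Vertex) : Prop :=
  let l := max (x.1 : ℕ) (y.1 : ℕ)
  let a : Fin (τ.card l) := τ.below (le_max_left _ _) x.2
  let b : Fin (τ.card l) := τ.below (le_max_right _ _) y.2
  a < b ∨ (a = b ∧ (y.1 : ℕ) < (x.1 : ℕ))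

/-- The map induced by a morphism on vertices. -/
def Hom.onVertex {τ σ : PrunedTree n} (u : τ ⟶ σ) (x : τ.Vertex) : σ.Vertex :=
  ⟨x.1, u.app x.1 x.2⟩

/-- A vertex is merged by `u` if another vertex has the same image. -/
def Hom.Merged {τ σ : PrunedTree n} (u : τ ⟶ σ) (x : τ.Vertex) : Prop :=
  ∃ y, y ≠ x ∧ Hom.onVertex u y = Hom.onVertex u x

open Classical in
/-- The sign of a morphism `u` of degree `1`, which merges exactly two vertices `x₁, x₂` of `τ`.
Each vertex counts as a symbol of degree `1`. The sign is that of the following permutations of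
tensors: starting from the tensor of the vertices of `τ` in their order, the factors `x₁, x₂` are
moved in front (first sum); they are fused to one factor; this factor is moved to its place in the
order of `σ` (second sum), and the other factors are reordered according to the order of `σ`
(third sum). -/
noncomputable def Hom.sgn {τ σ : PrunedTree n} (u : τ ⟶ σ) : ℤ :=
  (-1) ^
    (Finset.card {p : τ.Vertex × τ.Vertex |
        ¬ Hom.Merged u p.1 ∧ Hom.Merged u p.2 ∧ τ.Precedes p.1 p.2}
      + Finset.card {z : τ.Vertex |
        ¬ Hom.Merged u z ∧
          ∃ x, Hom.Merged u x ∧ σ.Precedes (Hom.onVertex u z) (Hom.onVertex u x)}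
      + Finset.card {p : τ.Vertex × τ.Vertex |
        ¬ Hom.Merged u p.1 ∧ ¬ Hom.Merged u p.2 ∧ τ.Precedes p.1 p.2 ∧
          σ.Precedes (Hom.onVertex u p.2) (Hom.onVertex u p.1)})

/-- A factorization `u = v w` of a morphism, with `w = fst` and `v = snd`. -/
structure Factorization {τ σ : PrunedTree n} (u : τ ⟶ σ) where
  mid : PrunedTree n
  fst : τ ⟶ mid
  snd : mid ⟶ σ
  comp : fst ≫ snd = u

lemma Hom.card_le {τ σ : PrunedTree n} (u : τ ⟶ σ) (i : ℕ) : σ.card i ≤ τ.card i := by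
  simpa using Fintype.card_le_of_surjective _ (u.surj i)

/-- The data of level `< n` of a factorization, which determine it. -/
def Factorization.code {τ σ : PrunedTree n} {u : τ ⟶ σ} (F : Factorization u) :
    ∀ i : Fin n, Fin (τ.card i + 1) × (Fin (τ.card i) → Fin (τ.card (i + 1))) ×
      (Fin (τ.card i) → Fin (τ.card i)) × (Fin (τ.card i) → Option (Fin (σ.card i))) :=
  fun i =>
    (⟨F.mid.card i, Nat.lt_succ_of_le (Hom.card_le F.fst i)⟩,
      fun a => if h : (a : ℕ) < F.mid.card i then
          Fin.castLE (Hom.card_le F.fst (i + 1)) (F.mid.map i ⟨a, h⟩) else τ.map i a,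
      fun a => Fin.castLE (Hom.card_le F.fst i) (F.fst.app i a),
      fun a => if h : (a : ℕ) < F.mid.card i then some (F.snd.app i ⟨a, h⟩) else none)

lemma Factorization.code_injective {τ σ : PrunedTree n} (u : τ ⟶ σ) :
    Function.Injective (Factorization.code (u := u)) := by
  rintro ⟨⟨c, m, hm, hs, h1⟩, w, v, hwv⟩ ⟨⟨c', m', hm', hs', h1'⟩, w', v', hwv'⟩ h
  have hc : c = c' := by
    funext i
    rcases lt_or_ge i n with hi | hi
    · have := congrArg (fun z => (z.1 : ℕ)) (congrFun h ⟨i, hi⟩)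
      simpa [Factorization.code] using this
    · rw [h1 i hi, h1' i hi]
  subst hc
  have hmm : m = m' := by
    funext i a
    rcases lt_or_ge i n with hi | hi
    · have h2 := congrArg (fun z => z.2.1) (congrFun h ⟨i, hi⟩)
      have hle : c i ≤ τ.card i := Hom.card_le w i
      have h3 := congrFun h2 (Fin.castLE hle a)
      simpa [Factorization.code] using h3
    · apply Fin.ext
      have := h1 (i + 1) (by omega)
      omega
  subst hmm
  have hw : w = w' := by
    ext i a
    rcases lt_or_ge i n with hi | hi
    · have h2 := congrArg (fun z => z.2.2.1) (congrFun h ⟨i, hi⟩)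
      have h3 := congrFun h2 a
      have h4 := congrArg Fin.val h3
      simpa [Factorization.code] using h4
    · have := h1 i hi
      have h5 := (w.app i a).isLt
      have h6 := (w'.app i a).isLt
      dsimp only at h5 h6
      omega
  have hv : v = v' := by
    ext i a
    obtain ⟨b, rfl⟩ := w.surj i a
    subst hw
    have := congrArg (fun z : τ ⟶ σ => (z.app i b : ℕ)) (hwv.trans hwv'.symm)
    exact this
  subst hw hv
  rfl

instance {τ σ : PrunedTree n} (u : τ ⟶ σ) : Finite (Factorization u) :=
  Finite.of_injective _ (Factorization.code_injective u)

noncomputable instance {τ σ : PrunedTree n} (u : τ ⟶ σ) (p : Factorization u → Prop) :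
    Fintype {F : Factorization u // p F} :=
  Fintype.ofFinite _

end PrunedTree

/-! ### Diagrams of dg-modules -/

section Diagrams

variable {k : Type u} [CommRing k]

/-- The covariant diagrams of dg-modules over the category of pruned trees: functors to `ℤ`-graded
chain complexes of `k`-modules. -/
abbrev DGDiagram (k : Type u) [CommRing k] (n : ℕ) :=
  PrunedTree n ⥤ ChainComplex (ModuleCat.{u} k) ℤ

/-- A cofibrant object of the projective model category of dg-modules: the morphism `0 ⟶ C` has the
left lifting property with respect to the acyclic fibrations, the degreewise surjective
quasi-isomorphisms. -/
def IsCofibrantDGModule (C : ChainComplex (ModuleCat.{u} k) ℤ) : Prop :=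
  ∀ ⦃X Y : ChainComplex (ModuleCat.{u} k) ℤ⦄ (p : X ⟶ Y),
    (∀ i, Function.Surjective (p.f i)) → QuasiIso p →
      ∀ g : C ⟶ Y, ∃ l : C ⟶ X, l ≫ p = g

variable {n : ℕ}

/-- A dg-cofibrant diagram: all the values are cofibrant dg-modules. -/
def IsDGCofibrant (S : DGDiagram k n) : Prop := ∀ τ, IsCofibrantDGModule (S.obj τ)

/-- A weak equivalence of diagrams: an objectwise quasi-isomorphism. -/
def IsWeakEquiv {X Y : DGDiagram k n} (p : X ⟶ Y) : Prop := ∀ τ, QuasiIso (p.app τ)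

/-- A fibration of diagrams (for the projective model structure): an objectwise and degreewise
surjective morphism. -/
def IsProjectiveFibration {X Y : DGDiagram k n} (p : X ⟶ Y) : Prop :=
  ∀ τ i, Function.Surjective ((p.app τ).f i)

/-- A cofibrant object of the projective model category of diagrams of dg-modules. -/
def IsCofibrantDiagram (Q : DGDiagram k n) : Prop :=
  ∀ ⦃X Y : DGDiagram k n⦄ (p : X ⟶ Y), IsProjectiveFibration p → IsWeakEquiv p →
    ∀ g : Q ⟶ Y, ∃ l : Q ⟶ X, l ≫ p = g

/-- A cofibrant replacement `q : Q ⟶ S` in the category of diagrams of dg-modules. -/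
structure IsCofibrantReplacement {Q S : DGDiagram k n} (q : Q ⟶ S) : Prop where
  cofibrant : IsCofibrantDiagram Q
  weakEquiv : IsWeakEquiv q

/-- A pair of degrees `(p, q)` with `p + d = q`. -/
structure DegPair (d : ℤ) where
  p : ℤ
  q : ℤ
  eq : p + d = q

/-- The homomorphisms of degree `d` in the end of the dg-modules `Hom(S(τ), T(τ))`: the families
of `k`-linear maps `S(τ)ₚ → T(τ)ₚ₊d` which are natural in `τ`. -/
def dgHom (S T : DGDiagram k n) (d : ℤ) :
    Submodule k (∀ (τ : PrunedTree n) (P : DegPair d), (S.obj τ).X P.p →ₗ[k] (T.obj τ).X P.q) where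
  carrier := {f | ∀ (τ σ : PrunedTree n) (u : τ ⟶ σ) (P : DegPair d),
    ((T.map u).f P.q).hom ∘ₗ f τ P = f σ P ∘ₗ ((S.map u).f P.p).hom}
  add_mem' hf hg τ σ u P := by
    simp only [Pi.add_apply, LinearMap.comp_add, LinearMap.add_comp, hf τ σ u P, hg τ σ u P]
  zero_mem' τ σ u P := by
    simp only [Pi.zero_apply, LinearMap.comp_zero, LinearMap.zero_comp]
  smul_mem' c f hf τ σ u P := by
    simp only [Pi.smul_apply, LinearMap.comp_smul, LinearMap.smul_comp, hf τ σ u P]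

/-- The differential `δ(f) = δ f - (-1)^(deg f) f δ` of the dg-hom, from degree `d` to degree
`d' = d - 1`. -/
noncomputable def dgHomD (S T : DGDiagram k n) (d d' : ℤ) (hd : d' + 1 = d) :
    dgHom S T d →ₗ[k] dgHom S T d' where
  toFun f := ⟨fun τ P =>
      ((T.obj τ).d (P.q + 1) P.q).hom ∘ₗ
          f.1 τ ⟨P.p, P.q + 1, by have := P.eq; omega⟩
        - (d.negOnePow : ℤ) • (f.1 τ ⟨P.p - 1, P.q, by have := P.eq; omega⟩ ∘ₗ
            ((S.obj τ).d P.p (P.p - 1)).hom), by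
    intro τ σ u P
    have h1 := f.2 τ σ u ⟨P.p, P.q + 1, by have := P.eq; omega⟩
    have h2 := f.2 τ σ u ⟨P.p - 1, P.q, by have := P.eq; omega⟩
    have h3 := congrArg ModuleCat.Hom.hom ((T.map u).comm (P.q + 1) P.q)
    have h4 := congrArg ModuleCat.Hom.hom ((S.map u).comm P.p (P.p - 1))
    simp only [ModuleCat.hom_comp] at h3 h4
    dsimp only at h1 h2
    rw [LinearMap.comp_sub, LinearMap.sub_comp, LinearMap.comp_smul, LinearMap.smul_comp,
      ← LinearMap.comp_assoc, ← LinearMap.comp_assoc, ← h3, LinearMap.comp_assoc, h1, h2,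
      LinearMap.comp_assoc, ← h4]
    simp only [LinearMap.comp_assoc]⟩
  map_add' f g := by
    ext τ P x
    simp
    abel
  map_smul' c f := by
    ext τ P x
    simp [smul_sub, smul_comm c]

lemma dgHomD_comp (S T : DGDiagram k n) (d d' d'' : ℤ) (h : d' + 1 = d) (h' : d'' + 1 = d') :
    dgHomD S T d' d'' h' ∘ₗ dgHomD S T d d' h = 0 := by
  subst h h'
  ext f τ P x
  obtain ⟨p, q, hpq⟩ := P
  have h1 : ∀ y, ((T.obj τ).d (q + 1) q).hom (((T.obj τ).d (q + 1 + 1) (q + 1)).hom y) = 0 :=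
    fun y => congrArg (fun a => ModuleCat.Hom.hom a y) ((T.obj τ).d_comp_d (q + 1 + 1) (q + 1) q)
  have h2 : ∀ y, ((S.obj τ).d (p - 1) (p - 1 - 1)).hom (((S.obj τ).d p (p - 1)).hom y) = 0 :=
    fun y => congrArg (fun a => ModuleCat.Hom.hom a y) ((S.obj τ).d_comp_d p (p - 1) (p - 1 - 1))
  simp [dgHomD, Int.negOnePow_succ, h1, h2]

/-- The dg-module `Hom_Ω(S, T)`. -/
noncomputable def homComplex (S T : DGDiagram k n) : ChainComplex (ModuleCat.{u} k) ℤ where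
  X d := ModuleCat.of k (dgHom S T d)
  d i j := if h : j + 1 = i then ModuleCat.ofHom (dgHomD S T i j h) else 0
  shape i j h := dif_neg h
  d_comp_d' i j l h h' := by
    have h1 : j + 1 = i := h
    have h2 : l + 1 = j := h'
    rw [dif_pos h1, dif_pos h2, ← ModuleCat.ofHom_comp, dgHomD_comp]
    rfl

/-- Precomposition with a morphism of diagrams. -/
noncomputable def homComplexMap {S S' : DGDiagram k n} (φ : S ⟶ S') (T : DGDiagram k n) :
    homComplex S' T ⟶ homComplex S T where
  f d := ModuleCat.ofHom
    { toFun := fun f => ⟨fun τ P => f.1 τ P ∘ₗ ((φ.app τ).f P.p).hom, by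
        intro τ σ u P
        have h1 := f.2 τ σ u P
        have h2 := congrArg (fun a => ModuleCat.Hom.hom (HomologicalComplex.Hom.f a P.p))
          (φ.naturality u)
        simp only [HomologicalComplex.comp_f, ModuleCat.hom_comp] at h2
        rw [← LinearMap.comp_assoc, h1, LinearMap.comp_assoc, ← h2, LinearMap.comp_assoc]⟩
      map_add' := fun f g => rfl
      map_smul' := fun c f => rfl }
  comm' i j h := by
    have h1 : j + 1 = i := h
    ext f
    apply Subtype.ext
    funext τ P
    have h2 := congrArg ModuleCat.Hom.hom ((φ.app τ).comm P.p (P.p - 1))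
    simp only [ModuleCat.hom_comp] at h2
    simp only [homComplex, dif_pos h1]
    change _ ∘ₗ (_ ∘ₗ _) - _ • ((_ ∘ₗ _) ∘ₗ _) = (_ ∘ₗ _ - _ • (_ ∘ₗ _)) ∘ₗ _
    rw [LinearMap.sub_comp, LinearMap.smul_comp, LinearMap.comp_assoc, LinearMap.comp_assoc,
      LinearMap.comp_assoc, h2]

/-- The module `Ext^i(S, T)`, as computed by a cofibrant replacement `Q` of `S`: the homology of
`Hom_Ω(Q, T)` in cohomological degree `i`, which is the lower degree `-i`. -/
noncomputable abbrev extVia (Q T : DGDiagram k n) (i : ℤ) : ModuleCat.{u} k :=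
  (homComplex Q T).homology (-i)

end Diagrams

/-! ### The Koszul complex with coefficients -/

section Koszul

variable {k : Type u} [CommRing k] {n : ℕ}

open PrunedTree

/-- The index of a summand `k{x} ⊗ k{u} ⊗ S(τ)_q ≅ S(τ)_q` of degree `m` of
`K(Ω(-, φ), Ω, S) = ⨁ Ω(σ, φ) ⊗ K(Ω)(τ, σ) ⊗ S(τ)`, where `K(Ω)(τ, σ)` is the graded module with a
generator `{u}` of degree `deg u` for each morphism `u : τ ⟶ σ`. -/
structure KoszulIndex (φ : PrunedTree n) (m : ℤ) where
  src : PrunedTree n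
  tgt : PrunedTree n
  u : src ⟶ tgt
  x : tgt ⟶ φ
  q : ℤ
  deg_eq : Hom.deg u + q = m

/-- The component of degree `m` of `K(Ω, Ω, S)(φ) = K(Ω(-, φ), Ω, S)`. -/
abbrev KoszulX (S : DGDiagram k n) (φ : PrunedTree n) (m : ℤ) : Type u :=
  DirectSum (KoszulIndex φ m) fun I => (S.obj I.src).X I.q

open Classical in
/-- The element `x ⊗ {u} ⊗ y` of `K(Ω, Ω, S)(φ)`, as a linear function of `y ∈ S(τ)_q`. -/
noncomputable def koszulElt (S : DGDiagram k n) {φ τ σ : PrunedTree n} (u : τ ⟶ σ) (x : σ ⟶ φ)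
    (q m : ℤ) (h : Hom.deg u + q = m) : (S.obj τ).X q →ₗ[k] KoszulX S φ m :=
  DirectSum.lof k (KoszulIndex φ m) (fun I => (S.obj I.src).X I.q) ⟨τ, σ, u, x, q, h⟩

open Classical in
/-- The linear map on `K(Ω, Ω, S)(φ)` with given values on the elements `x ⊗ {u} ⊗ y`. -/
noncomputable def koszulLift (S : DGDiagram k n) {φ : PrunedTree n} {m : ℤ}
    {M : Type u} [AddCommGroup M] [Module k M]
    (f : ∀ {τ σ : PrunedTree n} (u : τ ⟶ σ) (_ : σ ⟶ φ) (q : ℤ), Hom.deg u + q = m →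
      ((S.obj τ).X q →ₗ[k] M)) : KoszulX S φ m →ₗ[k] M :=
  DirectSum.toModule k _ _ fun I => f I.u I.x I.q I.deg_eq

@[simp]
lemma koszulLift_elt (S : DGDiagram k n) {φ : PrunedTree n} {m : ℤ}
    {M : Type u} [AddCommGroup M] [Module k M]
    (f : ∀ {τ σ : PrunedTree n} (u : τ ⟶ σ) (_ : σ ⟶ φ) (q : ℤ), Hom.deg u + q = m →
      ((S.obj τ).X q →ₗ[k] M)) {τ σ : PrunedTree n} (u : τ ⟶ σ) (x : σ ⟶ φ) (q : ℤ)
    (h : Hom.deg u + q = m) (y : (S.obj τ).X q) :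
    koszulLift S f (koszulElt S u x q m h y) = f u x q h y := by
  classical
  exact DirectSum.toModule_lof (M := fun I : KoszulIndex φ m => (S.obj I.src).X I.q) k
    ⟨τ, σ, u, x, q, h⟩ y

lemma koszul_hom_ext {S : DGDiagram k n} {φ : PrunedTree n} {m : ℤ}
    {M : Type u} [AddCommGroup M] [Module k M] {f g : KoszulX S φ m →ₗ[k] M}
    (h : ∀ {τ σ : PrunedTree n} (u : τ ⟶ σ) (x : σ ⟶ φ) (q : ℤ) (h : Hom.deg u + q = m)
      (y : (S.obj τ).X q), f (koszulElt S u x q m h y) = g (koszulElt S u x q m h y)) :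
    f = g := by
  classical
  exact DirectSum.linearMap_ext k fun I => LinearMap.ext fun y => h I.u I.x I.q I.deg_eq y

/-- The differential of `K(Ω, Ω, S)(φ)`, the sum of the internal differential
`x ⊗ {u} ⊗ y ↦ (-1)^(deg u) x ⊗ {u} ⊗ δ y` and of the twisting homomorphism
`x ⊗ {u} ⊗ y ↦ ∑_{u = v w, deg v = 1} sgn(v) (x v) ⊗ {w} ⊗ y
  + ∑_{u = v w, deg w = 1} (-1)^(deg u) sgn(w) x ⊗ {v} ⊗ w_* y`. -/
noncomputable def koszulD (S : DGDiagram k n) (φ : PrunedTree n) (i j : ℤ) (h : j + 1 = i) :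
    KoszulX S φ i →ₗ[k] KoszulX S φ j :=
  koszulLift S fun {τ _} u x q hq =>
    ((Hom.deg u).negOnePow : ℤ) •
      (koszulElt S u x (q - 1) j (by omega) ∘ₗ ((S.obj τ).d q (q - 1)).hom)
    + ∑ F : {F : Factorization u // Hom.deg F.snd = 1},
        Hom.sgn F.1.snd •
          koszulElt S F.1.fst (F.1.snd ≫ x) q j
            (by have := F.2; simp only [Hom.deg] at *; omega)
    + ∑ F : {F : Factorization u // Hom.deg F.fst = 1},
        (((Hom.deg u).negOnePow : ℤ) * Hom.sgn F.1.fst) •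
          (koszulElt S F.1.snd x q j (by have := F.2; simp only [Hom.deg] at *; omega) ∘ₗ
            ((S.map F.1.fst).f q).hom)

/-- The differential of `K(Ω, Ω, S)` has square zero. -/
def KoszulSquareZero (S : DGDiagram k n) : Prop :=
  ∀ (φ : PrunedTree n) (i j l : ℤ) (h : j + 1 = i) (h' : l + 1 = j),
    koszulD S φ j l h' ∘ₗ koszulD S φ i j h = 0

/-- The action of a morphism `f : φ ⟶ ψ` on the Koszul complex: `x ⊗ {u} ⊗ y ↦ (f x) ⊗ {u} ⊗ y`. -/
noncomputable def koszulMap (S : DGDiagram k n) {φ ψ : PrunedTree n} (f : φ ⟶ ψ) (m : ℤ) :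
    KoszulX S φ m →ₗ[k] KoszulX S ψ m :=
  koszulLift S fun u x q h => koszulElt S u (x ≫ f) q m h

lemma koszulMap_koszulD (S : DGDiagram k n) {φ ψ : PrunedTree n} (f : φ ⟶ ψ) (i j : ℤ)
    (h : j + 1 = i) :
    koszulD S ψ i j h ∘ₗ koszulMap S f i = koszulMap S f j ∘ₗ koszulD S φ i j h := by
  apply koszul_hom_ext
  intro τ σ u x q hq y
  simp only [LinearMap.comp_apply, koszulMap, koszulD, koszulLift_elt, LinearMap.add_apply,
    LinearMap.smul_apply, LinearMap.sum_apply, map_add, map_sum, map_zsmul, Category.assoc]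

lemma koszulMap_id (S : DGDiagram k n) (φ : PrunedTree n) (m : ℤ) :
    koszulMap S (𝟙 φ) m = LinearMap.id :=
  koszul_hom_ext fun u x q h y => koszulLift_elt S _ u x q h y

lemma koszulMap_comp (S : DGDiagram k n) {φ ψ χ : PrunedTree n} (f : φ ⟶ ψ) (g : ψ ⟶ χ) (m : ℤ) :
    koszulMap S (f ≫ g) m = koszulMap S g m ∘ₗ koszulMap S f m := by
  apply koszul_hom_ext
  intro τ σ u x q h y
  simp only [LinearMap.comp_apply, koszulMap, koszulLift_elt, Category.assoc]

/-- The dg-module `K(Ω, Ω, S)(φ) = K(Ω(-, φ), Ω, S)`. -/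
noncomputable def koszulObj (S : DGDiagram k n) (hS : KoszulSquareZero S) (φ : PrunedTree n) :
    ChainComplex (ModuleCat.{u} k) ℤ where
  X m := ModuleCat.of k (KoszulX S φ m)
  d i j := if h : j + 1 = i then ModuleCat.ofHom (koszulD S φ i j h) else 0
  shape i j h := dif_neg h
  d_comp_d' i j l h h' := by
    have h1 : j + 1 = i := h
    have h2 : l + 1 = j := h'
    rw [dif_pos h1, dif_pos h2, ← ModuleCat.ofHom_comp, hS]
    rfl

/-- The Koszul complex `K(Ω, Ω, S)`, as a diagram of dg-modules. -/
noncomputable def koszul (S : DGDiagram k n) (hS : KoszulSquareZero S) : DGDiagram k n where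
  obj φ := koszulObj S hS φ
  map {φ ψ} f :=
    { f := fun m => ModuleCat.ofHom (koszulMap S f m)
      comm' := fun i j h => by
        have h1 : j + 1 = i := h
        simp only [koszulObj, dif_pos h1]
        rw [← ModuleCat.ofHom_comp, ← ModuleCat.ofHom_comp, koszulMap_koszulD] }
  map_id φ := by
    apply HomologicalComplex.hom_ext
    intro m
    exact congrArg ModuleCat.ofHom (koszulMap_id S φ m)
  map_comp f g := by
    apply HomologicalComplex.hom_ext
    intro m
    exact congrArg ModuleCat.ofHom (koszulMap_comp S f g m)

open Classical in
/-- The augmentation `K(Ω, Ω, S) → S`. It is `x ⊗ {u} ⊗ y ↦ (x u)_* y` for `deg u = 0` (then `u`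
is an identity) and is zero for `deg u ≠ 0`. -/
noncomputable def koszulAug (S : DGDiagram k n) (φ : PrunedTree n) (m : ℤ) :
    KoszulX S φ m →ₗ[k] (S.obj φ).X m :=
  koszulLift S fun u x q h =>
    if hu : Hom.deg u = 0 then
      ((S.map (u ≫ x)).f q ≫ ((S.obj φ).XIsoOfEq (by omega : q = m)).hom).hom
    else 0

/-- A morphism `Q ⟶ K(Ω, Ω, S)` is compatible with `q : Q ⟶ S` if its composite with the
augmentation is `q`. -/
def IsOverAug {S Q : DGDiagram k n} (hS : KoszulSquareZero S) (q : Q ⟶ S)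
    (c : Q ⟶ koszul S hS) : Prop :=
  ∀ (φ : PrunedTree n) (m : ℤ) (z : (Q.obj φ).X m),
    koszulAug S φ m (((c.app φ).f m).hom z) = (q.app φ).f m z

/-- A diagram with zero internal differentials on which all the morphisms between trees of different
degrees (equivalently, the morphisms that are not identities) act by zero; the diagrams concentrated
on one tree are of this kind. -/
structure IsElementary (S : DGDiagram k n) : Prop where
  d_eq_zero : ∀ τ i j, (S.obj τ).d i j = 0
  map_eq_zero : ∀ ⦃τ σ : PrunedTree n⦄ (f : τ ⟶ σ), Hom.deg f ≠ 0 → S.map f = 0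

end Koszul

/-! The core is the Koszul property of the category of pruned trees. Once the augmentation of the
Koszul complex is known to be an acyclic fibration with cofibrant source, the complex is itself a
cofibrant replacement of `S`, and the comparison with any other one is formal.

Fix `f : τ ⟶ φ`. The factorizations of `f` form an interval, with a differential that splits one
degree-one merging off the first factor. A factorization is the same as a compatible family of total
preorders on the levels of `τ` (`exists_of_isQuotient`, `ext_of_le`), so the interval can be studied
by discrete Morse theory. Scanning from level `0`, one looks for the first vertex that is not
critical. If it shares its class with other vertices, it is split off to their left; if it is alone,
it is merged with its right neighbour. These operations are inverse to each other (`exists_isSplit`,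
`exists_isSplit'`, and the two uniqueness lemmas), and the matching is acyclic for a lexicographic
rank (`FirstNonCrit.le_of_comp`, `isSplit_or_pos_lt`). A morphism of positive degree always has a
noncritical vertex, so the matching is perfect. An acyclic perfect matching makes one block of the
differential triangular with unit diagonal, and inverting this block gives a contraction
(`exists_contraction_of_matching`, `exists_contraction`).

The differential squares to zero because a morphism of degree two has exactly two factorizations
into mergings, with opposite signs. The count comes from the same matching
(`exists_pair_of_deg_eq_two`). For the signs, the product of two successive signs is a determinant
whose columns are two indicator vectors and the indicators of the fibres of `f`. It is thus the
value of an alternating form depending on `f` alone, and comparing the values for two factorizations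
is linear algebra (`sgn_mul_sgn_eq_neg`). With `sum_coeff_mul_coeff` this yields `koszulSquareZero`.

To see that the augmentation is a quasi-isomorphism, filter by the degree of the composite of `u`
and `x` in the term of `x`, `{u}` and `y`. Up to lower filtration and the internal differential,
each composite contributes its interval complex. The contractions push every cycle down to
composites of degree zero, which form the image of `koszulUnit` (`koszul_homotopy_mem_fil`,
`isWeakEquiv_koszulAugmentation`).

Cofibrancy holds because the complex is freely generated, as a diagram, by the values of `S`, with a
twisting that lowers `deg u`. A lift is built by induction on this degree; each stage asks for a map
out of a cofibrant dg-module with prescribed image and prescribed differential, which exists by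
lifting against a map of shifted cones (`exists_twisted_lift`, `isCofibrantDiagram_koszul`). The
same device shows that lifts along acyclic fibrations are unique up to homotopy, and that weak
equivalences between cofibrant diagrams are invertible on the homology of the dg-hom. Minimality is
read off the formula: each term of the differential contains an internal differential or the action
of a morphism of positive degree. -/

namespace PrunedTree

variable {n : ℕ} {τ σ ρ φ : PrunedTree n}

/-! ### Degrees of morphisms -/

lemma app_eq_of_comp_eq {u : τ ⟶ σ} {v : σ ⟶ ρ} {w : τ ⟶ ρ} (h : u ≫ v = w) (i : ℕ)
    (a : Fin (τ.card i)) : v.app i (u.app i a) = w.app i a := by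
  rw [← h]; rfl

lemma cancel_left {u : τ ⟶ σ} {v w : σ ⟶ ρ} (h : u ≫ v = u ≫ w) : v = w := by
  ext i a
  obtain ⟨b, rfl⟩ := u.surj i a
  exact congrArg Fin.val (congrFun (congrFun (congrArg Hom.app h) i) b)

lemma Hom.deg_comp (u : τ ⟶ σ) (v : σ ⟶ ρ) : Hom.deg (u ≫ v) = Hom.deg u + Hom.deg v := by
  simp only [Hom.deg]; ring

@[simp]
lemma Hom.deg_id (τ : PrunedTree n) : Hom.deg (𝟙 τ) = 0 := by simp [Hom.deg]

lemma Hom.deg_eq_sum (u : τ ⟶ σ) :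
    Hom.deg u = ∑ i ∈ Finset.range n, ((τ.card i : ℤ) - σ.card i) := by
  simp [Hom.deg, degree]

lemma Hom.deg_nonneg (u : τ ⟶ σ) : 0 ≤ Hom.deg u := by
  rw [Hom.deg_eq_sum]
  refine Finset.sum_nonneg fun i _ => ?_
  have := Hom.card_le u i
  omega

lemma subsingleton_of_le (τ : PrunedTree n) {i : ℕ} (h : n ≤ i) (a b : Fin (τ.card i)) :
    a = b := by
  have := τ.card_eq_one i h
  apply Fin.ext
  omega

lemma Hom.injective_of_card_eq (u : τ ⟶ σ) {i : ℕ} (h : τ.card i = σ.card i) :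
    Function.Injective (u.app i) :=
  ((Fintype.bijective_iff_surjective_and_card _).2 ⟨u.surj i, by simpa using h⟩).1

lemma Hom.deg_eq_zero_of_injective (u : τ ⟶ σ) (h : ∀ i, Function.Injective (u.app i)) :
    Hom.deg u = 0 := by
  rw [Hom.deg_eq_sum]
  refine Finset.sum_eq_zero fun i _ => ?_
  have : τ.card i = σ.card i := by
    simpa using Fintype.card_of_bijective ⟨h i, u.surj i⟩
  omega

lemma Hom.injective_of_deg_eq_zero (u : τ ⟶ σ) (h : Hom.deg u = 0) (i : ℕ) :
    Function.Injective (u.app i) := by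
  rcases lt_or_ge i n with hi | hi
  · rw [Hom.deg_eq_sum, Finset.sum_eq_zero_iff_of_nonneg] at h
    · have := h i (by simpa using hi)
      exact u.injective_of_card_eq (by omega)
    · intro j _
      have := Hom.card_le u j
      omega
  · exact fun a b _ => subsingleton_of_le τ hi a b

/-- A morphism which merges exactly the two vertices `c`, `c'` of level `i`. -/
structure Hom.IsMerge (v : τ ⟶ σ) (i : ℕ) (c c' : Fin (τ.card i)) : Prop where
  ne : c ≠ c'
  eq : v.app i c = v.app i c'
  inj : ∀ x y, x ≠ c → y ≠ c → v.app i x = v.app i y → x = y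
  inj_of_ne : ∀ j, j ≠ i → Function.Injective (v.app j)

lemma Hom.IsMerge.lt {v : τ ⟶ σ} {i : ℕ} {c c' : Fin (τ.card i)} (h : Hom.IsMerge v i c c') :
    i < n := by
  by_contra hi
  exact h.ne (subsingleton_of_le τ (by omega) c c')

lemma Hom.IsMerge.card_eq {v : τ ⟶ σ} {i : ℕ} {c c' : Fin (τ.card i)} (h : Hom.IsMerge v i c c') :
    τ.card i = σ.card i + 1 := by
  have : Function.Bijective (fun x : {x // x ≠ c} => v.app i x.1) := by
    refine ⟨fun x y hxy => Subtype.ext (h.inj _ _ x.2 y.2 hxy), fun z => ?_⟩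
    obtain ⟨x, rfl⟩ := v.surj i z
    by_cases hx : x = c
    · exact ⟨⟨c', h.ne.symm⟩, by rw [hx, h.eq]⟩
    · exact ⟨⟨x, hx⟩, rfl⟩
  have h1 := Fintype.card_of_bijective this
  simp only [Fintype.card_subtype_compl, Fintype.card_fin, Fintype.card_unique, ne_eq] at h1
  have : 0 < τ.card i := c.pos
  omega

lemma Hom.IsMerge.deg_eq {v : τ ⟶ σ} {i : ℕ} {c c' : Fin (τ.card i)} (h : Hom.IsMerge v i c c') :
    Hom.deg v = 1 := by
  rw [Hom.deg_eq_sum, Finset.sum_eq_single i]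
  · have := h.card_eq
    omega
  · intro j _ hj
    have : τ.card j = σ.card j := by
      simpa using Fintype.card_of_bijective ⟨h.inj_of_ne j hj, v.surj j⟩
    omega
  · intro hi
    exact absurd h.lt (by simpa using hi)

/-- The degree is the sum of the nonnegative losses of vertices on the levels. One coincidence on
level `i` uses it up, so that nothing else can be identified there or elsewhere. -/
lemma Hom.isMerge_of_deg_eq_one {v : τ ⟶ σ} (hv : Hom.deg v = 1) {i : ℕ} {c c' : Fin (τ.card i)}
    (hne : c ≠ c') (he : v.app i c = v.app i c') : Hom.IsMerge v i c c' := by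
  have hi : i < n := by
    by_contra hi
    exact hne (subsingleton_of_le τ (by omega) c c')
  have hlt : σ.card i < τ.card i := by
    refine lt_of_le_of_ne (Hom.card_le v i) fun h => hne (v.injective_of_card_eq h.symm he)
  have hnn : ∀ j ∈ Finset.range n, (0 : ℤ) ≤ (τ.card j : ℤ) - σ.card j := by
    intro j _
    have := Hom.card_le v j
    omega
  have hsum := Finset.add_sum_erase (Finset.range n) (fun j => (τ.card j : ℤ) - σ.card j)
    (a := i) (by simpa using hi)
  rw [← Hom.deg_eq_sum, hv] at hsum
  have hrest : 0 ≤ ∑ j ∈ (Finset.range n).erase i, ((τ.card j : ℤ) - σ.card j) :=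
    Finset.sum_nonneg fun j hj => hnn j (Finset.mem_of_mem_erase hj)
  have hcard : τ.card i = σ.card i + 1 := by omega
  have hzero : ∑ j ∈ (Finset.range n).erase i, ((τ.card j : ℤ) - σ.card j) = 0 := by
    omega
  rw [Finset.sum_eq_zero_iff_of_nonneg fun j hj => hnn j (Finset.mem_of_mem_erase hj)] at hzero
  refine ⟨hne, he, ?_, ?_⟩
  · have hs : Function.Surjective (fun x : {x // x ≠ c} => v.app i x.1) := by
      intro z
      obtain ⟨x, rfl⟩ := v.surj i z
      by_cases hx : x = c
      · exact ⟨⟨c', hne.symm⟩, by rw [hx, he]⟩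
      · exact ⟨⟨x, hx⟩, rfl⟩
    have hb := (Fintype.bijective_iff_surjective_and_card _).2 ⟨hs, by
      simp only [Fintype.card_subtype_compl, Fintype.card_fin, Fintype.card_unique, ne_eq]
      omega⟩
    intro x y hx hy hxy
    exact congrArg Subtype.val (@hb.1 ⟨x, hx⟩ ⟨y, hy⟩ hxy)
  · intro j hj
    rcases lt_or_ge j n with hjn | hjn
    · have := hzero j (by simp [hj, hjn])
      exact v.injective_of_card_eq (by omega)
    · exact fun a b _ => subsingleton_of_le τ hjn a b

lemma Hom.exists_isMerge {v : τ ⟶ σ} (hv : Hom.deg v = 1) :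
    ∃ i c c', c < c' ∧ Hom.IsMerge v i c c' := by
  by_contra! h
  have : Hom.deg v = 0 := by
    refine v.deg_eq_zero_of_injective fun i a b hab => ?_
    by_contra hne
    rcases lt_or_gt_of_ne hne with hl | hl
    · exact h i a b hl (Hom.isMerge_of_deg_eq_one hv hne hab)
    · exact h i b a hl (Hom.isMerge_of_deg_eq_one hv (Ne.symm hne) hab.symm)
  omega

/-- Two vertices merged by a morphism of degree `1` have the same parent. -/
lemma Hom.IsMerge.map_eq {v : τ ⟶ σ} {i : ℕ} {c c' : Fin (τ.card i)} (h : Hom.IsMerge v i c c') :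
    τ.map i c = τ.map i c' :=
  h.inj_of_ne (i + 1) (by omega) (by rw [← v.comm, ← v.comm, h.eq])

/-! ### Lifting through a quotient -/

/-- A criterion for a morphism out of `τ` to factor through another one. -/
lemma exists_comp_eq {u : τ ⟶ σ} {w : τ ⟶ ρ}
    (h : ∀ i a b, u.app i a ≤ u.app i b → u.app (i + 1) (τ.map i b) ≤ u.app (i + 1) (τ.map i a) →
      w.app i a ≤ w.app i b) : ∃ v : σ ⟶ ρ, u ≫ v = w := by
  have h1 : ∀ i a b, u.app i a = u.app i b → w.app i a = w.app i b := by
    intro i a b hab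
    have h2 : u.app (i + 1) (τ.map i a) = u.app (i + 1) (τ.map i b) := by
      rw [← u.comm, ← u.comm, hab]
    exact le_antisymm (h i a b hab.le h2.ge) (h i b a hab.ge h2.le)
  have h2 : ∀ i a, w.app i (Function.surjInv (u.surj i) (u.app i a)) = w.app i a := fun i a =>
    h1 i _ _ (Function.surjInv_eq (u.surj i) _)
  refine ⟨⟨fun i c => w.app i (Function.surjInv (u.surj i) c), fun i z => ?_, fun i c => ?_,
    fun i c c' hc hcc => ?_⟩, ?_⟩
  · obtain ⟨a, rfl⟩ := w.surj i z
    exact ⟨u.app i a, h2 i a⟩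
  · obtain ⟨a, rfl⟩ := u.surj i c
    rw [h2, w.comm, u.comm, h2]
  · obtain ⟨a, rfl⟩ := u.surj i c
    obtain ⟨b, rfl⟩ := u.surj i c'
    rw [h2, h2]
    rw [u.comm, u.comm] at hc
    exact h i a b hcc hc.ge
  · ext i a
    exact congrArg Fin.val (h2 i a)

/-! ### Factorizations as families of preorders -/

/-- The number of elements strictly below `a` is a rank that detects the preorder; numbering its
values without gaps makes it surjective. -/
lemma exists_fin_of_preorder {m : ℕ} (R : Fin m → Fin m → Prop) (ht : ∀ a b, R a b ∨ R b a)
    (htr : ∀ a b c, R a b → R b c → R a c) :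
    ∃ (s : ℕ) (p : Fin m → Fin s), Function.Surjective p ∧ ∀ a b, p a ≤ p b ↔ R a b := by
  classical
  let r : Fin m → ℕ := fun a => (Finset.univ.filter fun c => ¬ R a c).card
  have h1 : ∀ a b, R a b → r a ≤ r b := fun a b hab =>
    Finset.card_le_card fun c hc => by
      simp only [Finset.mem_filter, Finset.mem_univ, true_and] at hc ⊢
      exact fun h => hc (htr a b c hab h)
  have h2 : ∀ a b, ¬ R a b → r b < r a := fun a b hab => by
    have hba := (ht a b).resolve_left hab
    refine Finset.card_lt_card ((Finset.ssubset_iff_of_subset fun c hc => ?_).2 ⟨b, ?_, ?_⟩)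
    · simp only [Finset.mem_filter, Finset.mem_univ, true_and] at hc ⊢
      exact fun h => hc (htr b a c hba h)
    · simpa using hab
    · simpa using (ht b b).elim id id
  let S := Finset.univ.image r
  refine ⟨S.card, fun a => (S.orderIsoOfFin rfl).symm ⟨r a, Finset.mem_image_of_mem _
    (Finset.mem_univ _)⟩, fun c => ?_, fun a b => ?_⟩
  · obtain ⟨a, -, ha⟩ := Finset.mem_image.1 (S.orderIsoOfFin rfl c).2
    refine ⟨a, ?_⟩
    rw [OrderIso.symm_apply_eq]
    exact Subtype.ext ha
  · rw [OrderIso.le_iff_le, Subtype.mk_le_mk]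
    refine ⟨fun h => ?_, h1 a b⟩
    by_contra hab
    exact absurd (h2 a b hab) (by omega)

/-- The families of total preorders on the levels of `τ` which correspond to the factorizations of
`f`. -/
structure IsQuotient (f : τ ⟶ φ) (R : ∀ i, Fin (τ.card i) → Fin (τ.card i) → Prop) : Prop where
  total : ∀ i a b, R i a b ∨ R i b a
  trans : ∀ i a b c, R i a b → R i b c → R i a c
  map : ∀ i a b, R i a b → R (i + 1) (τ.map i a) (τ.map i b)
  sib : ∀ i a b, τ.map i a = τ.map i b → a ≤ b → R i a b
  fib : ∀ i a b, R i a b → R (i + 1) (τ.map i b) (τ.map i a) → f.app i a ≤ f.app i b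

namespace Factorization

variable {f : τ ⟶ φ}

/-- The preorder on the vertices of level `i` induced by a factorization. -/
def le (F : Factorization f) (i : ℕ) (a b : Fin (τ.card i)) : Prop :=
  F.fst.app i a ≤ F.fst.app i b

lemma le_refl (F : Factorization f) (i : ℕ) (a : Fin (τ.card i)) : F.le i a a := _root_.le_refl _

lemma le_total (F : Factorization f) (i : ℕ) (a b : Fin (τ.card i)) : F.le i a b ∨ F.le i b a :=
  _root_.le_total _ _

lemma le_trans (F : Factorization f) {i : ℕ} {a b c : Fin (τ.card i)} (h : F.le i a b)
    (h' : F.le i b c) : F.le i a c :=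
  _root_.le_trans (α := Fin _) h h'

lemma app_eq_iff (F : Factorization f) {i : ℕ} {a b : Fin (τ.card i)} :
    F.fst.app i a = F.fst.app i b ↔ F.le i a b ∧ F.le i b a :=
  le_antisymm_iff

lemma le_map (F : Factorization f) {i : ℕ} {a b : Fin (τ.card i)} (h : F.le i a b) :
    F.le (i + 1) (τ.map i a) (τ.map i b) := by
  unfold le
  rw [← F.fst.comm, ← F.fst.comm]
  exact F.mid.mono i h

lemma le_sib (F : Factorization f) {i : ℕ} {a b : Fin (τ.card i)} (h : τ.map i a = τ.map i b)
    (hab : a ≤ b) : F.le i a b :=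
  F.fst.mono i a b h hab

lemma snd_app (F : Factorization f) (i : ℕ) (a : Fin (τ.card i)) :
    F.snd.app i (F.fst.app i a) = f.app i a := app_eq_of_comp_eq F.comp i a

lemma le_fib (F : Factorization f) {i : ℕ} {a b : Fin (τ.card i)} (h : F.le i a b)
    (h' : F.le (i + 1) (τ.map i b) (τ.map i a)) : f.app i a ≤ f.app i b := by
  rw [← F.snd_app, ← F.snd_app]
  refine F.snd.mono i _ _ ?_ h
  rw [F.fst.comm, F.fst.comm]
  exact le_antisymm (F.le_map h) h'

/-- The intermediate tree has the classes of the preorders as vertices. The field `map` of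
`IsQuotient` makes its structure maps well defined and monotone, `sib` makes the quotient map a
morphism, and `fib` lets `f` descend. -/
lemma exists_of_isQuotient {R : ∀ i, Fin (τ.card i) → Fin (τ.card i) → Prop}
    (hR : IsQuotient f R) : ∃ F : Factorization f, ∀ i a b, F.le i a b ↔ R i a b := by
  choose s p hp hpR using fun i => exists_fin_of_preorder (R i) (hR.total i) (hR.trans i)
  have hmap : ∀ i a b, p i a ≤ p i b → p (i + 1) (τ.map i a) ≤ p (i + 1) (τ.map i b) :=
    fun i a b h => (hpR _ _ _).2 (hR.map i a b ((hpR _ _ _).1 h))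
  have hfib : ∀ i a b, p i a ≤ p i b → p (i + 1) (τ.map i b) ≤ p (i + 1) (τ.map i a) →
      f.app i a ≤ f.app i b := fun i a b h h' =>
    hR.fib i a b ((hpR _ _ _).1 h) ((hpR _ _ _).1 h')
  let g : ∀ i, Fin (s i) → Fin (τ.card i) := fun i => Function.surjInv (hp i)
  have hg : ∀ i c, p i (g i c) = c := fun i => Function.surjInv_eq (hp i)
  let mid : PrunedTree n :=
    { card := s
      map := fun i c => p (i + 1) (τ.map i (g i c))
      mono := fun i c c' h => hmap i _ _ (by rwa [hg, hg])
      surj := fun i c => by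
        obtain ⟨a, rfl⟩ := hp (i + 1) c
        obtain ⟨b, rfl⟩ := τ.surj i a
        exact ⟨p i b, le_antisymm (hmap i _ _ (hg i _).le) (hmap i _ _ (hg i _).ge)⟩
      card_eq_one := fun i hi => by
        have h1 := τ.card_eq_one i hi
        have h2 := Fintype.card_le_of_surjective _ (hp i)
        have h3 := (p i ⟨0, by omega⟩).pos
        simp only [Fintype.card_fin] at h2
        omega }
  have hmid : ∀ i a, mid.map i (p i a) = p (i + 1) (τ.map i a) := fun i a =>
    le_antisymm (hmap i _ _ (hg i _).le) (hmap i _ _ (hg i _).ge)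
  let fst : τ ⟶ mid :=
    { app := p
      surj := hp
      comm := hmid
      mono := fun i a b h hab => (hpR _ _ _).2 (hR.sib i a b h hab) }
  obtain ⟨v, hv⟩ := exists_comp_eq (u := fst) (w := f) hfib
  exact ⟨⟨mid, fst, v, hv⟩, hpR⟩

/-- Levels are modelled on `Fin`, which has no nontrivial order automorphism; hence equal preorders
give equal, and not merely isomorphic, intermediate trees. This rigidity makes every later
uniqueness statement an equality. -/
lemma ext_of_le {F G : Factorization f} (h : ∀ i a b, F.le i a b ↔ G.le i a b) : F = G := by
  have key : ∀ {m c c' : ℕ} (p : Fin m → Fin c) (p' : Fin m → Fin c'), Function.Surjective p →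
      Function.Surjective p' → (∀ a b, p a ≤ p b ↔ p' a ≤ p' b) →
      c = c' ∧ ∀ a, (p a : ℕ) = p' a := by
    intro m c c' p p' hp hp' hpp
    have hpe : ∀ a b, p a = p b ↔ p' a = p' b := fun a b => by
      rw [le_antisymm_iff, le_antisymm_iff, hpp, hpp]
    let q : Fin c → Fin c' := fun x => p' (Function.surjInv hp x)
    have hq : ∀ a, q (p a) = p' a := fun a => (hpe _ _).1 (Function.surjInv_eq hp _)
    have hmono : StrictMono q := by
      intro x y hxy
      obtain ⟨a, rfl⟩ := hp x
      obtain ⟨b, rfl⟩ := hp y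
      rw [hq, hq, ← not_le, ← hpp, not_le]
      exact hxy
    have hsurj : Function.Surjective q := fun z => by
      obtain ⟨a, rfl⟩ := hp' z
      exact ⟨p a, hq a⟩
    have hc : c = c' := by
      simpa using Fintype.card_of_bijective ⟨hmono.injective, hsurj⟩
    subst hc
    refine ⟨rfl, fun a => ?_⟩
    have := Subsingleton.elim (StrictMono.orderIsoOfSurjective q hmono hsurj) (OrderIso.refl _)
    have h2 := DFunLike.congr_fun this (p a)
    rw [← hq]
    exact congrArg Fin.val h2.symm
  obtain ⟨⟨c, m, hm, hs, h1⟩, w, v, hwv⟩ := F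
  obtain ⟨⟨c', m', hm', hs', h1'⟩, w', v', hwv'⟩ := G
  have hk := fun i => key (w.app i) (w'.app i) (w.surj i) (w'.surj i) (h i)
  obtain rfl : c = c' := funext fun i => (hk i).1
  have hww : ∀ i a, w.app i a = w'.app i a := fun i a => Fin.ext ((hk i).2 a)
  obtain rfl : m = m' := by
    funext i x
    obtain ⟨a, rfl⟩ := w.surj i x
    exact (w.comm i a).trans ((hww _ _).trans ((w'.comm i a).symm.trans (by rw [hww])))
  obtain rfl : w = w' := hom_ext hww
  obtain rfl : v = v' := cancel_left (hwv.trans hwv'.symm)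
  rfl

end Factorization

end PrunedTree

namespace PrunedTree

variable {n : ℕ} {τ σ ρ φ : PrunedTree n}

namespace Factorization

variable {f : τ ⟶ φ}

/-! ### Critical vertices -/

/-- No other vertex has the same image as `a` in the intermediate tree. -/
def Alone (F : Factorization f) (i : ℕ) (a : Fin (τ.card i)) : Prop :=
  ∀ b, F.le i a b → F.le i b a → b = a

/-- The siblings of `a` in the intermediate tree which have the same image in `φ` and do not lie
at the left of `a` have a smaller index than `a` in `τ`. -/
def Last (F : Factorization f) (i : ℕ) (a : Fin (τ.card i)) : Prop :=
  ∀ b, F.le (i + 1) (τ.map i a) (τ.map i b) → F.le (i + 1) (τ.map i b) (τ.map i a) →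
    f.app i b = f.app i a → F.le i a b → b ≤ a

/-- A vertex is critical for a factorization if it can neither be split off to the left nor be
merged with its right neighbour. -/
def Crit (F : Factorization f) (i : ℕ) (a : Fin (τ.card i)) : Prop := F.Alone i a ∧ F.Last i a

/-- All vertices of the levels `< i` are critical. -/
def CritBelow (F : Factorization f) (i : ℕ) : Prop := ∀ j, j < i → ∀ a, F.Crit j a

/-- The first vertex which is not critical. -/
structure FirstNonCrit (F : Factorization f) (i : ℕ) (l : Fin (τ.card i)) : Prop where
  not_crit : ¬ F.Crit i l
  crit : ∀ a, a < l → F.Crit i a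
  below : F.CritBelow i

/-- Siblings in `τ` appear in increasing order in every intermediate tree, while criticality puts
vertices with the same image in decreasing order. If all vertices were critical, `f` would therefore
be injective, level by level starting from the root. -/
lemma exists_firstNonCrit (hf : Hom.deg f ≠ 0) (F : Factorization f) :
    ∃ i l, F.FirstNonCrit i l := by
  classical
  have h1 : ∃ i, ∃ a, ¬ F.Crit i a := by
    by_contra! h
    refine hf (f.deg_eq_zero_of_injective ?_)
    have h2 : ∀ d i, n ≤ i + d → Function.Injective (f.app i) := by
      intro d
      induction d with
      | zero => exact fun i hi a b _ => subsingleton_of_le τ hi a b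
      | succ d ih =>
        intro i hi
        have key : ∀ a b, f.app i a = f.app i b → a ≤ b → b ≤ a := by
          intro a b hab hle
          have h3 : τ.map i a = τ.map i b :=
            ih (i + 1) (by omega) (by rw [← f.comm, ← f.comm, hab])
          exact (h i a).2 b (h3 ▸ F.le_refl _ _) (h3 ▸ F.le_refl _ _) hab.symm (F.le_sib h3 hle)
        intro a b hab
        rcases _root_.le_total a b with hl | hl
        · exact le_antisymm hl (key a b hab hl)
        · exact le_antisymm (key b a hab.symm hl) hl
    exact fun i => h2 n i (by omega)
  let i := Nat.find h1
  have h2 : (Finset.univ.filter fun a => ¬ F.Crit i a).Nonempty := by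
    obtain ⟨a, ha⟩ := Nat.find_spec h1
    exact ⟨a, by simpa using ha⟩
  refine ⟨i, (Finset.univ.filter fun a => ¬ F.Crit i a).min' h2, ?_, ?_, ?_⟩
  · simpa using Finset.min'_mem _ h2
  · intro a ha
    by_contra h
    exact absurd (Finset.min'_le (Finset.univ.filter fun a => ¬ F.Crit i a) a (by simpa using h))
      (not_le.2 ha)
  · intro j hj a
    by_contra h
    exact Nat.find_min h1 hj ⟨a, h⟩

lemma FirstNonCrit.eq {F : Factorization f} {i j : ℕ} {l : Fin (τ.card i)} {m : Fin (τ.card j)}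
    (h : F.FirstNonCrit i l) (h' : F.FirstNonCrit j m) :
    (⟨i, l⟩ : Σ i, Fin (τ.card i)) = ⟨j, m⟩ := by
  rcases lt_trichotomy i j with hij | rfl | hij
  · exact absurd (h'.below i hij l) h.not_crit
  · rcases lt_trichotomy l m with hl | rfl | hl
    · exact absurd (h'.crit l hl) h.not_crit
    · rfl
    · exact absurd (h.crit m hl) h'.not_crit
  · exact absurd (h.below j hij m) h'.not_crit

/-- The comparison of vertices with the same parent if all vertices are critical. -/
def SibLE (f : τ ⟶ φ) (i : ℕ) (a b : Fin (τ.card i)) : Prop :=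
  f.app i a < f.app i b ∨ (f.app i a = f.app i b ∧ b ≤ a)

lemma SibLE.antisymm {i : ℕ} {a b : Fin (τ.card i)} (h : SibLE f i a b) (h' : SibLE f i b a) :
    a = b := by
  rcases h with h | ⟨h, hl⟩ <;> rcases h' with h' | ⟨h', hl'⟩
  · exact absurd h' (not_lt.2 h.le)
  · exact absurd h (h'.symm ▸ lt_irrefl _)
  · exact absurd h' (h ▸ lt_irrefl _)
  · exact le_antisymm hl' hl

lemma sibLE_total (f : τ ⟶ φ) (i : ℕ) (a b : Fin (τ.card i)) : SibLE f i a b ∨ SibLE f i b a := by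
  rcases lt_trichotomy (f.app i a) (f.app i b) with h | h | h
  · exact Or.inl (Or.inl h)
  · rcases _root_.le_total a b with hl | hl
    · exact Or.inr (Or.inr ⟨h.symm, hl⟩)
    · exact Or.inl (Or.inr ⟨h, hl⟩)
  · exact Or.inr (Or.inl h)

lemma SibLE.trans {i : ℕ} {a b c : Fin (τ.card i)} (h : SibLE f i a b) (h' : SibLE f i b c) :
    SibLE f i a c := by
  rcases h with h | ⟨h, hl⟩ <;> rcases h' with h' | ⟨h', hl'⟩
  · exact Or.inl (h.trans h')
  · exact Or.inl (h' ▸ h)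
  · exact Or.inl (h ▸ h')
  · exact Or.inr ⟨h.trans h', hl'.trans hl⟩

/-- On critical levels there is no freedom: classes are singletons, and vertices over the same
parent are sorted by their image in `φ` and then by decreasing index. The preorder is thus recovered
from the next level. -/
lemma le_iff_of_critBelow {F : Factorization f} {i : ℕ} (h : F.CritBelow i) {j : ℕ} (hj : j < i)
    (a b : Fin (τ.card j)) :
    F.le j a b ↔ F.le (j + 1) (τ.map j a) (τ.map j b) ∧
      (F.le (j + 1) (τ.map j b) (τ.map j a) → SibLE f j a b) := by
  refine ⟨fun hab => ⟨F.le_map hab, fun hba => ?_⟩, fun ⟨h1, h2⟩ => ?_⟩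
  · rcases (F.le_fib hab hba).lt_or_eq with hl | he
    · exact Or.inl hl
    · exact Or.inr ⟨he, (h j hj a).2 b (F.le_map hab) hba he.symm hab⟩
  · rcases F.le_total j a b with hab | hab
    · exact hab
    · have h3 := F.le_map hab
      rcases h2 h3 with hl | ⟨he, hl⟩
      · exact absurd (F.le_fib hab h1) (not_le.2 hl)
      · have : a = b := le_antisymm ((h j hj b).2 a h3 h1 he hab) hl
        rw [this]
        exact F.le_refl _ _

lemma critBelow_of_le_iff {F : Factorization f} {i : ℕ} (h : ∀ j, j < i → ∀ a b : Fin (τ.card j),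
    F.le j a b ↔ F.le (j + 1) (τ.map j a) (τ.map j b) ∧
      (F.le (j + 1) (τ.map j b) (τ.map j a) → SibLE f j a b)) : F.CritBelow i := by
  intro j hj a
  refine ⟨fun b hab hba => ?_, fun b hab hba he hl => ?_⟩
  · exact (((h j hj b a).1 hba).2 (F.le_map hab)).antisymm (((h j hj a b).1 hab).2 (F.le_map hba))
  · rcases ((h j hj a b).1 hl).2 hba with h1 | h1
    · exact absurd h1 (he ▸ lt_irrefl _)
    · exact h1.2

/-- A factorization whose vertices of level `< i` are critical is determined by the levels `≥ i`. -/
lemma ext_of_critBelow {F G : Factorization f} {i : ℕ} (hF : F.CritBelow i) (hG : G.CritBelow i)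
    (h : ∀ j, i ≤ j → ∀ a b, F.le j a b ↔ G.le j a b) : F = G := by
  have key : ∀ d j, i ≤ j + d → ∀ a b, F.le j a b ↔ G.le j a b := by
    intro d
    induction d with
    | zero => exact fun j hj => h j hj
    | succ d ih =>
      intro j hj a b
      rcases le_or_gt i j with hij | hij
      · exact h j hij a b
      · rw [le_iff_of_critBelow hF hij, le_iff_of_critBelow hG hij,
          ih (j + 1) (by omega), ih (j + 1) (by omega)]
  exact ext_of_le fun j => key i j (by omega)

/-! ### Modification of a factorization at one level -/

open Classical in
/-- The relations which agree with `S` on the levels `≥ i` and for which the vertices of the levels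
`< i` are critical. -/
def lowerRel (f : τ ⟶ φ) (i : ℕ) (S : ∀ j, Fin (τ.card j) → Fin (τ.card j) → Prop) (j : ℕ)
    (a b : Fin (τ.card j)) : Prop :=
  if i ≤ j then S j a b
  else lowerRel f i S (j + 1) (τ.map j a) (τ.map j b) ∧
    (lowerRel f i S (j + 1) (τ.map j b) (τ.map j a) → SibLE f j a b)
termination_by i - j

lemma lowerRel_of_le (i : ℕ) (S : ∀ j, Fin (τ.card j) → Fin (τ.card j) → Prop) {j : ℕ}
    (h : i ≤ j) : lowerRel f i S j = S j := by
  funext a b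
  rw [lowerRel, if_pos h]

lemma lowerRel_of_lt (i : ℕ) (S : ∀ j, Fin (τ.card j) → Fin (τ.card j) → Prop) {j : ℕ}
    (h : j < i) (a b : Fin (τ.card j)) : lowerRel f i S j a b ↔
      lowerRel f i S (j + 1) (τ.map j a) (τ.map j b) ∧
        (lowerRel f i S (j + 1) (τ.map j b) (τ.map j a) → SibLE f j a b) := by
  rw [lowerRel, if_neg (not_le.2 h)]

/-- The assumption `inj` is what reconciles the decreasing order imposed by `SibLE` with the
increasing order of the siblings in `τ`. -/
lemma isQuotient_lowerRel {i : ℕ} {S : ∀ j, Fin (τ.card j) → Fin (τ.card j) → Prop}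
    (total : ∀ j, i ≤ j → ∀ a b, S j a b ∨ S j b a)
    (trans : ∀ j, i ≤ j → ∀ a b c, S j a b → S j b c → S j a c)
    (map : ∀ j, i ≤ j → ∀ a b, S j a b → S (j + 1) (τ.map j a) (τ.map j b))
    (sib : ∀ j, i ≤ j → ∀ a b, τ.map j a = τ.map j b → a ≤ b → S j a b)
    (fib : ∀ j, i ≤ j → ∀ a b, S j a b → S (j + 1) (τ.map j b) (τ.map j a) → f.app j a ≤ f.app j b)
    (inj : ∀ j, j < i → ∀ a b, τ.map j a = τ.map j b → f.app j a = f.app j b → a = b) :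
    IsQuotient f (lowerRel f i S) := by
  have ht : ∀ d j, i ≤ j + d → ∀ a b, lowerRel f i S j a b ∨ lowerRel f i S j b a := by
    intro d
    induction d with
    | zero =>
      intro j hj
      rw [lowerRel_of_le i S (by omega : i ≤ j)]
      exact total j hj
    | succ d ih =>
      intro j hj a b
      rcases le_or_gt i j with hij | hij
      · rw [lowerRel_of_le i S hij]
        exact total j hij a b
      · rw [lowerRel_of_lt i S hij, lowerRel_of_lt i S hij]
        have h1 := ih (j + 1) (by omega) (τ.map j a) (τ.map j b)
        have h2 := sibLE_total f j a b
        by_cases h3 : lowerRel f i S (j + 1) (τ.map j a) (τ.map j b) <;>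
          by_cases h4 : lowerRel f i S (j + 1) (τ.map j b) (τ.map j a) <;> simp_all
  have htr : ∀ d j, i ≤ j + d → ∀ a b c, lowerRel f i S j a b → lowerRel f i S j b c →
      lowerRel f i S j a c := by
    intro d
    induction d with
    | zero =>
      intro j hj
      rw [lowerRel_of_le i S (by omega : i ≤ j)]
      exact trans j hj
    | succ d ih =>
      intro j hj a b c
      rcases le_or_gt i j with hij | hij
      · rw [lowerRel_of_le i S hij]
        exact trans j hij a b c
      · rw [lowerRel_of_lt i S hij, lowerRel_of_lt i S hij, lowerRel_of_lt i S hij]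
        rintro ⟨h1, h2⟩ ⟨h3, h4⟩
        have ih := ih (j + 1) (by omega)
        exact ⟨ih _ _ _ h1 h3, fun h5 => (h2 (ih _ _ _ h3 h5)).trans (h4 (ih _ _ _ h5 h1))⟩
  refine ⟨fun j => ht i j (by omega), fun j => htr i j (by omega), fun j a b h => ?_,
    fun j a b hab hl => ?_, fun j a b h h' => ?_⟩
  · rcases le_or_gt i j with hij | hij
    · rw [lowerRel_of_le i S hij] at h
      rw [lowerRel_of_le i S (by omega : i ≤ j + 1)]
      exact map j hij a b h
    · exact ((lowerRel_of_lt i S hij a b).1 h).1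
  · rcases le_or_gt i j with hij | hij
    · rw [lowerRel_of_le i S hij]
      exact sib j hij a b hab hl
    · rw [lowerRel_of_lt i S hij, hab]
      refine ⟨(ht i (j + 1) (by omega) _ _).elim id id, fun _ => ?_⟩
      rcases (f.mono j a b hab hl).lt_or_eq with h | h
      · exact Or.inl h
      · exact Or.inr ⟨h, (inj j hij a b hab h).ge⟩
  · rcases le_or_gt i j with hij | hij
    · rw [lowerRel_of_le i S hij] at h
      rw [lowerRel_of_le i S (by omega : i ≤ j + 1)] at h'
      exact fib j hij a b h h'
    · rcases ((lowerRel_of_lt i S hij a b).1 h).2 h' with h | h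
      · exact h.le
      · exact h.1.le

/-- The preorder at the level `i` of a factorization can be replaced by another one if all the
vertices of lower level are critical. -/
lemma exists_modify {F : Factorization f} {i : ℕ} (hF : F.CritBelow i)
    {R : Fin (τ.card i) → Fin (τ.card i) → Prop}
    (total : ∀ a b, R a b ∨ R b a) (trans : ∀ a b c, R a b → R b c → R a c)
    (map : ∀ a b, R a b → F.le (i + 1) (τ.map i a) (τ.map i b))
    (sib : ∀ a b, τ.map i a = τ.map i b → a ≤ b → R a b)
    (fib : ∀ a b, R a b → F.le (i + 1) (τ.map i b) (τ.map i a) → f.app i a ≤ f.app i b) :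
    ∃ G : Factorization f, G.CritBelow i ∧ (∀ a b, G.le i a b ↔ R a b) ∧
      ∀ j, i < j → ∀ a b, G.le j a b ↔ F.le j a b := by
  let S := Function.update F.le i R
  have hS : S i = R := Function.update_self ..
  have hS' : ∀ j, i < j → S j = F.le j := fun j hj => Function.update_of_ne hj.ne' ..
  have hq : IsQuotient f (lowerRel f i S) := by
    refine isQuotient_lowerRel (fun j hj => ?_) (fun j hj => ?_) (fun j hj => ?_) (fun j hj => ?_)
      (fun j hj => ?_) (fun j hj a b hab he => ?_)
    · rcases hj.eq_or_lt with rfl | hj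
      · rwa [hS]
      · rw [hS' j hj]
        exact F.le_total j
    · rcases hj.eq_or_lt with rfl | hj
      · rwa [hS]
      · rw [hS' j hj]
        exact fun a b c => F.le_trans
    · rw [hS' (j + 1) (by omega)]
      rcases hj.eq_or_lt with rfl | hj
      · rwa [hS]
      · rw [hS' j hj]
        exact fun a b => F.le_map
    · rcases hj.eq_or_lt with rfl | hj
      · rwa [hS]
      · rw [hS' j hj]
        exact fun a b => F.le_sib
    · rw [hS' (j + 1) (by omega)]
      rcases hj.eq_or_lt with rfl | hj
      · rwa [hS]
      · rw [hS' j hj]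
        exact fun a b => F.le_fib
    -- Criticality in `F` of the levels below `i` supplies the injectivity on siblings, so the
    -- rebuilt levels need no further condition.
    · have key : ∀ a b, τ.map j a = τ.map j b → f.app j a = f.app j b → a ≤ b → b ≤ a := by
        intro a b hab he hl
        exact (hF j hj a).2 b (hab ▸ F.le_refl _ _) (hab ▸ F.le_refl _ _) he.symm (F.le_sib hab hl)
      rcases _root_.le_total a b with hl | hl
      · exact le_antisymm hl (key a b hab he hl)
      · exact le_antisymm (key b a hab.symm he.symm hl) hl
  obtain ⟨G, hG⟩ := exists_of_isQuotient hq
  refine ⟨G, critBelow_of_le_iff fun j hj a b => ?_, fun a b => ?_, fun j hj a b => ?_⟩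
  · rw [hG, hG, hG, lowerRel_of_lt i S hj]
  · rw [hG, lowerRel_of_le i S _root_.le_rfl, hS]
  · rw [hG, lowerRel_of_le i S hj.le, hS' j hj]

/-! ### The matching -/

/-- `G` is obtained from `F` by splitting off its first noncritical vertex `l` to the left. -/
structure IsSplit (F G : Factorization f) (i : ℕ) (l : Fin (τ.card i)) : Prop where
  first : F.FirstNonCrit i l
  not_alone : ¬ F.Alone i l
  first' : G.FirstNonCrit i l
  alone : G.Alone i l
  above : ∀ j, i < j → ∀ a b, G.le j a b ↔ F.le j a b
  le_iff : ∀ a b, G.le i a b ↔ F.le i a b ∧ (b = l → F.le i l a → a = l)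

/-- The vertices equivalent to `l` all have a larger index, since a smaller one would be critical
and hence alone. Splitting `l` off to their left therefore respects the order of siblings, and
leaves `l` noncritical, because such a vertex now violates `Last`. -/
lemma exists_isSplit {F : Factorization f} {i : ℕ} {l : Fin (τ.card i)} (h : F.FirstNonCrit i l)
    (hl : ¬ F.Alone i l) : ∃ G, IsSplit F G i l := by
  have hmod : ∃ G : Factorization f, G.CritBelow i ∧ (∀ a b, G.le i a b ↔
      F.le i a b ∧ (b = l → F.le i l a → a = l)) ∧
      ∀ j, i < j → ∀ a b, G.le j a b ↔ F.le j a b := by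
    refine exists_modify h.below
      (R := fun a b => F.le i a b ∧ (b = l → F.le i l a → a = l)) (fun a b => ?_)
      (fun a b c hab hbc => ?_) (fun a b hab => F.le_map hab.1) (fun a b hab hle => ?_)
      (fun a b hab hba => F.le_fib hab.1 hba)
    · by_cases h1 : F.le i a b ∧ (b = l → F.le i l a → a = l)
      · exact Or.inl h1
      · by_cases h2 : F.le i a b
        · simp only [h2, true_and, Classical.not_imp] at h1
          obtain ⟨rfl, h3, h4⟩ := h1
          exact Or.inr ⟨h3, fun h => absurd h h4⟩
        · refine Or.inr ⟨(F.le_total i a b).resolve_left h2, fun ha hb => ?_⟩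
          subst ha
          exact absurd hb h2
    · refine ⟨F.le_trans hab.1 hbc.1, fun hc hla => ?_⟩
      have := hbc.2 hc (F.le_trans hla hab.1)
      exact hab.2 this hla
    -- A sibling of `l` with a smaller index is alone, so it was not in the class of `l`.
    · refine ⟨F.le_sib hab hle, fun hb hla => ?_⟩
      subst hb
      by_contra hne
      exact hne ((h.crit a (lt_of_le_of_ne hle hne)).1 b (F.le_sib hab hle) hla).symm
  obtain ⟨G, hG, hGi, hGa⟩ := hmod
  have halone : G.Alone i l := fun b h1 h2 =>
    ((hGi b l).1 h2).2 rfl ((hGi l b).1 h1).1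
  refine ⟨G, h, hl, ⟨fun hc => ?_, fun a ha => ⟨fun b h1 h2 => ?_, fun b h1 h2 h3 h4 => ?_⟩, hG⟩,
    halone, hGa, hGi⟩
  · simp only [Alone, not_forall] at hl
    obtain ⟨b, h1, h2, h3⟩ := hl
    have hlb : ¬ b ≤ l := fun hbl => h3 ((h.crit b (lt_of_le_of_ne hbl h3)).1 l h2 h1).symm
    refine hlb (hc.2 b ?_ ?_ ?_ ?_)
    · rw [hGa _ (by omega)]
      exact F.le_map h1
    · rw [hGa _ (by omega)]
      exact F.le_map h2
    · exact le_antisymm (F.le_fib h2 (F.le_map h1)) (F.le_fib h1 (F.le_map h2))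
    · exact (hGi _ _).2 ⟨h1, fun hb => absurd hb h3⟩
  · exact (h.crit a ha).1 b ((hGi _ _).1 h1).1 ((hGi _ _).1 h2).1
  · rw [hGa _ (by omega)] at h1 h2
    exact (h.crit a ha).2 b h1 h2 h3 ((hGi _ _).1 h4).1

/-- As `l` is alone but not critical, some `b₀ > l` on its right has an equivalent parent and the
same image. The class just to the right of `l` lies between `l` and `b₀`, so it also has this parent
and this image, and `l` can be merged with it. -/
lemma exists_isSplit' {G : Factorization f} {i : ℕ} {l : Fin (τ.card i)} (h : G.FirstNonCrit i l)
    (hl : G.Alone i l) : ∃ F, IsSplit F G i l := by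
  obtain ⟨b₀, hb1, hb2, hb3, hb4, hb5⟩ : ∃ b, G.le (i + 1) (τ.map i l) (τ.map i b) ∧
      G.le (i + 1) (τ.map i b) (τ.map i l) ∧ f.app i b = f.app i l ∧ G.le i l b ∧ l < b := by
    by_contra! hc
    refine h.not_crit ⟨hl, fun b h1 h2 h3 h4 => hc b h1 h2 h3 h4⟩
  have hne : b₀ ≠ l := hb5.ne'
  have hnext : ∀ a, (∀ c, G.le i l c → c ≠ l → G.le i a c) → G.le i a b₀ :=
    fun a ha => ha b₀ hb4 hne
  have hmod : ∃ F : Factorization f, F.CritBelow i ∧ (∀ a b, F.le i a b ↔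
      G.le i a b ∨ (b = l ∧ ∀ c, G.le i l c → c ≠ l → G.le i a c)) ∧
      ∀ j, i < j → ∀ a b, F.le j a b ↔ G.le j a b := by
    refine exists_modify h.below
      (R := fun a b => G.le i a b ∨ (b = l ∧ ∀ c, G.le i l c → c ≠ l → G.le i a c))
      (fun a b => (G.le_total i a b).imp Or.inl Or.inl) (fun a b c hab hbc => ?_) (fun a b hab => ?_)
      (fun a b hab hle => Or.inl (G.le_sib hab hle)) (fun a b hab hba => ?_)
    · rcases hab with hab | ⟨rfl, hab⟩
      · rcases hbc with hbc | ⟨rfl, hbc⟩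
        · exact Or.inl (G.le_trans hab hbc)
        · exact Or.inr ⟨rfl, fun x hx hx' => G.le_trans hab (hbc x hx hx')⟩
      · rcases hbc with hbc | ⟨rfl, hbc⟩
        · by_cases hc : c = b
          · exact Or.inr ⟨hc, hab⟩
          · exact Or.inl (hab c hbc hc)
        · exact Or.inr ⟨rfl, hab⟩
    · rcases hab with hab | ⟨rfl, hab⟩
      · exact G.le_map hab
      · exact G.le_trans (G.le_map (hnext a hab)) hb2
    · rcases hab with hab | ⟨rfl, hab⟩
      · exact G.le_fib hab hba
      · exact hb3 ▸ G.le_fib (hnext a hab) (G.le_trans hb2 hba)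
  obtain ⟨F, hF, hFi, hFa⟩ := hmod
  have hnotalone : ¬ F.Alone i l := by
    -- `c` represents the immediate right neighbour of `l` in `G`.
    obtain ⟨c, hc, hc'⟩ := Set.exists_min_image {c | G.le i l c ∧ c ≠ l} (fun c => G.fst.app i c)
      (Set.toFinite _) ⟨b₀, hb4, hne⟩
    intro hal
    exact hc.2 (hal c ((hFi _ _).2 (Or.inl hc.1))
      ((hFi _ _).2 (Or.inr ⟨rfl, fun x hx hx' => hc' x ⟨hx, hx'⟩⟩)))
  -- The vertices before `l` stay critical: if such an `a` lay at or before the neighbour of `l`,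
  -- with the parent and the image of `l`, then `Last` for `a` would give `b₀ ≤ a`, although `a < l
  -- < b₀`.
  have haux : ∀ a, a < l → (∀ c, G.le i l c → c ≠ l → G.le i a c) → f.app i a = f.app i l →
      G.le (i + 1) (τ.map i l) (τ.map i a) → False := by
    intro a ha h1 h2 h3
    have h4 := hnext a h1
    have h5 := (h.crit a ha).2 b₀ (G.le_map h4) (G.le_trans hb2 h3) (hb3.trans h2.symm) h4
    exact absurd (lt_of_le_of_lt h5 (ha.trans hb5)) (lt_irrefl _)
  refine ⟨F, ⟨fun hc => hnotalone hc.1, fun a ha => ⟨fun b h1 h2 => ?_,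
    fun b h1 h2 h3 h4 => ?_⟩, hF⟩, hnotalone, h, hl, fun j hj a b => (hFa j hj a b).symm, ?_⟩
  · rw [hFi] at h1 h2
    rcases h2 with h2 | ⟨rfl, -⟩
    · rcases h1 with h1 | ⟨rfl, h1⟩
      · exact (h.crit a ha).1 b h1 h2
      · refine (haux a ha h1 (le_antisymm ?_ ?_) (G.le_map h2)).elim
        · have h4 := hnext a h1
          exact hb3 ▸ G.le_fib h4 (G.le_trans hb2 (G.le_map h2))
        · exact G.le_fib h2 (G.le_trans (G.le_map (hnext a h1)) hb2)
    · exact absurd ha (lt_irrefl _)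
  · rw [hFa _ (by omega)] at h1 h2
    rcases (hFi _ _).1 h4 with h4 | ⟨rfl, h4⟩
    · exact (h.crit a ha).2 b h1 h2 h3 h4
    · exact (haux a ha h4 h3.symm h2).elim
  · intro a b
    rw [hFi, hFi]
    constructor
    · refine fun hab => ⟨Or.inl hab, ?_⟩
      rintro rfl (h1 | ⟨rfl, -⟩)
      · exact hl a h1 hab
      · rfl
    · rintro ⟨h1 | ⟨rfl, h1⟩, h2⟩
      · exact h1
      · rcases G.le_total i a b with h3 | h3
        · exact h3
        · rw [h2 rfl (Or.inl h3)]
          exact G.le_refl _ _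

lemma IsSplit.right_unique {F G G' : Factorization f} {i : ℕ} {l : Fin (τ.card i)}
    (h : IsSplit F G i l) (h' : IsSplit F G' i l) : G = G' := by
  refine ext_of_critBelow h.first'.below h'.first'.below fun j hj a b => ?_
  rcases hj.eq_or_lt with rfl | hj
  · rw [h.le_iff, h'.le_iff]
  · rw [h.above j hj, h'.above j hj]

/-- `G` determines all comparisons `F.le i a b` with `b ≠ l`. A comparison with `l` is the
comparison with another member `c` of its class, which exists because `l` is not alone. -/
lemma IsSplit.left_unique {F F' G : Factorization f} {i : ℕ} {l : Fin (τ.card i)}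
    (h : IsSplit F G i l) (h' : IsSplit F' G i l) : F = F' := by
  have key : ∀ {F F' : Factorization f}, IsSplit F G i l → IsSplit F' G i l →
      ∀ a b, F.le i a b → F'.le i a b := by
    intro F F' h h' a b hab
    have h1 : ∀ a b, b ≠ l → (F.le i a b ↔ F'.le i a b) := fun a b hb => by
      have h2 := h.le_iff a b
      have h3 := h'.le_iff a b
      simp only [hb, false_imp_iff, and_true] at h2 h3
      rw [← h2, h3]
    by_cases hb : b = l
    · subst hb
      by_contra hab'
      have h3 := (F'.le_total i a b).resolve_left hab'
      have hne : a ≠ b := fun h => hab' (h ▸ F'.le_refl _ _)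
      have hna := h'.not_alone
      simp only [Alone, not_forall] at hna
      obtain ⟨c, h4, h5, h6⟩ := hna
      have h7 : ¬ F.le i a c := fun h8 => hab' (F'.le_trans ((h1 a c h6).1 h8) h5)
      exact h7 (F.le_trans hab ((h1 b c h6).2 h4))
    · exact (h1 a b hb).1 hab
  refine ext_of_critBelow h.first.below h'.first.below fun j hj a b => ?_
  rcases hj.eq_or_lt with rfl | hj
  · exact ⟨key h h' a b, key h' h a b⟩
  · rw [← h.above j hj, ← h'.above j hj]

/-! ### Refinement of factorizations and acyclicity of the matching -/

/-- `G` refines `F` by one merging of two vertices. -/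
def Covers (F G : Factorization f) : Prop :=
  ∃ v : G.mid ⟶ F.mid, G.fst ≫ v = F.fst ∧ Hom.deg v = 1

/-- On level `i` only `l` is reunited with its class. Above it nothing changes, and below it the
rebuilt levels have singleton classes on both sides; so the comparison map merges exactly one pair.
-/
lemma IsSplit.covers {F G : Factorization f} {i : ℕ} {l : Fin (τ.card i)} (h : IsSplit F G i l) :
    Covers F G := by
  have hii : ∀ a b, G.le i a b → F.le i a b := fun a b hab => ((h.le_iff a b).1 hab).1
  have hlt : ∀ j, j < i → ∀ a b, G.le j a b → G.le j b a → a = b := fun j hj a b hab hba =>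
    (h.first'.below j hj b).1 a hba hab
  obtain ⟨v, hv⟩ : ∃ v : G.mid ⟶ F.mid, G.fst ≫ v = F.fst := by
    refine exists_comp_eq fun j a b hab hba => ?_
    change G.le j a b at hab
    change G.le (j + 1) _ _ at hba
    change F.le j a b
    rcases lt_trichotomy j i with hj | rfl | hj
    · rw [le_iff_of_critBelow h.first.below hj]
      refine ⟨?_, fun _ => ((le_iff_of_critBelow h.first'.below hj a b).1 hab).2 hba⟩
      rcases (Nat.succ_le_of_lt hj).lt_or_eq with hj' | hj'
      · rw [hlt (j + 1) hj' _ _ (G.le_map hab) hba]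
        exact F.le_refl _ _
      · subst hj'
        exact hii _ _ (G.le_map hab)
    · exact hii a b hab
    · exact (h.above j hj a b).1 hab
  refine ⟨v, hv, ?_⟩
  have hva : ∀ j a, v.app j (G.fst.app j a) = F.fst.app j a := app_eq_of_comp_eq hv
  have hna := h.not_alone
  simp only [Alone, not_forall] at hna
  obtain ⟨b, h1, h2, h3⟩ := hna
  refine Hom.IsMerge.deg_eq (i := i) (c := G.fst.app i l) (c' := G.fst.app i b) ⟨?_, ?_, ?_, ?_⟩
  · intro he
    exact h3 (h.alone b (G.app_eq_iff.1 he).1 (G.app_eq_iff.1 he).2)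
  · rw [hva, hva]
    exact F.app_eq_iff.2 ⟨h1, h2⟩
  · intro x y hx hy hxy
    obtain ⟨a, rfl⟩ := G.fst.surj i x
    obtain ⟨c, rfl⟩ := G.fst.surj i y
    have ha : a ≠ l := fun h => hx (h ▸ rfl)
    have hc : c ≠ l := fun h => hy (h ▸ rfl)
    rw [hva, hva, F.app_eq_iff] at hxy
    rw [G.app_eq_iff, h.le_iff, h.le_iff]
    exact ⟨⟨hxy.1, fun h => absurd h hc⟩, hxy.2, fun h => absurd h ha⟩
  · intro j hj x y hxy
    obtain ⟨a, rfl⟩ := G.fst.surj j x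
    obtain ⟨c, rfl⟩ := G.fst.surj j y
    rw [hva, hva, F.app_eq_iff] at hxy
    rcases lt_or_gt_of_ne hj with hj | hj
    · rw [(h.first.below j hj c).1 a hxy.2 hxy.1]
    · rw [G.app_eq_iff, h.above j hj, h.above j hj]
      exact hxy

/-- Refining makes fewer vertices equivalent, so both `Alone` and `Last` have less to check; `Last`
also uses that `v` is nondecreasing over a fixed parent. -/
lemma Crit.of_comp {F G : Factorization f} {v : G.mid ⟶ F.mid} (hv : G.fst ≫ v = F.fst) {i : ℕ}
    {a : Fin (τ.card i)} (h : F.Crit i a) : G.Crit i a := by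
  have hva : ∀ j a, v.app j (G.fst.app j a) = F.fst.app j a := app_eq_of_comp_eq hv
  have heq : ∀ j a b, G.le j a b → G.le j b a → F.le j a b ∧ F.le j b a := fun j a b hab hba => by
    rw [← F.app_eq_iff, ← hva, ← hva, G.app_eq_iff.2 ⟨hab, hba⟩]
  refine ⟨fun b h1 h2 => ?_, fun b h1 h2 h3 h4 => ?_⟩
  · have := heq _ _ _ h1 h2
    exact h.1 b this.1 this.2
  · have := heq _ _ _ h1 h2
    refine h.2 b this.1 this.2 h3 ?_
    unfold le
    rw [← hva, ← hva]
    refine v.mono i _ _ ?_ h4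
    rw [G.fst.comm, G.fst.comm]
    exact le_antisymm h1 h2

/-- The first noncritical vertex does not decrease under refinement. -/
lemma FirstNonCrit.le_of_comp {F G : Factorization f} {v : G.mid ⟶ F.mid} (hv : G.fst ≫ v = F.fst)
    {i j : ℕ} {l : Fin (τ.card i)} {m : Fin (τ.card j)} (h : F.FirstNonCrit i l)
    (h' : G.FirstNonCrit j m) : i < j ∨ ∃ e : i = j, l ≤ e ▸ m := by
  rcases lt_trichotomy i j with hij | rfl | hij
  · exact Or.inl hij
  · refine Or.inr ⟨rfl, ?_⟩
    by_contra hlt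
    exact h'.not_crit ((h.crit m (not_le.1 hlt)).of_comp hv)
  · exact absurd ((h.below j hij m).of_comp hv) h'.not_crit

open Classical in
/-- The number of vertices of level `i` at the left of `l`. -/
noncomputable def pos (F : Factorization f) (i : ℕ) (l : Fin (τ.card i)) : ℕ :=
  (Finset.univ.filter fun a => ¬ F.le i l a).card

lemma IsSplit.pos_eq {F G : Factorization f} {i : ℕ} {l : Fin (τ.card i)} (h : IsSplit F G i l) :
    F.pos i l = G.pos i l := by
  have : ∀ a, F.le i l a ↔ G.le i l a := fun a => by
    rw [h.le_iff]
    exact ⟨fun h => ⟨h, fun _ _ => rfl⟩, fun h => h.1⟩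
  unfold pos
  congr 1
  ext a
  simp only [Finset.mem_filter, this]

/-- Isolates the only comparisons on a level that the next level leaves open, namely those over
equivalent parents. -/
lemma le_iff_map (F : Factorization f) (i : ℕ) (a b : Fin (τ.card i)) :
    F.le i a b ↔ ¬ F.le (i + 1) (τ.map i b) (τ.map i a) ∨
      (F.le (i + 1) (τ.map i a) (τ.map i b) ∧ F.le i a b) := by
  constructor
  · exact fun h => Or.inr ⟨F.le_map h, h⟩
  · rintro (h | h)
    · exact (F.le_total i a b).resolve_right fun h' => h (F.le_map h')
    · exact h.2

/-- This settles the case in which the first noncritical vertex does not move. The merging from `G`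
to `F` must join `l` to some other class. If this class is on the right of `l` in `G`, then `G` is
the split of `F`; otherwise more vertices lie on the left of `l` in `G`. -/
lemma isSplit_or_pos_lt {F G : Factorization f} {i : ℕ} {l : Fin (τ.card i)}
    (h : F.FirstNonCrit i l) (hl : ¬ F.Alone i l) (h' : G.FirstNonCrit i l) (hl' : G.Alone i l)
    (hFG : Covers F G) : IsSplit F G i l ∨ F.pos i l < G.pos i l := by
  obtain ⟨v, hv, hdeg⟩ := hFG
  have hva : ∀ j a, v.app j (G.fst.app j a) = F.fst.app j a := app_eq_of_comp_eq hv
  have hna := hl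
  simp only [Alone, not_forall] at hna
  obtain ⟨b, h1, h2, h3⟩ := hna
  have hm : Hom.IsMerge v i (G.fst.app i l) (G.fst.app i b) := by
    refine Hom.isMerge_of_deg_eq_one hdeg (fun he => ?_) ?_
    · exact h3 (hl' b (G.app_eq_iff.1 he).1 (G.app_eq_iff.1 he).2)
    · rw [hva, hva]
      exact F.app_eq_iff.2 ⟨h1, h2⟩
  have hsib : ∀ j a c, G.le (j + 1) (τ.map j a) (τ.map j c) →
      G.le (j + 1) (τ.map j c) (τ.map j a) → G.le j a c → F.le j a c := by
    intro j a c hac hca hle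
    unfold le
    rw [← hva, ← hva]
    refine v.mono j _ _ ?_ hle
    rw [G.fst.comm, G.fst.comm]
    exact le_antisymm hac hca
  -- `v` is injective on every level other than `i`. Induction from the root shows that `F` and `G`
  -- have the same preorders on the levels above `i`.
  have habove : ∀ d j, n ≤ j + d → i < j → ∀ a c, G.le j a c ↔ F.le j a c := by
    intro d
    induction d with
    | zero =>
      intro j hj _ a c
      rw [subsingleton_of_le τ hj a c]
      exact ⟨fun _ => F.le_refl _ _, fun _ => G.le_refl _ _⟩
    | succ d ih =>
      intro j hj hij a c
      have ih := ih (j + 1) (by omega) (by omega)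
      have key : ∀ a c, G.le (j + 1) (τ.map j a) (τ.map j c) →
          G.le (j + 1) (τ.map j c) (τ.map j a) → (G.le j a c ↔ F.le j a c) := by
        refine fun a c hac hca => ⟨hsib j a c hac hca, fun hle => ?_⟩
        rcases G.le_total j a c with h4 | h4
        · exact h4
        · have h5 := hsib j c a hca hac h4
          have h6 : F.fst.app j a = F.fst.app j c := F.app_eq_iff.2 ⟨hle, h5⟩
          rw [← hva, ← hva] at h6
          exact (G.app_eq_iff.1 (hm.inj_of_ne j (by omega) h6)).1
      rw [le_iff_map G, le_iff_map F, ih, ih]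
      by_cases hca : F.le (j + 1) (τ.map j c) (τ.map j a)
      · by_cases hac : F.le (j + 1) (τ.map j a) (τ.map j c)
        · rw [key a c ((ih _ _).2 hac) ((ih _ _).2 hca)]
        · simp [hac]
      · simp [hca]
  have hab : ∀ j, i < j → ∀ a c, G.le j a c ↔ F.le j a c := fun j => habove n j (by omega)
  have hGF : ∀ a c, G.le i a c → F.le i a c := by
    intro a c hac
    by_cases hca : G.le (i + 1) (τ.map i c) (τ.map i a)
    · exact hsib i a c (G.le_map hac) hca hac
    · rw [hab _ (by omega)] at hca
      exact (F.le_total i a c).resolve_right fun h => hca (F.le_map h)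
  have hclass : ∀ a c, a ≠ l → c ≠ l → F.le i a c → F.le i c a → G.le i a c := by
    intro a c ha hc hac hca
    have h6 : F.fst.app i a = F.fst.app i c := F.app_eq_iff.2 ⟨hac, hca⟩
    rw [← hva, ← hva] at h6
    refine (G.app_eq_iff.1 (hm.inj _ _ (fun he => ha ?_) (fun he => hc ?_) h6)).1
    · exact hl' a (G.app_eq_iff.1 he).2 (G.app_eq_iff.1 he).1
    · exact hl' c (G.app_eq_iff.1 he).2 (G.app_eq_iff.1 he).1
  -- The position in `G` of `l` relative to its partner `b` decides between the two conclusions.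
  by_cases hlb : G.le i l b
  · refine Or.inl ⟨h, hl, h', hl', hab, fun a c => ⟨fun hac => ⟨hGF a c hac, ?_⟩, ?_⟩⟩
    · rintro rfl hca
      by_contra hne
      have h4 := hclass b a h3 hne (F.le_trans h2 hca) (F.le_trans (hGF _ _ hac) h1)
      exact hne (hl' a (G.le_trans hlb h4) hac)
    · rintro ⟨hac, hc⟩
      rcases G.le_total i a c with h4 | h4
      · exact h4
      · have h5 := hGF _ _ h4
        by_cases hcl : c = l
        · subst hcl
          rw [hc rfl h5]
          exact G.le_refl _ _
        · by_cases hal : a = l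
          · subst hal
            exact G.le_trans hlb (hclass b c h3 hcl (F.le_trans h2 hac) (F.le_trans h5 h1))
          · exact hclass a c hal hcl hac h5
  · right
    refine Finset.card_lt_card ((Finset.ssubset_iff_of_subset fun a ha => ?_).2 ⟨b, ?_, ?_⟩)
    · simp only [Finset.mem_filter, Finset.mem_univ, true_and] at ha ⊢
      exact fun h => ha (hGF _ _ h)
    · simpa using hlb
    · simpa using h1

end Factorization

end PrunedTree

namespace PrunedTree

variable {n : ℕ} {τ σ ρ φ : PrunedTree n}

/-! ### Factorizations of the morphisms of degree two -/

/-- Morphisms are only assumed nondecreasing on siblings, but vertices with different parents are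
ordered like their parents, so induction from the root applies. Hence degree zero leaves no choice
for a factor. -/
lemma Hom.app_le_iff_of_deg_eq_zero {u : τ ⟶ σ} (h : Hom.deg u = 0) (i : ℕ)
    (a b : Fin (τ.card i)) : u.app i a ≤ u.app i b ↔ a ≤ b := by
  have key : ∀ d i, n ≤ i + d → ∀ a b : Fin (τ.card i), u.app i a ≤ u.app i b ↔ a ≤ b := by
    intro d
    induction d with
    | zero =>
      intro i hi a b
      rw [subsingleton_of_le τ hi a b]
      simp
    | succ d ih =>
      intro i hi a b
      have mono : ∀ a b : Fin (τ.card i), a ≤ b → u.app i a ≤ u.app i b := by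
        intro a b hab
        by_cases hs : τ.map i a = τ.map i b
        · exact u.mono i a b hs hab
        · by_contra hlt
          have h1 := σ.mono i (not_le.1 hlt).le
          rw [u.comm, u.comm, ih (i + 1) (by omega)] at h1
          exact hs (le_antisymm (τ.mono i hab) h1)
      refine ⟨fun hab => ?_, mono a b⟩
      rcases le_total a b with h1 | h1
      · exact h1
      · exact (u.injective_of_deg_eq_zero h i (le_antisymm hab (mono b a h1))).le
  exact key n i (by omega) a b

namespace Factorization

variable {f : τ ⟶ φ}

lemma deg_add (F : Factorization f) : Hom.deg F.fst + Hom.deg F.snd = Hom.deg f := by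
  rw [← Hom.deg_comp, F.comp]

lemma eq_of_deg_fst_eq_zero {F G : Factorization f} (hF : Hom.deg F.fst = 0)
    (hG : Hom.deg G.fst = 0) : F = G :=
  ext_of_le fun i a b => (Hom.app_le_iff_of_deg_eq_zero hF i a b).trans
    (Hom.app_le_iff_of_deg_eq_zero hG i a b).symm

lemma eq_of_deg_snd_eq_zero {F G : Factorization f} (hF : Hom.deg F.snd = 0)
    (hG : Hom.deg G.snd = 0) : F = G := by
  refine ext_of_le fun i a b => ?_
  unfold le
  rw [← Hom.app_le_iff_of_deg_eq_zero hF, ← Hom.app_le_iff_of_deg_eq_zero hG, F.snd_app, F.snd_app,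
    G.snd_app, G.snd_app]

lemma Covers.deg_fst {F G : Factorization f} (h : Covers F G) :
    Hom.deg F.fst = Hom.deg G.fst + 1 := by
  obtain ⟨v, hv, hd⟩ := h
  rw [← hv, Hom.deg_comp, hd]

lemma IsSplit.cast {F G : Factorization f} {i j : ℕ} {l : Fin (τ.card i)} {m : Fin (τ.card j)}
    (h : IsSplit F G i l) (e : (⟨i, l⟩ : Σ i, Fin (τ.card i)) = ⟨j, m⟩) : IsSplit F G j m := by
  obtain ⟨rfl, e⟩ := Sigma.mk.inj_iff.1 e
  obtain rfl := eq_of_heq e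
  exact h

/-- A morphism of degree `2` has exactly two factorizations into morphisms of degree `1`. -/
theorem exists_pair_of_deg_eq_two (hf : Hom.deg f = 2) :
    ∃ F G : Factorization f, F ≠ G ∧ ∀ W : Factorization f, Hom.deg W.fst = 1 ↔ W = F ∨ W = G := by
  have hf0 : Hom.deg f ≠ 0 := by omega
  let I : Factorization f := ⟨τ, 𝟙 τ, f, Category.id_comp f⟩
  let J : Factorization f := ⟨φ, f, 𝟙 φ, Category.comp_id f⟩
  have hI : Hom.deg I.fst = 0 := Hom.deg_id τ
  have hJ : Hom.deg J.snd = 0 := Hom.deg_id φ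
  have hJ' : Hom.deg J.fst = 2 := hf
  have hnn : ∀ F : Factorization f, 0 ≤ Hom.deg F.fst := fun F => Hom.deg_nonneg _
  have hle : ∀ F : Factorization f, Hom.deg F.fst ≤ 2 := fun F => by
    have h1 := F.deg_add
    have h2 := Hom.deg_nonneg F.snd
    omega
  -- The count uses only that partners in the matching differ by one in `deg fst`. `I` and `J`, the
  -- sole factorizations with `deg fst` equal to `0` and `2`, have partners in the middle, and a
  -- middle element can only be the partner of `I` or of `J`.
  obtain ⟨i, l, hIl⟩ := exists_firstNonCrit hf0 I
  obtain ⟨j, m, hJm⟩ := exists_firstNonCrit hf0 J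
  have hIA : I.Alone i l := by
    by_contra h
    obtain ⟨G, hG⟩ := exists_isSplit hIl h
    have h1 := hG.covers.deg_fst
    have h2 := hnn G
    omega
  have hJM : ¬ J.Alone j m := by
    intro h
    obtain ⟨F, hF⟩ := exists_isSplit' hJm h
    have h1 := hF.covers.deg_fst
    have h2 := hle F
    omega
  obtain ⟨F, hF⟩ := exists_isSplit' hIl hIA
  obtain ⟨G, hG⟩ := exists_isSplit hJm hJM
  have hFd := hF.covers.deg_fst
  have hGd := hG.covers.deg_fst
  refine ⟨F, G, ?_, fun W => ⟨fun hW => ?_, ?_⟩⟩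
  · rintro rfl
    obtain ⟨rfl, e⟩ := Sigma.mk.inj_iff.1 (hF.first.eq hG.first')
    obtain rfl := eq_of_heq e
    exact hF.not_alone hG.alone
  · obtain ⟨r, s, hWs⟩ := exists_firstNonCrit hf0 W
    by_cases ha : W.Alone r s
    · right
      obtain ⟨W', hW'⟩ := exists_isSplit' hWs ha
      have h1 := hW'.covers.deg_fst
      obtain rfl : W' = J := eq_of_deg_snd_eq_zero (by have := W'.deg_add; omega) hJ
      exact (hW'.cast (hW'.first.eq hJm)).right_unique hG
    · left
      obtain ⟨W', hW'⟩ := exists_isSplit hWs ha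
      have h1 := hW'.covers.deg_fst
      obtain rfl : W' = I := eq_of_deg_fst_eq_zero (by omega) hI
      exact (hW'.cast (hW'.first'.eq hIl)).left_unique hF
  · rintro (rfl | rfl) <;> omega

end Factorization

/-! ### The order on the vertices -/

lemma below_self (τ : PrunedTree n) (i : ℕ) (h : i ≤ i) (a : Fin (τ.card i)) :
    τ.below h a = a :=
  Nat.leRecOn_self (C := fun l => Fin (τ.card l)) a

lemma below_succ (τ : PrunedTree n) {i j : ℕ} (h : i ≤ j) (a : Fin (τ.card i)) :
    τ.below (h.trans (Nat.le_succ j)) a = τ.map j (τ.below h a) :=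
  Nat.leRecOn_succ (C := fun l => Fin (τ.card l)) h a

lemma below_below (τ : PrunedTree n) {i j l : ℕ} (h : i ≤ j) (h' : j ≤ l) (a : Fin (τ.card i)) :
    τ.below h' (τ.below h a) = τ.below (h.trans h') a :=
  (Nat.leRecOn_trans (C := fun l => Fin (τ.card l)) h h' a).symm

lemma below_mono (τ : PrunedTree n) {i j : ℕ} (h : i ≤ j) : Monotone (τ.below h) := by
  induction j, h using Nat.le_induction with
  | base => exact fun a b hab => by rwa [below_self, below_self]
  | succ j h ih =>
      intro a b hab
      rw [below_succ τ h, below_succ τ h]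
      exact τ.mono j (ih hab)

/-- Frees the level of comparison from the literal maximum, so that it can be identified with the
level of either vertex. -/
lemma precedes_iff (τ : PrunedTree n) {x y : τ.Vertex} {l : ℕ} (hl : max (x.1 : ℕ) (y.1 : ℕ) = l) :
    τ.Precedes x y ↔ τ.below (hl ▸ le_max_left _ _) x.2 < τ.below (hl ▸ le_max_right _ _) y.2 ∨
      (τ.below (hl ▸ le_max_left _ _) x.2 = τ.below (hl ▸ le_max_right _ _) y.2 ∧
        (y.1 : ℕ) < (x.1 : ℕ)) := by
  subst hl
  rfl

lemma Precedes.below_le {x y : τ.Vertex} (h : τ.Precedes x y) {l : ℕ} (hx : (x.1 : ℕ) ≤ l)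
    (hy : (y.1 : ℕ) ≤ l) : τ.below hx x.2 ≤ τ.below hy y.2 := by
  rw [precedes_iff τ rfl] at h
  rw [← below_below τ (le_max_left (x.1 : ℕ) y.1) (max_le hx hy),
    ← below_below τ (le_max_right (x.1 : ℕ) y.1) (max_le hx hy)]
  refine below_mono τ _ ?_
  rcases h with h | h
  · exact h.le
  · exact h.1.le

lemma Precedes.trans {x y z : τ.Vertex} (h : τ.Precedes x y) (h' : τ.Precedes y z) :
    τ.Precedes x z := by
  rw [precedes_iff τ rfl]
  set l := max (x.1 : ℕ) (z.1 : ℕ) with hl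
  have hx : (x.1 : ℕ) ≤ l := le_max_left _ _
  have hz : (z.1 : ℕ) ≤ l := le_max_right _ _
  rcases le_or_gt (y.1 : ℕ) l with hy | hy
  · have h1 := h.below_le hx hy
    have h2 := h'.below_le hy hz
    rcases (h1.trans h2).lt_or_eq with h3 | h3
    · exact Or.inl h3
    · refine Or.inr ⟨h3, ?_⟩
      have h4 : τ.below hx x.2 = τ.below hy y.2 := le_antisymm h1 (h3 ▸ h2)
      have h5 : τ.below hy y.2 = τ.below hz z.2 := h4.symm.trans h3
      rcases le_or_gt (x.1 : ℕ) z.1 with hxz | hxz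
      · have hlz : max (y.1 : ℕ) (z.1 : ℕ) = l := by omega
        rw [precedes_iff τ hlz] at h'
        have h6 : (z.1 : ℕ) < y.1 := by
          rcases h' with h' | h'
          · exact absurd h' (h5 ▸ lt_irrefl _)
          · exact h'.2
        omega
      · exact hxz
  -- Here `y` is nearer to the root than both `x` and `z`. A tie would put `x` below `y`, so `x` is
  -- strictly on the left of `y` at the level of `y`, and this strictness descends to the level `l`.
  · left
    have hxy : max (x.1 : ℕ) (y.1 : ℕ) = y.1 := by omega
    have hyz : max (y.1 : ℕ) (z.1 : ℕ) = y.1 := by omega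
    have h1 : τ.below (hx.trans hy.le) x.2 < τ.below le_rfl y.2 := by
      rw [precedes_iff τ hxy] at h
      rcases h with h | h
      · exact h
      · exact absurd h.2 (by omega)
    have h2 := h'.below_le le_rfl (hz.trans hy.le)
    by_contra h3
    have h4 := below_mono τ hy.le (not_lt.1 h3)
    rw [below_below, below_below] at h4
    exact absurd (h1.trans_le (h2.trans h4)) (lt_irrefl _)

lemma not_precedes_self (x : τ.Vertex) : ¬ τ.Precedes x x := by
  rw [precedes_iff τ rfl]
  simp

lemma Precedes.asymm {x y : τ.Vertex} (h : τ.Precedes x y) : ¬ τ.Precedes y x :=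
  fun h' => not_precedes_self x (h.trans h')

lemma precedes_of_lt {i : Fin n} {a b : Fin (τ.card i)} (h : a < b) :
    τ.Precedes ⟨i, a⟩ ⟨i, b⟩ := by
  rw [precedes_iff τ (max_self (i : ℕ))]
  left
  change τ.below _ a < τ.below _ b
  rwa [below_self, below_self]

lemma precedes_trichotomy (x y : τ.Vertex) : τ.Precedes x y ∨ x = y ∨ τ.Precedes y x := by
  obtain ⟨i, a⟩ := x
  obtain ⟨j, b⟩ := y
  rcases lt_trichotomy i j with hij | rfl | hij
  · have h1 : max (i : ℕ) (j : ℕ) = j := max_eq_right (Fin.le_iff_val_le_val.1 hij.le)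
    have h2 : max (j : ℕ) (i : ℕ) = j := max_eq_left (Fin.le_iff_val_le_val.1 hij.le)
    rw [precedes_iff τ h1, precedes_iff τ h2]
    have h3 : (i : ℕ) < j := hij
    rcases lt_trichotomy (τ.below h3.le a) (τ.below le_rfl b) with h | h | h
    · exact Or.inl (Or.inl h)
    · exact Or.inr (Or.inr (Or.inr ⟨h.symm, h3⟩))
    · exact Or.inr (Or.inr (Or.inl h))
  · rcases lt_trichotomy a b with h | rfl | h
    · exact Or.inl (precedes_of_lt h)
    · exact Or.inr (Or.inl rfl)
    · exact Or.inr (Or.inr (precedes_of_lt h))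
  · have h1 : max (i : ℕ) (j : ℕ) = i := max_eq_left (Fin.le_iff_val_le_val.1 hij.le)
    have h2 : max (j : ℕ) (i : ℕ) = i := max_eq_right (Fin.le_iff_val_le_val.1 hij.le)
    rw [precedes_iff τ h1, precedes_iff τ h2]
    have h3 : (j : ℕ) < i := hij
    rcases lt_trichotomy (τ.below le_rfl a) (τ.below h3.le b) with h | h | h
    · exact Or.inl (Or.inl h)
    · exact Or.inl (Or.inr ⟨h, h3⟩)
    · exact Or.inr (Or.inr (Or.inl h))

/-- The vertices of level `< n`, as an ordered set. -/
def OrderedVertex (τ : PrunedTree n) : Type := τ.Vertex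

noncomputable instance (τ : PrunedTree n) : LinearOrder τ.OrderedVertex :=
  let _ : IsStrictTotalOrder τ.OrderedVertex τ.Precedes :=
    { irrefl := not_precedes_self
      trans := fun _ _ _ => Precedes.trans
      trichotomous := fun x y h h' => by
        have := precedes_trichotomy x y
        tauto }
  @linearOrderOfSTO τ.OrderedVertex τ.Precedes _ (Classical.decRel _)

noncomputable instance (τ : PrunedTree n) : Fintype τ.OrderedVertex :=
  inferInstanceAs (Fintype τ.Vertex)

/-- The numbering of the vertices in their order. -/
lemma exists_numbering (τ : PrunedTree n) {N : ℕ} (hN : τ.degree = N) :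
    ∃ e : τ.Vertex ≃ Fin N, ∀ x y, τ.Precedes x y ↔ e x < e y := by
  have hc : Fintype.card τ.OrderedVertex = N := by
    change Fintype.card τ.Vertex = N
    rw [Fintype.card_sigma, ← Nat.cast_inj (R := ℤ), ← hN]
    simp only [Fintype.card_fin, degree, Nat.cast_sum]
    exact (Finset.sum_range fun i => (τ.card i : ℤ)).symm
  let e := (monoEquivOfFin τ.OrderedVertex hc).symm
  exact ⟨e.toEquiv, fun x y => Iff.symm (e.lt_iff_lt : e x < e y ↔ (show τ.OrderedVertex from x) < y)⟩

end PrunedTree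

/-! ### The sign of a merging as a determinant -/

section MergeSign

/-- A point which has the same image as another point. -/
def IsMergedBy {A B : Type*} (v : A → B) (x : A) : Prop := ∃ y, y ≠ x ∧ v y = v x

open Classical in
/-- The sign of a map which merges two points, for sets with given orders. -/
noncomputable def mergeSign {A B : Type*} [Fintype A] (r : A → A → Prop) (s : B → B → Prop)
    (v : A → B) : ℤ :=
  (-1) ^
    (Finset.card {p : A × A | ¬ IsMergedBy v p.1 ∧ IsMergedBy v p.2 ∧ r p.1 p.2}
      + Finset.card {z : A | ¬ IsMergedBy v z ∧ ∃ x, IsMergedBy v x ∧ s (v z) (v x)}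
      + Finset.card {p : A × A |
        ¬ IsMergedBy v p.1 ∧ ¬ IsMergedBy v p.2 ∧ r p.1 p.2 ∧ s (v p.2) (v p.1)})

/-- Transports the sign along numberings of the vertices, so that it can be computed with
permutations and determinants over `Fin`. -/
lemma mergeSign_congr {A B A' B' : Type*} [Fintype A] [Fintype A'] {r : A → A → Prop}
    {s : B → B → Prop} {v : A → B} {r' : A' → A' → Prop} {s' : B' → B' → Prop} {v' : A' → B'}
    (e : A ≃ A') (e' : B ≃ B') (hr : ∀ x y, r x y ↔ r' (e x) (e y))
    (hs : ∀ x y, s x y ↔ s' (e' x) (e' y)) (hv : ∀ x, v' (e x) = e' (v x)) :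
    mergeSign r s v = mergeSign r' s' v' := by
  have hm : ∀ x, IsMergedBy v x ↔ IsMergedBy v' (e x) := by
    intro x
    constructor
    · rintro ⟨y, hy, h⟩
      exact ⟨e y, fun h => hy (e.injective h), by rw [hv, hv, h]⟩
    · rintro ⟨y, hy, h⟩
      obtain ⟨y, rfl⟩ := e.surjective y
      rw [hv, hv] at h
      exact ⟨y, fun h => hy (h ▸ rfl), e'.injective h⟩
  unfold mergeSign
  congr 1
  congr 1
  · congr 1
    · refine Finset.card_equiv (e.prodCongr e) fun p => ?_
      simp [hm, hr]
    · refine Finset.card_equiv e fun z => ?_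
      simp only [Finset.mem_filter, Finset.mem_univ, true_and, hm, hs, ← hv]
      rw [e.exists_congr_left]
      simp
  · refine Finset.card_equiv (e.prodCongr e) fun p => ?_
    simp [hm, hr, hs, hv]

variable {m : ℕ}

/-- The map `v` merges exactly the two points `x`, `x'`. -/
structure MergesPair {A B : Type*} (v : A → B) (x x' : A) : Prop where
  ne : x ≠ x'
  eq : v x = v x'
  inj : ∀ y z, y ≠ x → z ≠ x → v y = v z → y = z

lemma MergesPair.isMergedBy_iff {A B : Type*} {v : A → B} {x x' : A} (h : MergesPair v x x')
    (y : A) : IsMergedBy v y ↔ y = x ∨ y = x' := by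
  constructor
  · rintro ⟨z, hz, hzy⟩
    by_contra! hy
    by_cases hzx : z = x
    · subst hzx
      exact hy.2 (h.inj y x' hy.1 h.ne.symm (by rw [← hzy, h.eq]))
    · exact hz (h.inj z y hzx hy.1 hzy)
  · rintro (rfl | rfl)
    · exact ⟨x', h.ne.symm, h.eq.symm⟩
    · exact ⟨x, h.ne, h.eq⟩

lemma Equiv.Perm.sign_eq_neg_one_pow_card (π : Equiv.Perm (Fin m)) :
    ((Equiv.Perm.sign π : ℤˣ) : ℤ) =
      (-1) ^ (∑ i, ∑ j, if i < j ∧ π j < π i then 1 else 0 : ℕ) := by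
  rw [Equiv.Perm.sign_eq_prod_prod_Ioi]
  push_cast
  rw [← Finset.prod_pow_eq_pow_sum]
  refine Finset.prod_congr rfl fun i _ => ?_
  rw [← Finset.prod_pow_eq_pow_sum]
  have h1 : Finset.Ioi i = Finset.univ.filter (fun j => i < j) := by ext; simp
  rw [h1, Finset.prod_filter]
  refine Finset.prod_congr rfl fun j _ => ?_
  by_cases hij : i < j
  · rcases lt_trichotomy (π i) (π j) with h | h | h
    · simp [hij, h, h.not_gt]
    · exact absurd (π.injective h) hij.ne
    · simp [hij, h, h.not_gt]
  · simp [hij]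

/-- Dropping the left point `x` turns `v` into a permutation `π`. Modulo two, the three counts of
the definition add up to the number of points before `x` plus the number of inversions of `π`. -/
lemma mergeSign_eq {v : Fin (m + 1) → Fin m} {x x' : Fin (m + 1)} (h : MergesPair v x x')
    (hx : x < x') {π : Equiv.Perm (Fin m)} (hπ : ∀ a, π a = v (x.succAbove a)) :
    mergeSign (· < ·) (· < ·) v = (-1) ^ (x : ℕ) * ((Equiv.Perm.sign π : ℤˣ) : ℤ) := by
  classical
  let U : Fin (m + 1) → Prop := fun p => ¬ (p = x ∨ p = x')
  have hI : (∑ i, ∑ j, if i < j ∧ π j < π i then 1 else 0 : ℕ) =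
      ∑ p, ∑ q, if p ≠ x ∧ q ≠ x ∧ p < q ∧ v q < v p then 1 else 0 := by
    rw [Fin.sum_univ_succAbove _ x]
    simp only [ne_eq, not_true_eq_false, false_and, if_false, Finset.sum_const_zero, zero_add]
    refine Finset.sum_congr rfl fun i _ => ?_
    rw [Fin.sum_univ_succAbove _ x]
    simp only [not_true_eq_false, false_and, and_false, if_false, zero_add]
    refine Finset.sum_congr rfl fun j _ => ?_
    simp only [hπ, Fin.succAbove_ne, not_false_iff, true_and, Fin.succAbove_lt_succAbove_iff]
  -- The inversions are sorted by whether they involve the surviving merged point `x'`, as its first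
  -- or as its second entry.
  have hsplit : ∀ p q, (if p ≠ x ∧ q ≠ x ∧ p < q ∧ v q < v p then 1 else 0 : ℕ) =
      (if U p ∧ U q ∧ p < q ∧ v q < v p then 1 else 0)
      + (if p = x' then (if U q ∧ x' < q ∧ v q < v x' then 1 else 0) else 0)
      + (if q = x' then (if U p ∧ p < x' ∧ v x' < v p then 1 else 0) else 0) := by
    intro p q
    have hne := h.ne
    by_cases h1 : p = x'
    · subst h1
      by_cases h2 : q = p
      · subst h2; simp [U]
      · simp [U, h2, hne.symm]
    · by_cases h2 : q = x'
      · subst h2; simp [U, h1, hne.symm]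
      · simp [U, h1, h2]
  have hI2 : (∑ p, ∑ q, if p ≠ x ∧ q ≠ x ∧ p < q ∧ v q < v p then 1 else 0 : ℕ) =
      (∑ p, ∑ q, if U p ∧ U q ∧ p < q ∧ v q < v p then 1 else 0)
      + (∑ q, if U q ∧ x' < q ∧ v q < v x' then 1 else 0)
      + ∑ p, if U p ∧ p < x' ∧ v x' < v p then 1 else 0 := by
    simp only [hsplit, Finset.sum_add_distrib]
    congr 1
    · congr 1
      rw [Finset.sum_eq_single x' (by intro p _ hp; simp [hp]) (by simp)]
      simp
    · refine Finset.sum_congr rfl fun p _ => ?_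
      rw [Finset.sum_ite_eq' Finset.univ x']
      simp
  have hC1 : Finset.card {p : Fin (m + 1) × Fin (m + 1) |
        ¬ IsMergedBy v p.1 ∧ IsMergedBy v p.2 ∧ p.1 < p.2} =
      (∑ p, if U p ∧ p < x then 1 else 0) + ∑ p, if U p ∧ p < x' then 1 else 0 := by
    rw [Finset.card_filter, Fintype.sum_prod_type, ← Finset.sum_add_distrib]
    refine Finset.sum_congr rfl fun p _ => ?_
    have : ∀ q, (if ¬ IsMergedBy v p ∧ IsMergedBy v q ∧ p < q then 1 else 0 : ℕ) =
        (if q = x then (if U p ∧ p < x then 1 else 0) else 0)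
        + (if q = x' then (if U p ∧ p < x' then 1 else 0) else 0) := by
      intro q
      rw [h.isMergedBy_iff, h.isMergedBy_iff]
      by_cases h1 : q = x
      · subst h1; simp [U, h.ne]
      · by_cases h2 : q = x'
        · subst h2; simp [U, h1]
        · simp [h1, h2]
    simp only [this, Finset.sum_add_distrib, Finset.sum_ite_eq', Finset.mem_univ, if_true]
  have hC2 : Finset.card {z : Fin (m + 1) | ¬ IsMergedBy v z ∧ ∃ x, IsMergedBy v x ∧ v z < v x} =
      ∑ p, if U p ∧ v p < v x' then 1 else 0 := by
    rw [Finset.card_filter]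
    refine Finset.sum_congr rfl fun p _ => ?_
    congr 1
    simp only [h.isMergedBy_iff, U, or_and_right, exists_or, exists_eq_left, h.eq,
      or_self]
  have hC3 : Finset.card {p : Fin (m + 1) × Fin (m + 1) |
        ¬ IsMergedBy v p.1 ∧ ¬ IsMergedBy v p.2 ∧ p.1 < p.2 ∧ v p.2 < v p.1} =
      ∑ p, ∑ q, if U p ∧ U q ∧ p < q ∧ v q < v p then 1 else 0 := by
    rw [Finset.card_filter, Fintype.sum_prod_type]
    simp only [h.isMergedBy_iff, U]
  have hX : (x : ℕ) = ∑ p, if U p ∧ p < x then 1 else 0 := by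
    rw [← Finset.card_filter]
    have : Finset.univ.filter (fun p => U p ∧ p < x) = Finset.Iio x := by
      ext p
      simp only [Finset.mem_filter, Finset.mem_univ, true_and, Finset.mem_Iio, U]
      refine ⟨fun h => h.2, fun hp => ⟨?_, hp⟩⟩
      rintro (h1 | h1)
      · exact hp.ne h1
      · exact (hp.trans hx).ne h1
    rw [this, Fin.card_Iio]
  have hP1 : (∑ p, if U p ∧ p < x' then 1 else 0 : ℕ) =
      (∑ p, if U p ∧ p < x' ∧ v p < v x' then 1 else 0)
      + ∑ p, if U p ∧ p < x' ∧ v x' < v p then 1 else 0 := by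
    rw [← Finset.sum_add_distrib]
    refine Finset.sum_congr rfl fun p _ => ?_
    by_cases hp : U p ∧ p < x'
    · have hne : v p ≠ v x' := fun he => by
        have := h.inj p x' (fun h => hp.1 (Or.inl h)) h.ne.symm he
        exact hp.1 (Or.inr this)
      rcases lt_or_gt_of_ne hne with hl | hl
      · simp [hp.1, hp.2, hl, hl.not_gt]
      · simp [hp.1, hp.2, hl, hl.not_gt]
    · rw [if_neg hp, if_neg (fun h => hp ⟨h.1, h.2.1⟩), if_neg (fun h => hp ⟨h.1, h.2.1⟩)]
  have hP2 : (∑ p, if U p ∧ v p < v x' then 1 else 0 : ℕ) =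
      (∑ p, if U p ∧ p < x' ∧ v p < v x' then 1 else 0)
      + ∑ p, if U p ∧ x' < p ∧ v p < v x' then 1 else 0 := by
    rw [← Finset.sum_add_distrib]
    refine Finset.sum_congr rfl fun p _ => ?_
    by_cases hp : U p ∧ v p < v x'
    · have hne : p ≠ x' := fun he => hp.1 (Or.inr he)
      rcases lt_or_gt_of_ne hne with hl | hl
      · simp [hp.1, hp.2, hl, hl.not_gt]
      · simp [hp.1, hp.2, hl, hl.not_gt]
    · rw [if_neg hp, if_neg (fun h => hp ⟨h.1, h.2.2⟩), if_neg (fun h => hp ⟨h.1, h.2.2⟩)]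
  have hdef : mergeSign (· < ·) (· < ·) v = (-1 : ℤ) ^ (Finset.card
        {p : Fin (m + 1) × Fin (m + 1) | ¬ IsMergedBy v p.1 ∧ IsMergedBy v p.2 ∧ p.1 < p.2}
      + Finset.card {z : Fin (m + 1) | ¬ IsMergedBy v z ∧ ∃ x, IsMergedBy v x ∧ v z < v x}
      + Finset.card {p : Fin (m + 1) × Fin (m + 1) |
        ¬ IsMergedBy v p.1 ∧ ¬ IsMergedBy v p.2 ∧ p.1 < p.2 ∧ v p.2 < v p.1}) := by
    unfold mergeSign
    congr!
  rw [hdef, Equiv.Perm.sign_eq_neg_one_pow_card, hI, hI2, ← pow_add, hC1, hC2, hC3, hP1, hP2]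
  -- The unmerged points which precede `x'` and are mapped below its image are counted in both `hP1`
  -- and `hP2`; this is the only difference of the exponents, and it is even.
  have parity : ∀ a b : ℕ, a % 2 = b % 2 → (-1 : ℤ) ^ a = (-1) ^ b := fun a b h => by
    rw [neg_one_pow_eq_pow_mod_two, h, ← neg_one_pow_eq_pow_mod_two]
  exact parity _ _ (by omega)

lemma exists_perm_of_mergesPair {v : Fin (m + 1) → Fin m} {x x' : Fin (m + 1)}
    (h : MergesPair v x x') : ∃ π : Equiv.Perm (Fin m), ∀ a, π a = v (x.succAbove a) := by
  have hinj : Function.Injective fun a => v (x.succAbove a) := fun a b hab =>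
    Fin.succAbove_right_injective (h.inj _ _ (Fin.succAbove_ne x a) (Fin.succAbove_ne x b) hab)
  exact ⟨Equiv.ofBijective _ (Finite.injective_iff_bijective.1 hinj), fun a => rfl⟩

lemma det_cons_single (x : Fin (m + 1)) (M : Fin (m + 1) → Fin m → ℤ) :
    Matrix.det (Matrix.of fun i => (Fin.cons (if i = x then 1 else 0) (M i) : Fin (m + 1) → ℤ)) =
      (-1) ^ (x : ℕ) * Matrix.det (Matrix.of fun a => M (x.succAbove a)) := by
  rw [Matrix.det_succ_column_zero, Finset.sum_eq_single x]
  · simp only [Matrix.of_apply, Fin.cons_zero, if_true, mul_one]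
    rfl
  · intro i _ hi
    simp [hi]
  · simp

/-- The matrix with columns `α`, `β` and the indicators of the fibres of `g`. -/
def fibreMatrix (g : Fin (m + 2) → Fin m) (α β : Fin (m + 2) → ℤ) :
    Matrix (Fin (m + 2)) (Fin (m + 2)) ℤ :=
  Matrix.of fun i => Fin.cons (α i) (Fin.cons (β i) fun c => if g i = c then 1 else 0)

lemma mergeSign_eq_det {v : Fin (m + 1) → Fin m} {x x' : Fin (m + 1)} (h : MergesPair v x x')
    (hx : x < x') : mergeSign (· < ·) (· < ·) v =
      Matrix.det (Matrix.of fun i => (Fin.cons (if i = x then 1 else 0)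
        (fun c => if v i = c then 1 else 0) : Fin (m + 1) → ℤ)) := by
  obtain ⟨π, hπ⟩ := exists_perm_of_mergesPair h
  rw [mergeSign_eq h hx hπ, det_cons_single]
  have : (Matrix.of fun (a : Fin m) (c : Fin m) => if v (x.succAbove a) = c then (1 : ℤ) else 0) =
      (1 : Matrix (Fin m) (Fin m) ℤ).submatrix π id := by
    ext a c
    simp [Matrix.one_apply, hπ]
  rw [this, Matrix.det_permute, Matrix.det_one, mul_one]
  simp

/-- Expansion along the indicator of `x` gives the sign of its position and removes the row `x`.
What remains is the matrix for `w` with its rows permuted by the bijection that `v` induces off `x`.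
-/
lemma mergeSign_mul_eq_det {v : Fin (m + 2) → Fin (m + 1)} {w : Fin (m + 1) → Fin m}
    {x x' : Fin (m + 2)} (h : MergesPair v x x') (hx : x < x') {z z' : Fin (m + 1)}
    (h' : MergesPair w z z') (hz : z < z') :
    mergeSign (· < ·) (· < ·) v * mergeSign (· < ·) (· < ·) w =
      (fibreMatrix (fun i => w (v i)) (fun i => if i = x then 1 else 0)
        (fun i => if v i = z then 1 else 0)).det := by
  obtain ⟨π, hπ⟩ := exists_perm_of_mergesPair h
  have key := Matrix.det_permute π (Matrix.of fun i => (Fin.cons (if i = z then 1 else 0)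
    (fun c => if w i = c then 1 else 0) : Fin (m + 1) → ℤ))
  rw [mergeSign_eq h hx hπ, mergeSign_eq_det h' hz, fibreMatrix,
    det_cons_single x fun i => Fin.cons (if v i = z then 1 else 0)
      fun c => if w (v i) = c then 1 else 0, mul_assoc]
  congr 1
  refine Eq.trans (by simp) (key.symm.trans ?_)
  congr 1
  ext a c
  simp [hπ]

lemma fibreMatrix_det_add (g : Fin (m + 2) → Fin m) (α β β' : Fin (m + 2) → ℤ) :
    (fibreMatrix g α (β + β')).det = (fibreMatrix g α β).det + (fibreMatrix g α β').det := by
  have h : ∀ γ, fibreMatrix g α γ = (fibreMatrix g α 0).updateCol 1 γ := by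
    intro γ
    ext i j
    refine Fin.cases ?_ (fun j => Fin.cases ?_ (fun j => ?_) j) j
    · simp [fibreMatrix]
    · simp [fibreMatrix]
    · rw [Matrix.updateCol_ne]
      · simp [fibreMatrix]
      · simp [Fin.ext_iff]
  rw [h (β + β'), h β, h β', Matrix.det_updateCol_add]

lemma fibreMatrix_det_swap (g : Fin (m + 2) → Fin m) (α β : Fin (m + 2) → ℤ) :
    (fibreMatrix g α β).det = -(fibreMatrix g β α).det := by
  have h : fibreMatrix g α β = (fibreMatrix g β α).submatrix id (Equiv.swap 0 1) := by
    ext i j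
    refine Fin.cases ?_ (fun j => Fin.cases ?_ (fun j => ?_) j) j
    · simp [fibreMatrix]
    · simp [fibreMatrix]
    · rw [Matrix.submatrix_apply, Equiv.swap_apply_of_ne_of_ne]
      · simp [fibreMatrix]
      · simp [Fin.ext_iff]
      · simp [Fin.ext_iff]
  rw [h, Matrix.det_permute', Equiv.Perm.sign_swap (by simp)]
  simp

/-- The indicator of a fibre of `g` is already one of the later columns. -/
lemma fibreMatrix_det_fibre (g : Fin (m + 2) → Fin m) (α : Fin (m + 2) → ℤ) (c : Fin m) :
    (fibreMatrix g α (fun i => if g i = c then 1 else 0)).det = 0 := by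
  refine Matrix.det_zero_of_column_eq (i := 1) (j := c.succ.succ) ?_ fun i => ?_
  · simp [Fin.ext_iff]
  · simp [fibreMatrix]

/-- The signs of the factorizations of a map which merges twice two points. -/
lemma exists_alternating_form {A C : Type*} [Fintype A] {r : A → A → Prop}
    {t : C → C → Prop} (eA : A ≃ Fin (m + 2)) (hA : ∀ x y, r x y ↔ eA x < eA y)
    (eC : C ≃ Fin m) (hC : ∀ x y, t x y ↔ eC x < eC y) (g : A → C) :
    ∃ D : (A → ℤ) → (A → ℤ) → ℤ,
      (∀ α β β', D α (β + β') = D α β + D α β') ∧ (∀ α β, D α β = -D β α) ∧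
      (∀ α c, (∀ β : A → ℤ, (∀ a, g a = c → β a = 1) → (∀ a, g a ≠ c → β a = 0) → D α β = 0)) ∧
      ∀ {B : Type} [Fintype B] (s : B → B → Prop) (eB : B ≃ Fin (m + 1))
        (_ : ∀ x y, s x y ↔ eB x < eB y) (v : A → B) (w : B → C) (_ : ∀ a, w (v a) = g a)
        (x x' : A) (z z' : B) (_ : MergesPair v x x') (_ : r x x') (_ : MergesPair w z z')
        (_ : s z z') (α β : A → ℤ), α x = 1 → (∀ a, a ≠ x → α a = 0) → (∀ a, v a = z → β a = 1) →
        (∀ a, v a ≠ z → β a = 0) → mergeSign r s v * mergeSign s t w = D α β := by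
  -- The form is a determinant in the numberings of `A` and `C`. It involves `g` but not `B`, so one
  -- form serves all factorizations of `g`.
  refine ⟨fun α β => (fibreMatrix (fun i => eC (g (eA.symm i))) (fun i => α (eA.symm i))
    (fun i => β (eA.symm i))).det, fun α β β' => fibreMatrix_det_add _ _ _ _,
    fun α β => fibreMatrix_det_swap _ _ _, fun α c β h1 h2 => ?_, ?_⟩
  · convert fibreMatrix_det_fibre (fun i => eC (g (eA.symm i))) (fun i => α (eA.symm i)) (eC c)
      using 3
    funext i
    by_cases h : g (eA.symm i) = c
    · simp [h, h1 _ h]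
    · simp [h, h2 _ h]
  · intro B _ s eB hB v w hg x x' z z' hv hx hw hz α β h1 h2 h3 h4
    have hv' : MergesPair (fun i => eB (v (eA.symm i))) (eA x) (eA x') := by
      refine ⟨fun h => hv.ne (eA.injective h), by simp [hv.eq], fun y z hy hz hyz => ?_⟩
      refine eA.symm.injective (hv.inj _ _ (fun h => hy (by simp [← h])) (fun h => hz (by simp [← h]))
        (eB.injective hyz))
    have hw' : MergesPair (fun i => eC (w (eB.symm i))) (eB z) (eB z') := by
      refine ⟨fun h => hw.ne (eB.injective h), by simp [hw.eq], fun y z hy hz hyz => ?_⟩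
      refine eB.symm.injective (hw.inj _ _ (fun h => hy (by simp [← h])) (fun h => hz (by simp [← h]))
        (eC.injective hyz))
    rw [mergeSign_congr eA eB hA hB (v' := fun i => eB (v (eA.symm i))) (by simp),
      mergeSign_congr eB eC hB hC (v' := fun i => eC (w (eB.symm i))) (by simp),
      mergeSign_mul_eq_det hv' ((hA _ _).1 hx) hw' ((hB _ _).1 hz)]
    congr 2
    · funext i
      simp [hg]
    · funext i
      by_cases h : i = eA x
      · subst h; simp [h1]
      · rw [if_neg h, h2]
        exact fun h' => h (by simp [← h'])
    · funext i
      by_cases h : v (eA.symm i) = z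
      · simp [h, h3 _ h]
      · simp [h, h4 _ h]

end MergeSign

namespace PrunedTree

variable {n : ℕ} {τ σ ρ φ : PrunedTree n}

/-! ### Signs of the factorizations of a morphism of degree two -/

/-- Two vertices with the same parent, the first one at the left of the second one. -/
inductive SibLT (τ : PrunedTree n) : τ.Vertex → τ.Vertex → Prop
  | intro (i : Fin n) (a b : Fin (τ.card i)) (lt : a < b) (eq : τ.map i a = τ.map i b) :
    SibLT τ ⟨i, a⟩ ⟨i, b⟩

lemma SibLT.precedes {x y : τ.Vertex} (h : τ.SibLT x y) : τ.Precedes x y := by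
  obtain ⟨i, a, b, hlt, -⟩ := h
  exact precedes_of_lt hlt

lemma SibLT.asymm {x y : τ.Vertex} (h : τ.SibLT x y) : ¬ τ.SibLT y x :=
  fun h' => h.precedes.asymm h'.precedes

lemma SibLT.ne {x y : τ.Vertex} (h : τ.SibLT x y) : x ≠ y := by
  rintro rfl
  exact not_precedes_self _ h.precedes

lemma SibLT.trans {x y z : τ.Vertex} (h : τ.SibLT x y) (h' : τ.SibLT y z) : τ.SibLT x z := by
  obtain ⟨i, a, b, hlt, he⟩ := h
  obtain ⟨_, _, c, hlt', he'⟩ := h'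
  exact ⟨i, a, c, hlt.trans hlt', he.trans he'⟩

lemma SibLT.trichotomy {x y z : τ.Vertex} (h : τ.SibLT x y) (h' : τ.SibLT x z) :
    τ.SibLT y z ∨ y = z ∨ τ.SibLT z y := by
  obtain ⟨i, a, b, hlt, he⟩ := h
  obtain ⟨_, _, c, hlt', he'⟩ := h'
  rcases lt_trichotomy b c with hl | rfl | hl
  · exact Or.inl ⟨i, b, c, hl, he.symm.trans he'⟩
  · exact Or.inr (Or.inl rfl)
  · exact Or.inr (Or.inr ⟨i, c, b, hl, he'.symm.trans he⟩)

/-- The order of siblings can be followed through morphisms because monotonicity is imposed exactly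
there; it is not imposed for the full order `Precedes`. -/
lemma SibLT.onVertex {x y : τ.Vertex} (h : τ.SibLT x y) (w : τ ⟶ σ) :
    Hom.onVertex w x = Hom.onVertex w y ∨ σ.SibLT (Hom.onVertex w x) (Hom.onVertex w y) := by
  obtain ⟨i, a, b, hlt, he⟩ := h
  rcases (w.mono i a b he hlt.le).lt_or_eq with hl | hl
  · exact Or.inr ⟨i, _, _, hl, by rw [w.comm, w.comm, he]⟩
  · exact Or.inl (by simp only [Hom.onVertex, hl])

lemma Hom.onVertex_comp (u : τ ⟶ σ) (v : σ ⟶ ρ) (x : τ.Vertex) :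
    Hom.onVertex (u ≫ v) x = Hom.onVertex v (Hom.onVertex u x) := rfl

lemma Hom.onVertex_surjective (u : τ ⟶ σ) : Function.Surjective (Hom.onVertex u) := by
  rintro ⟨i, a⟩
  obtain ⟨b, rfl⟩ := u.surj i a
  exact ⟨⟨i, b⟩, rfl⟩

lemma Hom.sgn_eq_mergeSign (u : τ ⟶ σ) :
    Hom.sgn u = mergeSign τ.Precedes σ.Precedes (Hom.onVertex u) := rfl

lemma Hom.exists_mergesPair {v : τ ⟶ σ} (hv : Hom.deg v = 1) :
    ∃ x x', τ.SibLT x x' ∧ MergesPair (Hom.onVertex v) x x' := by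
  obtain ⟨i, c, c', hlt, hm⟩ := Hom.exists_isMerge hv
  refine ⟨⟨⟨i, hm.lt⟩, c⟩, ⟨⟨i, hm.lt⟩, c'⟩, ⟨⟨i, hm.lt⟩, c, c', hlt, hm.map_eq⟩, ?_, ?_, ?_⟩
  · simpa using hm.ne
  · simp only [Hom.onVertex, hm.eq]
  · rintro ⟨j, a⟩ ⟨j', b⟩ ha hb hab
    obtain ⟨rfl, hab⟩ := Sigma.mk.inj_iff.1 hab
    have hab : v.app j a = v.app j b := eq_of_heq hab
    by_cases hj : (j : ℕ) = i
    · subst hj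
      rw [hm.inj a b (fun h => ha (by rw [h])) (fun h => hb (by rw [h])) hab]
    · rw [hm.inj_of_ne j hj hab]

/-! ### The two successive mergings of a factorization of a morphism of degree two -/

namespace Factorization

variable {f : τ ⟶ φ}

/-- The two successive mergings of a factorization into morphisms of degree `1`: the vertices `x`,
`x'` are merged first, and the images of `r`, `r'` afterwards. -/
structure MergeData (W : Factorization f) (x x' r r' : τ.Vertex) : Prop where
  sib : τ.SibLT x x'
  merges : MergesPair (Hom.onVertex W.fst) x x'
  left_ne : r ≠ x
  right_ne : r' ≠ x
  sib' : W.mid.SibLT (Hom.onVertex W.fst r) (Hom.onVertex W.fst r')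
  merges' : MergesPair (Hom.onVertex W.snd) (Hom.onVertex W.fst r) (Hom.onVertex W.fst r')

lemma onVertex_snd (W : Factorization f) (x : τ.Vertex) :
    Hom.onVertex W.snd (Hom.onVertex W.fst x) = Hom.onVertex f x := by
  rw [← Hom.onVertex_comp, W.comp]

lemma exists_mergeData {W : Factorization f} (h : Hom.deg W.fst = 1) (h' : Hom.deg W.snd = 1) :
    ∃ x x' r r', W.MergeData x x' r r' := by
  obtain ⟨x, x', hx, hm⟩ := Hom.exists_mergesPair h
  obtain ⟨z, z', hz, hm'⟩ := Hom.exists_mergesPair h'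
  have key : ∀ z, ∃ r, r ≠ x ∧ Hom.onVertex W.fst r = z := by
    intro z
    obtain ⟨r, rfl⟩ := Hom.onVertex_surjective W.fst z
    by_cases hr : r = x
    · exact ⟨x', hm.ne.symm, by rw [hr, hm.eq]⟩
    · exact ⟨r, hr, rfl⟩
  obtain ⟨r, hr, rfl⟩ := key z
  obtain ⟨r', hr', rfl⟩ := key z'
  exact ⟨x, x', r, r', hx, hm, hr, hr', hz, hm'⟩

/-- Away from `x` the first merging is injective, so whatever `f` still identifies is identified by
the second merging, which concerns the pair of `r` and `r'` only. -/
lemma MergeData.eq_or_eq {W : Factorization f} {x x' r r' : τ.Vertex} (h : W.MergeData x x' r r')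
    {y y' : τ.Vertex} (hy : y ≠ x) (hy' : y' ≠ x) (hne : y ≠ y')
    (he : Hom.onVertex f y = Hom.onVertex f y') : (y = r ∧ y' = r') ∨ (y = r' ∧ y' = r) := by
  have hne' : Hom.onVertex W.fst y ≠ Hom.onVertex W.fst y' := fun he' =>
    hne (h.merges.inj _ _ hy hy' he')
  rw [← W.onVertex_snd, ← W.onVertex_snd] at he
  have h1 := (h.merges'.isMergedBy_iff _).1 ⟨_, hne'.symm, he.symm⟩
  have h2 := (h.merges'.isMergedBy_iff _).1 ⟨_, hne', he⟩
  rcases h1 with h1 | h1 <;> rcases h2 with h2 | h2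
  · exact absurd (h1.trans h2.symm) hne'
  · exact Or.inl ⟨h.merges.inj _ _ hy h.left_ne h1, h.merges.inj _ _ hy' h.right_ne h2⟩
  · exact Or.inr ⟨h.merges.inj _ _ hy h.right_ne h1, h.merges.inj _ _ hy' h.left_ne h2⟩
  · exact absurd (h1.trans h2.symm) hne'

lemma MergeData.map_eq {W : Factorization f} {x x' r r' : τ.Vertex} (h : W.MergeData x x' r r') :
    Hom.onVertex f r = Hom.onVertex f r' := by
  rw [← W.onVertex_snd, ← W.onVertex_snd, h.merges'.eq]

/-- Two different factorizations merge first the same vertices only if the second mergings are in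
reverse order. -/
lemma MergeData.eq_left {W V : Factorization f} {x x' y' r r' s s' : τ.Vertex}
    (hW : W.MergeData x x' r r') (hV : V.MergeData x y' s s') : x' = y' := by
  have key : ∀ {W : Factorization f} {x x' y' r r' : τ.Vertex}, W.MergeData x x' r r' →
      τ.SibLT x y' → τ.SibLT y' x' → False := by
    intro W x x' y' r r' hW h1 h2
    have hne : Hom.onVertex W.fst x = Hom.onVertex W.fst y' := by
      rcases h1.onVertex W.fst with h | h
      · exact h
      · rcases h2.onVertex W.fst with h' | h'
        · rw [hW.merges.eq, h']
        · rw [hW.merges.eq] at h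
          exact absurd h' h.asymm
    rcases (hW.merges.isMergedBy_iff y').1 ⟨x, h1.ne, hne⟩ with h | h
    · exact h1.ne h.symm
    · exact h2.ne h
  rcases hW.sib.trichotomy hV.sib with h | h | h
  · exact (key hV hW.sib h).elim
  · exact h
  · exact (key hW hV.sib h).elim

/-- `f` identifies `y` with a sibling on its right other than `x`: with `y'`, or with `x'` if `y' =
x`. This pair must be the second merging of `W`, and the order of siblings makes `y` its left
member. -/
lemma MergeData.left_eq {W V : Factorization f} {x x' y y' r r' s s' : τ.Vertex}
    (hW : W.MergeData x x' r r') (hV : V.MergeData y y' s s') (hne : x ≠ y) : r = y := by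
  have key : ∀ z, z ≠ x → τ.SibLT y z → Hom.onVertex f y = Hom.onVertex f z → r = y := by
    intro z hz hyz he
    rcases hW.eq_or_eq hne.symm hz hyz.ne he with h | h
    · exact h.1.symm
    · have h1 := hW.sib'
      rw [← h.1, ← h.2] at h1
      rcases hyz.onVertex W.fst with h2 | h2
      · exact absurd h2.symm h1.ne
      · exact absurd h1 h2.asymm
  have hVe : Hom.onVertex f y = Hom.onVertex f y' := by
    rw [← V.onVertex_snd, ← V.onVertex_snd, hV.merges.eq]
  have hWe : Hom.onVertex f x = Hom.onVertex f x' := by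
    rw [← W.onVertex_snd, ← W.onVertex_snd, hW.merges.eq]
  by_cases hxy : y' = x
  · subst hxy
    exact key x' hW.sib.ne.symm (hV.sib.trans hW.sib) (hVe.trans hWe)
  · exact key y' hxy hV.sib hVe

/-- The preorders agree level by level from the root. Over equivalent parents, `f` decides all
comparisons of vertices with different images. Among the vertices other than `x` the only remaining
pair is `r`, `r'`, whose order is part of the data. -/
lemma MergeData.factorization_eq {W V : Factorization f} {x x' r r' : τ.Vertex}
    (hW : W.MergeData x x' r r') (hV : V.MergeData x x' r r') : W = V := by
  have key : ∀ {W V : Factorization f}, W.MergeData x x' r r' → V.MergeData x x' r r' →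
      ∀ (j : Fin n), (∀ a b, W.le (j + 1) a b ↔ V.le (j + 1) a b) →
        ∀ a b, W.le j a b → V.le j a b := by
    intro W V hW hV j ih a b hab
    by_cases hba : W.le (j + 1) (τ.map j b) (τ.map j a)
    · have h1 := W.le_fib hab hba
      by_contra hV'
      have hVba := (V.le_total j a b).resolve_left hV'
      have h2 := V.le_fib hVba ((ih _ _).1 (W.le_map hab))
      have hf : f.app j a = f.app j b := le_antisymm h1 h2
      have core : ∀ a b : Fin (τ.card j), (⟨j, a⟩ : τ.Vertex) ≠ x → (⟨j, b⟩ : τ.Vertex) ≠ x →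
          f.app j a = f.app j b → W.le j a b → V.le j a b := by
        intro a b ha hb hf hab
        by_cases hne : a = b
        · rw [hne]
          exact V.le_refl _ _
        · rcases hW.eq_or_eq ha hb (by simpa using hne) (by simp only [Hom.onVertex, hf]) with
            ⟨rfl, rfl⟩ | ⟨rfl, rfl⟩
          · have := hV.sib'
            simp only [Hom.onVertex] at this
            cases this with | intro _ _ _ lt _ => exact lt.le
          · have := hW.sib'
            simp only [Hom.onVertex] at this
            cases this with | intro _ _ _ lt _ => exact absurd hab (not_le.2 lt)
      -- The vertex `x` is replaced by `x'`, with which it is already identified by both first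
      -- factors; this reduces everything to `core`.
      have hmerge : ∀ {U : Factorization f}, U.MergeData x x' r r' → ∀ a c : Fin (τ.card j),
          (⟨j, a⟩ : τ.Vertex) = x → (⟨j, c⟩ : τ.Vertex) = x' → U.fst.app j a = U.fst.app j c := by
        intro U hU a c ha hc
        have := hU.merges.eq
        rw [← ha, ← hc] at this
        simpa [Hom.onVertex] using this
      have hex : ∀ a : Fin (τ.card j), (⟨j, a⟩ : τ.Vertex) = x →
          ∃ c : Fin (τ.card j), (⟨j, c⟩ : τ.Vertex) = x' := by
        intro a ha
        have := hW.sib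
        rw [← ha] at this
        cases this with | intro _ _ c _ _ => exact ⟨c, rfl⟩
      have hx'x := hW.merges.ne.symm
      have hfst : ∀ {U : Factorization f}, U.MergeData x x' r r' → ∀ a c : Fin (τ.card j),
          (⟨j, a⟩ : τ.Vertex) = x → (⟨j, c⟩ : τ.Vertex) = x' → f.app j a = f.app j c := by
        intro U hU a c ha hc
        rw [← U.snd_app, ← U.snd_app, hmerge hU a c ha hc]
      by_cases ha : (⟨j, a⟩ : τ.Vertex) = x
      · by_cases hb : (⟨j, b⟩ : τ.Vertex) = x
        · obtain rfl : a = b := by simpa using ha.trans hb.symm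
          exact hV' (V.le_refl _ _)
        · obtain ⟨c, hc⟩ := hex a ha
          have h3 := core c b (by rwa [hc]) hb ((hfst hW a c ha hc).symm.trans hf)
            (by unfold le at hab ⊢; rwa [← hmerge hW a c ha hc])
          refine hV' ?_
          unfold le at h3 ⊢
          rwa [hmerge hV a c ha hc]
      · by_cases hb : (⟨j, b⟩ : τ.Vertex) = x
        · obtain ⟨c, hc⟩ := hex b hb
          have h3 := core a c ha (by rwa [hc]) (hf.trans (hfst hW b c hb hc))
            (by unfold le at hab ⊢; rwa [← hmerge hW b c hb hc])
          refine hV' ?_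
          unfold le at h3 ⊢
          rwa [hmerge hV b c hb hc]
        · exact hV' (core a b ha hb hf hab)
    · rw [ih] at hba
      exact (V.le_total j a b).resolve_right fun h => hba (V.le_map h)
  have hall : ∀ d j, n ≤ j + d → ∀ a b, W.le j a b ↔ V.le j a b := by
    intro d
    induction d with
    | zero =>
      intro j hj a b
      rw [subsingleton_of_le τ hj a b]
      exact ⟨fun _ => V.le_refl _ _, fun _ => W.le_refl _ _⟩
    | succ d ih =>
      intro j hj a b
      have ih := ih (j + 1) (by omega)
      rcases lt_or_ge j n with hjn | hjn
      · exact ⟨key hW hV ⟨j, hjn⟩ ih a b, key hV hW ⟨j, hjn⟩ (fun a b => (ih a b).symm) a b⟩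
      · rw [subsingleton_of_le τ hjn a b]
        exact ⟨fun _ => V.le_refl _ _, fun _ => W.le_refl _ _⟩
  exact ext_of_le fun j => hall n j (by omega)

/-- Two different factorizations into morphisms of degree `1` have opposite signs. -/
theorem sgn_mul_sgn_eq_neg {W V : Factorization f} (hW : Hom.deg W.fst = 1)
    (hW' : Hom.deg W.snd = 1) (hV : Hom.deg V.fst = 1) (hV' : Hom.deg V.snd = 1) (hne : W ≠ V) :
    Hom.sgn W.fst * Hom.sgn W.snd = -(Hom.sgn V.fst * Hom.sgn V.snd) := by
  classical
  have hd : ∀ τ : PrunedTree n, 0 ≤ τ.degree := fun τ =>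
    Finset.sum_nonneg fun i _ => Int.natCast_nonneg _
  obtain ⟨m, hm⟩ := Int.eq_ofNat_of_zero_le (hd φ)
  have hτ : τ.degree = (m + 2 : ℕ) := by
    have h1 := W.deg_add
    unfold Hom.deg at *
    push_cast
    omega
  have hmid : ∀ W : Factorization f, Hom.deg W.snd = 1 → W.mid.degree = (m + 1 : ℕ) := by
    intro W hW'
    unfold Hom.deg at *
    push_cast
    omega
  obtain ⟨eτ, heτ⟩ := exists_numbering τ hτ
  obtain ⟨eφ, heφ⟩ := exists_numbering φ hm
  obtain ⟨D, hadd, hswap, hfib, hD⟩ := exists_alternating_form eτ heτ eφ heφ (Hom.onVertex f)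
  have hself : ∀ α, D α α = 0 := fun α => by have := hswap α α; omega
  -- If the second merging involves the vertex fused from `x`, its indicator pulls back to the sum
  -- of the indicators of `x` and `r`. The first summand contributes nothing since the form is
  -- alternating, so the formula is uniform.
  have hsgn : ∀ (W : Factorization f) (_ : Hom.deg W.snd = 1) {x x' r r' : τ.Vertex},
      W.MergeData x x' r r' →
      Hom.sgn W.fst * Hom.sgn W.snd = D (Pi.single x 1) (Pi.single r 1) := by
    intro W hW' x x' r r' h
    obtain ⟨em, hem⟩ := exists_numbering W.mid (hmid W hW')
    have key := fun β => hD W.mid.Precedes em hem (Hom.onVertex W.fst) (Hom.onVertex W.snd)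
      W.onVertex_snd x x' _ _ h.merges h.sib.precedes h.merges' h.sib'.precedes (Pi.single x 1) β
      (by simp) (fun a ha => by simp [ha])
    rw [Hom.sgn_eq_mergeSign, Hom.sgn_eq_mergeSign]
    by_cases hr : Hom.onVertex W.fst r = Hom.onVertex W.fst x
    · rw [key (Pi.single x 1 + Pi.single r 1), hadd, hself, zero_add]
      · intro a ha
        by_cases hax : a = x
        · subst hax
          simp [h.left_ne.symm]
        · rw [h.merges.inj a r hax h.left_ne ha]
          simp [h.left_ne]
      · intro a ha
        have h1 : a ≠ x := fun h' => ha (by rw [h', hr])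
        have h2 : a ≠ r := fun h' => ha (by rw [h'])
        simp [h1, h2]
    · rw [key (Pi.single r 1)]
      · intro a ha
        have hax : a ≠ x := fun h' => hr (by rw [← ha, h'])
        rw [h.merges.inj a r hax h.left_ne ha]
        simp
      · intro a ha
        have h2 : a ≠ r := fun h' => ha (by rw [h'])
        simp [h2]
  obtain ⟨x, x', r, r', h⟩ := exists_mergeData hW hW'
  obtain ⟨y, y', s, s', h'⟩ := exists_mergeData hV hV'
  rw [hsgn W hW' h, hsgn V hV' h']
  by_cases hxy : x = y
  · subst hxy
    obtain rfl := h.eq_left h'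
    have hss : s ≠ s' := fun he => h'.sib'.ne (by rw [he])
    rcases h.eq_or_eq h'.left_ne h'.right_ne hss h'.map_eq with ⟨rfl, rfl⟩ | ⟨rfl, rfl⟩
    · exact absurd (h.factorization_eq h') hne
    -- The second mergings are in reverse order. The indicators of `s` and `s'`, together with that
    -- of `x` if it lies in the same fibre of `f`, add up to the indicator of this fibre, on which
    -- the form vanishes.
    · rw [eq_neg_iff_add_eq_zero, ← hadd]
      by_cases hx : Hom.onVertex f x = Hom.onVertex f s
      · have h1 : D (Pi.single x 1) (Pi.single x 1 + (Pi.single s' 1 + Pi.single s 1)) = 0 := by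
          refine hfib _ (Hom.onVertex f s) _ (fun a ha => ?_) (fun a ha => ?_)
          · by_cases hax : a = x
            · subst hax
              simp [h'.left_ne.symm, h'.right_ne.symm]
            · by_cases has : a = s
              · subst has
                simp [h'.left_ne, hss]
              · rcases h'.eq_or_eq hax h'.left_ne has ha with h1 | h1
                · exact absurd h1.1 has
                · rw [h1.1]
                  simp [h'.right_ne, hss.symm]
          · have h1 : a ≠ x := fun h1 => ha (by rw [h1, hx])
            have h2 : a ≠ s := fun h1 => ha (by rw [h1])
            have h3 : a ≠ s' := fun h1 => ha (by rw [h1, h'.map_eq])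
            simp [h1, h2, h3]
        rwa [hadd, hself, zero_add] at h1
      · refine hfib _ (Hom.onVertex f s) _ (fun a ha => ?_) (fun a ha => ?_)
        · have hax : a ≠ x := fun h1 => hx (by rw [← h1, ha])
          by_cases has : a = s
          · subst has
            simp [hss]
          · rcases h'.eq_or_eq hax h'.left_ne has ha with h1 | h1
            · exact absurd h1.1 has
            · rw [h1.1]
              simp [hss.symm]
        · have h2 : a ≠ s := fun h1 => ha (by rw [h1])
          have h3 : a ≠ s' := fun h1 => ha (by rw [h1, h'.map_eq])
          simp [h2, h3]
  -- With different first mergings, the two left vertices exchange their roles, and antisymmetry of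
  -- the form is the sign.
  · rw [h.left_eq h' hxy, h'.left_eq h (Ne.symm hxy)]
    exact hswap _ _

end Factorization

end PrunedTree

/-! ### Contractions of matrices from acyclic matchings -/

section Contraction

open Matrix

/-- A square-zero matrix `d` with an acyclic perfect matching is contractible. -/
lemma exists_contraction_of_matching {P α : Type*} [Fintype P] [DecidableEq P] [LinearOrder α]
    (d : Matrix P P ℤ) (hd : d * d = 0) (M : P → Prop) (μ : {p // M p} ≃ {p // ¬ M p})
    (ρ : {p // M p} → α) (hunit : ∀ p, IsUnit (d p.1 (μ p).1))
    (htri : ∀ p q, p ≠ q → d p.1 (μ q).1 ≠ 0 → ρ p < ρ q) :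
    ∃ h : Matrix P P ℤ, d * h + h * d = 1 := by
  classical
  let B : Matrix {p // M p} {p // M p} ℤ := fun p q => d p.1 (μ q).1
  have hB : IsUnit B.det := by
    have ht : B.BlockTriangular ρ := by
      intro p q hpq
      by_contra hne
      by_cases he : p = q
      · exact absurd hpq (he ▸ lt_irrefl _)
      · exact lt_asymm hpq (htri p q he hne)
    rw [ht.det]
    refine Finset.univ.image ρ |>.prod_induction _ IsUnit (fun a b => IsUnit.mul) isUnit_one
      fun a _ => ?_
    -- Distinct elements of equal rank have zero entries, since `htri` is strict; so the blocks on
    -- the diagonal are diagonal with unit entries.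
    have hdiag : B.toSquareBlock ρ a = Matrix.diagonal fun p => B p.1 p.1 := by
      ext p q
      by_cases hpq : p = q
      · subst hpq
        simp [Matrix.toSquareBlock_def]
      · rw [Matrix.diagonal_apply_ne _ hpq, Matrix.toSquareBlock_def]
        by_contra hne
        have := htri p.1 q.1 (fun h => hpq (Subtype.ext h)) hne
        rw [p.2, q.2] at this
        exact lt_irrefl _ this
    rw [hdiag, Matrix.det_diagonal]
    exact Finset.univ.prod_induction _ IsUnit (fun a b => IsUnit.mul) isUnit_one
      fun p _ => hunit p.1
  let e : {p // M p} ⊕ {p // ¬ M p} ≃ P := Equiv.sumCompl M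
  let dMA : Matrix {p // M p} {p // ¬ M p} ℤ := B.submatrix id μ.symm
  let X : Matrix {p // ¬ M p} {p // M p} ℤ := B⁻¹.submatrix μ.symm id
  have h1 : dMA * X = 1 := by
    have := Matrix.submatrix_mul_equiv B B⁻¹ id μ.symm id
    rw [this, Matrix.mul_nonsing_inv B hB]
    simp
  have h2 : X * dMA = 1 := by
    have := Matrix.submatrix_mul_equiv B⁻¹ B μ.symm (Equiv.refl _) μ.symm
    simp only [Equiv.coe_refl] at this
    rw [this, Matrix.nonsing_inv_mul B hB, Matrix.submatrix_one_equiv]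
  have hdMA : (d.submatrix e e).toBlocks₁₂ = dMA := by
    ext p q
    change d p.1 q.1 = d p.1 (μ (μ.symm q)).1
    rw [Equiv.apply_symm_apply]
  set D := d.submatrix e e with hD
  have hDD : D * D = 0 := by
    rw [hD, Matrix.submatrix_mul_equiv, hd]
    rfl
  rw [← Matrix.fromBlocks_toBlocks D, hdMA, Matrix.fromBlocks_multiply] at hDD
  have h12 : D.toBlocks₁₁ * dMA + dMA * D.toBlocks₂₂ = 0 := by
    have := congrArg Matrix.toBlocks₁₂ hDD
    rwa [Matrix.toBlocks_fromBlocks₁₂] at this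
  -- The candidate homotopy is `X` alone in the lower left block. The diagonal blocks of the
  -- homotopy identity say that `X` is inverse to `dMA`; the remaining block is a block of `D * D =
  -- 0` multiplied by `X` on both sides.
  have hX : D.toBlocks₂₂ * X + X * D.toBlocks₁₁ = 0 := by
    have h3 : X * (D.toBlocks₁₁ * dMA + dMA * D.toBlocks₂₂) * X = 0 := by rw [h12]; simp
    rw [Matrix.mul_add, Matrix.add_mul, ← Matrix.mul_assoc X dMA, h2, Matrix.one_mul,
      Matrix.mul_assoc, Matrix.mul_assoc, h1, Matrix.mul_one] at h3
    rwa [add_comm]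
  let h : Matrix ({p // M p} ⊕ {p // ¬ M p}) ({p // M p} ⊕ {p // ¬ M p}) ℤ :=
    Matrix.fromBlocks 0 0 X 0
  have hmain : D * h + h * D = 1 := by
    rw [← Matrix.fromBlocks_toBlocks D, hdMA, Matrix.fromBlocks_multiply,
      Matrix.fromBlocks_multiply, Matrix.fromBlocks_add]
    simp only [Matrix.mul_zero, Matrix.zero_mul, add_zero, zero_add, h1, h2, hX]
    exact Matrix.fromBlocks_one
  refine ⟨h.submatrix e.symm e.symm, ?_⟩
  have hd' : d = D.submatrix e.symm e.symm := by
    rw [hD, Matrix.submatrix_submatrix]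
    simp
  rw [hd', Matrix.submatrix_mul_equiv, Matrix.submatrix_mul_equiv, ← Matrix.submatrix_one_equiv e.symm,
    ← hmain]
  rfl

end Contraction

/-! ### Alternating sums over factorizations and contractibility of the intervals -/

namespace PrunedTree

variable {n : ℕ} {τ σ ρ φ : PrunedTree n}

noncomputable instance (u : τ ⟶ σ) : Fintype (Factorization u) := Fintype.ofFinite _

open Classical in
/-- The sign of a morphism of degree `1`, extended by zero to all morphisms. -/
noncomputable def Hom.coeff (v : τ ⟶ σ) : ℤ := if Hom.deg v = 1 then Hom.sgn v else 0

lemma Hom.coeff_of_deg_ne {v : τ ⟶ σ} (h : Hom.deg v ≠ 1) : Hom.coeff v = 0 := if_neg h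

lemma Hom.isUnit_coeff {v : τ ⟶ σ} (h : Hom.deg v = 1) : IsUnit (Hom.coeff v) := by
  rw [Hom.coeff, if_pos h, Hom.sgn]
  exact IsUnit.pow _ isUnit_one.neg

/-- Only morphisms of degree two have nonzero terms, and then exactly two, which cancel. All the
square-zero statements reduce to this identity. -/
lemma sum_coeff_mul_coeff (g : τ ⟶ σ) :
    ∑ W : Factorization g, Hom.coeff W.fst * Hom.coeff W.snd = 0 := by
  classical
  by_cases hg : Hom.deg g = 2
  · obtain ⟨F, G, hne, hFG⟩ := Factorization.exists_pair_of_deg_eq_two hg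
    have hF := (hFG F).2 (Or.inl rfl)
    have hG := (hFG G).2 (Or.inr rfl)
    have hF' : Hom.deg F.snd = 1 := by have := F.deg_add; omega
    have hG' : Hom.deg G.snd = 1 := by have := G.deg_add; omega
    rw [Fintype.sum_eq_add F G hne]
    · simp only [Hom.coeff, hF, hG, hF', hG', if_true]
      rw [Factorization.sgn_mul_sgn_eq_neg hF hF' hG hG' hne]
      ring
    · intro W hW
      rw [Hom.coeff_of_deg_ne, zero_mul]
      exact fun h => ((hFG W).1 h).elim hW.1 hW.2
  · refine Finset.sum_eq_zero fun W _ => ?_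
    by_cases h1 : Hom.deg W.fst = 1
    · rw [Hom.coeff_of_deg_ne (v := W.snd), mul_zero]
      have := W.deg_add
      omega
    · rw [Hom.coeff_of_deg_ne h1, zero_mul]

namespace Factorization

variable {f : τ ⟶ φ}

open Classical in
/-- The coefficient of `G` in the differential of `F`. -/
noncomputable def coeff (F G : Factorization f) : ℤ :=
  if h : ∃ v : G.mid ⟶ F.mid, G.fst ≫ v = F.fst then Hom.coeff h.choose else 0

lemma coeff_eq {F G : Factorization f} {v : G.mid ⟶ F.mid} (hv : G.fst ≫ v = F.fst) :
    coeff F G = Hom.coeff v := by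
  have h : ∃ v : G.mid ⟶ F.mid, G.fst ≫ v = F.fst := ⟨v, hv⟩
  rw [coeff, dif_pos h, cancel_left (h.choose_spec.trans hv.symm)]

lemma coeff_eq_zero {F G : Factorization f} (h : ¬ ∃ v : G.mid ⟶ F.mid, G.fst ≫ v = F.fst) :
    coeff F G = 0 := dif_neg h

lemma covers_of_coeff_ne_zero {F G : Factorization f} (h : coeff F G ≠ 0) : Covers F G := by
  by_cases hv : ∃ v : G.mid ⟶ F.mid, G.fst ≫ v = F.fst
  · obtain ⟨v, hv⟩ := hv
    refine ⟨v, hv, ?_⟩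
    by_contra hd
    rw [coeff_eq hv, Hom.coeff_of_deg_ne hd] at h
    exact h rfl
  · exact absurd (coeff_eq_zero hv) h

lemma Covers.isUnit_coeff {F G : Factorization f} (h : Covers F G) : IsUnit (coeff F G) := by
  obtain ⟨v, hv, hd⟩ := h
  rw [coeff_eq hv]
  exact Hom.isUnit_coeff hd

/-- The factorization obtained by a factorization of the first morphism. -/
def refineFst (F : Factorization f) (G : Factorization F.fst) : Factorization f :=
  ⟨G.mid, G.fst, G.snd ≫ F.snd, by rw [← Category.assoc, G.comp, F.comp]⟩

lemma refineFst_injective (F : Factorization f) : Function.Injective F.refineFst := by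
  intro G H h
  refine ext_of_le fun i a b => ?_
  change (F.refineFst G).le i a b ↔ (F.refineFst H).le i a b
  rw [h]

lemma coeff_refineFst (F : Factorization f) (G : Factorization F.fst) :
    coeff F (F.refineFst G) = Hom.coeff G.snd := coeff_eq G.comp

/-- Identifies the part of the Koszul twisting that moves a merging from `u` to `x` with the
differential of the interval of the composite. -/
lemma sum_refineFst {A : Type*} [AddCommGroup A] (F : Factorization f) (ψ : Factorization f → A) :
    ∑ G : Factorization F.fst, Hom.coeff G.snd • ψ (F.refineFst G) = ∑ G, coeff F G • ψ G := by
  refine Fintype.sum_of_injective F.refineFst F.refineFst_injective _ _ (fun G hG => ?_)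
    fun G => by rw [coeff_refineFst]
  rw [coeff_eq_zero, zero_smul]
  rintro ⟨v, hv⟩
  refine hG ⟨⟨G.mid, G.fst, v, hv⟩, ext_of_le fun i a b => Iff.rfl⟩

/-- The elements between `H` and `F` are the factorizations of the comparison morphism `H.mid ⟶
F.mid`. -/
lemma coeff_mul_self : (Matrix.of (coeff (f := f))) * Matrix.of coeff = 0 := by
  ext F H
  rw [Matrix.mul_apply, Matrix.zero_apply]
  simp only [Matrix.of_apply]
  by_cases hg : ∃ g : H.mid ⟶ F.mid, H.fst ≫ g = F.fst
  · obtain ⟨g, hg⟩ := hg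
    rw [← sum_coeff_mul_coeff g]
    symm
    let e : Factorization g → Factorization f := fun W =>
      ⟨W.mid, H.fst ≫ W.fst, W.snd ≫ F.snd, by
        rw [Category.assoc, ← Category.assoc W.fst, W.comp, ← Category.assoc, hg, F.comp]⟩
    refine Fintype.sum_of_injective e (fun W V hWV => ext_of_le fun i a b => ?_) _ _
      (fun G hG => ?_) fun W => ?_
    · obtain ⟨a, rfl⟩ := H.fst.surj i a
      obtain ⟨b, rfl⟩ := H.fst.surj i b
      change (e W).le i a b ↔ (e V).le i a b
      rw [hWV]
    · by_contra hne
      obtain ⟨v, hv, -⟩ := covers_of_coeff_ne_zero (left_ne_zero_of_mul hne)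
      obtain ⟨w, hw, -⟩ := covers_of_coeff_ne_zero (right_ne_zero_of_mul hne)
      refine hG ⟨⟨G.mid, w, v, cancel_left (u := H.fst) ?_⟩, ext_of_le fun i a b => ?_⟩
      · rw [← Category.assoc, hw, hv, hg]
      · change Hom.app (H.fst ≫ w) i a ≤ Hom.app (H.fst ≫ w) i b ↔ _
        rw [hw]
        rfl
    · rw [coeff_eq (F := F) (G := e W) (v := W.snd) (by rw [Category.assoc, W.comp, hg]),
        coeff_eq (F := e W) (G := H) (v := W.fst) rfl, mul_comm]
  · refine Finset.sum_eq_zero fun G _ => ?_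
    by_contra hne
    obtain ⟨v, hv, -⟩ := covers_of_coeff_ne_zero (left_ne_zero_of_mul hne)
    obtain ⟨w, hw, -⟩ := covers_of_coeff_ne_zero (right_ne_zero_of_mul hne)
    exact hg ⟨w ≫ v, by rw [← Category.assoc, hw, hv]⟩

open Classical in
/-- The intervals of positive degree are contractible. -/
theorem exists_contraction (hf : Hom.deg f ≠ 0) : ∃ h : Factorization f → Factorization f → ℤ,
    (∀ F G, h F G ≠ 0 → Hom.deg G.fst = Hom.deg F.fst + 1) ∧
    ∀ F H, ∑ G, coeff F G * h G H + ∑ G, h F G * coeff G H = if F = H then 1 else 0 := by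
  choose i l hil using exists_firstNonCrit hf
  let M : Factorization f → Prop := fun F => ¬ F.Alone (i F) (l F)
  have hsplit : ∀ F : {F // M F}, ∃ G : {F // ¬ M F}, IsSplit F.1 G.1 (i F.1) (l F.1) := by
    rintro ⟨F, hF⟩
    obtain ⟨G, hG⟩ := exists_isSplit (hil F) hF
    refine ⟨⟨G, ?_⟩, hG⟩
    have h1 := (hG.cast (hG.first'.eq (hil G))).alone
    exact fun h => h h1
  choose μ hμ using hsplit
  have hμb : Function.Bijective μ := by
    refine ⟨fun F F' h => Subtype.ext ?_, fun G => ?_⟩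
    · have h1 := hμ F
      have h2 := hμ F'
      rw [h] at h1
      exact (h1.cast (h1.first'.eq h2.first')).left_unique h2
    · obtain ⟨F, hF⟩ := exists_isSplit' (hil G.1) (not_not.1 G.2)
      have h1 := hF.cast (hF.first.eq (hil F))
      refine ⟨⟨F, h1.not_alone⟩, Subtype.ext ?_⟩
      exact (hμ ⟨F, h1.not_alone⟩).right_unique h1
  -- The lexicographic rank: the first noncritical vertex cannot decrease under refinement, and if
  -- it stays the same, its position increases unless the refinement is the matched one.
  let r : {F // M F} → ℕ ×ₗ ℕ ×ₗ ℕ := fun F =>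
    toLex (i F.1, toLex ((l F.1 : ℕ), F.1.pos (i F.1) (l F.1)))
  obtain ⟨h, hh⟩ := exists_contraction_of_matching (Matrix.of (coeff (f := f))) coeff_mul_self M
    (Equiv.ofBijective μ hμb) r (fun F => (hμ F).covers.isUnit_coeff) (fun F F' hne hFF' => by
      have hc : Covers F.1 (μ F').1 := covers_of_coeff_ne_zero hFF'
      have hF' := hμ F'
      obtain ⟨v, hv, -⟩ := id hc
      have key : ∀ {j : ℕ} {m : Fin (τ.card j)}, IsSplit F'.1 (μ F').1 j m →
          toLex (i F.1, toLex ((l F.1 : ℕ), F.1.pos (i F.1) (l F.1))) <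
            toLex (j, toLex ((m : ℕ), F'.1.pos j m)) := by
        intro j m hjm
        rw [Prod.Lex.toLex_lt_toLex]
        rcases (hil F.1).le_of_comp hv hjm.first' with hlt | ⟨rfl, hle⟩
        · exact Or.inl hlt
        · refine Or.inr ⟨rfl, ?_⟩
          rw [Prod.Lex.toLex_lt_toLex]
          rcases hle.lt_or_eq with hlt | he
          · exact Or.inl hlt
          · obtain rfl : l F.1 = m := he
            refine Or.inr ⟨rfl, ?_⟩
            rcases isSplit_or_pos_lt (hil F.1) F.2 hjm.first' hjm.alone hc with hs | hlt
            · exact absurd (Subtype.ext (hs.left_unique hjm)) hne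
            · rw [hjm.pos_eq]
              exact hlt
      exact key hF')
  -- The matrix inversion does not track degrees, so `h` is truncated to its part of degree one;
  -- `coeff` is homogeneous of degree minus one, so the identity survives.
  refine ⟨fun F G => if Hom.deg G.fst = Hom.deg F.fst + 1 then h F G else 0, fun F G hFG => ?_,
    fun F H => ?_⟩
  · by_contra hne
    simp [hne] at hFG
  · by_cases hd : Hom.deg F.fst = Hom.deg H.fst
    · have h1 := congrFun (congrFun hh F) H
      rw [Matrix.add_apply, Matrix.mul_apply, Matrix.mul_apply, Matrix.one_apply] at h1
      rw [← h1]
      congr 1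
      · refine Finset.sum_congr rfl fun G _ => ?_
        by_cases hc : coeff F G = 0
        · simp [hc]
        · have := (covers_of_coeff_ne_zero hc).deg_fst
          beta_reduce
          rw [if_pos (by omega)]
          rfl
      · refine Finset.sum_congr rfl fun G _ => ?_
        by_cases hc : coeff G H = 0
        · simp [hc]
        · have := (covers_of_coeff_ne_zero hc).deg_fst
          beta_reduce
          rw [if_pos (by omega)]
          rfl
    · rw [if_neg (fun h => hd (by rw [h])), Finset.sum_eq_zero, Finset.sum_eq_zero, add_zero]
      · intro G _
        by_cases hc : coeff G H = 0
        · simp [hc]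
        · have := (covers_of_coeff_ne_zero hc).deg_fst
          beta_reduce
          rw [if_neg (by omega), zero_mul]
      · intro G _
        by_cases hc : coeff F G = 0
        · simp [hc]
        · have := (covers_of_coeff_ne_zero hc).deg_fst
          beta_reduce
          rw [if_neg (by omega), mul_zero]

end Factorization

end PrunedTree

/-! ### Chain complexes of modules, elementwise -/

section DGModules

variable {k : Type u} [CommRing k]

/-- The component `X_a → Y_b` of a morphism of complexes, where `a = b`. -/
noncomputable def fAt {X Y : ChainComplex (ModuleCat.{u} k) ℤ} (p : X ⟶ Y) (a b : ℤ) (h : a = b) :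
    X.X a →ₗ[k] Y.X b :=
  (p.f a ≫ (Y.XIsoOfEq h).hom).hom

section

variable {X Y Z : ChainComplex (ModuleCat.{u} k) ℤ}

lemma fAt_rfl (p : X ⟶ Y) (a : ℤ) : fAt p a a rfl = (p.f a).hom := by
  simp [fAt]

lemma d_fAt (p : X ⟶ Y) {a b a' b' : ℤ} (h : a = b) (h' : a' = b') (x : X.X a) :
    (Y.d b b').hom (fAt p a b h x) = fAt p a' b' h' ((X.d a a').hom x) := by
  subst h h'
  rw [fAt_rfl, fAt_rfl]
  exact congrArg (fun f => ModuleCat.Hom.hom f x) (p.comm a a')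

lemma f_fAt (p : X ⟶ Y) (p' : Y ⟶ Z) {a b : ℤ} (h : a = b) (x : X.X a) :
    (p'.f b).hom (fAt p a b h x) = fAt (p ≫ p') a b h x := by
  subst h
  simp [fAt_rfl]

lemma fAt_f (p : X ⟶ Y) (p' : Y ⟶ Z) {a b : ℤ} (h : a = b) (x : X.X a) :
    fAt p' a b h ((p.f a).hom x) = fAt (p ≫ p') a b h x := by
  subst h
  simp [fAt_rfl]

lemma hom_d (p : X ⟶ Y) (a b : ℤ) (x : X.X a) :
    (Y.d a b).hom ((p.f a).hom x) = (p.f b).hom ((X.d a b).hom x) :=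
  congrArg (fun f => ModuleCat.Hom.hom f x) (p.comm a b)

lemma d_d (X : ChainComplex (ModuleCat.{u} k) ℤ) (a b c : ℤ) (x : X.X a) :
    (X.d b c).hom ((X.d a b).hom x) = 0 :=
  congrArg (fun f => ModuleCat.Hom.hom f x) (X.d_comp_d a b c)

lemma negOnePow_mul_self (d : ℤ) : (d.negOnePow : ℤ) * (d.negOnePow : ℤ) = 1 := by
  rw [← Units.val_mul, Int.units_mul_self, Units.val_one]

lemma negOnePow_smul_smul {M : Type*} [AddCommGroup M] (d : ℤ) (x : M) :
    (d.negOnePow : ℤ) • (d.negOnePow : ℤ) • x = x := by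
  rw [smul_smul, negOnePow_mul_self, one_smul]

open HomologicalComplex in
/-- A quasi-isomorphism, elementwise. -/
lemma quasiIso_iff_elementwise (f : X ⟶ Y) :
    QuasiIso f ↔
      (∀ i j l, j + 1 = i → l + 1 = j → ∀ y : Y.X j, (Y.d j l).hom y = 0 →
        ∃ (x : X.X j) (b : Y.X i), (X.d j l).hom x = 0 ∧ y = (f.f j).hom x + (Y.d i j).hom b) ∧
      (∀ i j l, j + 1 = i → l + 1 = j → ∀ (x : X.X j) (b : Y.X i), (X.d j l).hom x = 0 →
        (f.f j).hom x = (Y.d i j).hom b → ∃ w : X.X i, (X.d i j).hom w = x) := by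
  have key : ∀ i j l, j + 1 = i → l + 1 = j → (QuasiIsoAt f j ↔
      (∀ y : Y.X j, (Y.d j l).hom y = 0 →
        ∃ (x : X.X j) (b : Y.X i), (X.d j l).hom x = 0 ∧ y = (f.f j).hom x + (Y.d i j).hom b) ∧
      (∀ (x : X.X j) (b : Y.X i), (X.d j l).hom x = 0 →
        (f.f j).hom x = (Y.d i j).hom b → ∃ w : X.X i, (X.d i j).hom w = x)) := by
    intro i j l hi hl
    have hp : (ComplexShape.down ℤ).prev j = i := (ComplexShape.down ℤ).prev_eq' hi
    have hn : (ComplexShape.down ℤ).next j = l := (ComplexShape.down ℤ).next_eq' hl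
    rw [quasiIsoAt_iff_isIso_homologyMap, isIso_iff_mono_and_epi, and_comm,
      mono_homologyMap_iff_up_to_refinements f i j l hp hn,
      epi_homologyMap_iff_up_to_refinements f i j l hp hn]
    refine and_congr ⟨fun h y hy => ?_, fun h A y hy => ?_⟩ ⟨fun h x b hx hb => ?_,
      fun h A x hx b hb => ?_⟩
    · obtain ⟨A', π, hπ, x, hx, b, hb⟩ := h (A := ModuleCat.of k k)
        (ModuleCat.ofHom (LinearMap.toSpanSingleton k _ y)) (by ext; simpa using hy)
      obtain ⟨a, ha⟩ := (ModuleCat.epi_iff_surjective π).1 hπ (1 : k)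
      refine ⟨x.hom a, b.hom a, congrArg (fun g => ModuleCat.Hom.hom g a) hx, ?_⟩
      have h1 := congrArg (fun g => ModuleCat.Hom.hom g a) hb
      simp only [ModuleCat.hom_comp, LinearMap.comp_apply, ModuleCat.hom_add, LinearMap.add_apply,
        ModuleCat.hom_ofHom] at h1
      rw [← h1]
      erw [ha]
      simp
    · have h' : ∀ a : A, ∃ (x : X.X j) (b : Y.X i), (X.d j l).hom x = 0 ∧
          y.hom a = (f.f j).hom x + (Y.d i j).hom b :=
        fun a => h _ (congrArg (fun g => ModuleCat.Hom.hom g a) hy)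
      choose x b hx hb using h'
      -- The elementwise choices need not be linear in `a`; they become linear on the free module
      -- over the underlying set of `A`, which maps onto `A`.
      refine ⟨ModuleCat.of k (A →₀ k), ModuleCat.ofHom (Finsupp.linearCombination k id),
        (ModuleCat.epi_iff_surjective _).2 fun a => ⟨Finsupp.single a 1, by simp⟩,
        ModuleCat.ofHom (Finsupp.linearCombination k x), ?_,
        ModuleCat.ofHom (Finsupp.linearCombination k b), ?_⟩
      · ext a
        simp [hx]
      · ext a
        simp [hb]
    · obtain ⟨A', π, hπ, w, hw⟩ := h (A := ModuleCat.of k k)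
        (ModuleCat.ofHom (LinearMap.toSpanSingleton k _ x)) (by ext; simpa using hx)
        (ModuleCat.ofHom (LinearMap.toSpanSingleton k _ b)) (by ext; simpa using hb)
      obtain ⟨a, ha⟩ := (ModuleCat.epi_iff_surjective π).1 hπ (1 : k)
      refine ⟨w.hom a, ?_⟩
      have h1 := congrArg (fun g => ModuleCat.Hom.hom g a) hw
      simp only [ModuleCat.hom_comp, LinearMap.comp_apply, ModuleCat.hom_ofHom] at h1
      rw [← h1]
      erw [ha]
      simp
    · have h' : ∀ a : A, ∃ w : X.X i, (X.d i j).hom w = x.hom a :=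
        fun a => h _ (b.hom a) (congrArg (fun g => ModuleCat.Hom.hom g a) hx)
          (congrArg (fun g => ModuleCat.Hom.hom g a) hb)
      choose w hw using h'
      refine ⟨ModuleCat.of k (A →₀ k), ModuleCat.ofHom (Finsupp.linearCombination k id),
        (ModuleCat.epi_iff_surjective _).2 fun a => ⟨Finsupp.single a 1, by simp⟩,
        ModuleCat.ofHom (Finsupp.linearCombination k w), ?_⟩
      ext a
      simp [hw]
  rw [quasiIso_iff]
  constructor
  · intro h
    exact ⟨fun i j l hi hl => ((key i j l hi hl).1 (h j)).1,
      fun i j l hi hl => ((key i j l hi hl).1 (h j)).2⟩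
  · intro h j
    exact (key (j + 1) j (j - 1) rfl (by omega)).2
      ⟨h.1 _ _ _ rfl (by omega), h.2 _ _ _ rfl (by omega)⟩

/-- A surjective morphism is a quasi-isomorphism if and only if its kernel is acyclic. -/
lemma quasiIso_iff_of_surjective (p : X ⟶ Y) (hp : ∀ i, Function.Surjective (p.f i)) :
    QuasiIso p ↔ ∀ i j l, j + 1 = i → l + 1 = j → ∀ x : X.X j, (p.f j).hom x = 0 →
      (X.d j l).hom x = 0 → ∃ w : X.X i, (p.f i).hom w = 0 ∧ (X.d i j).hom w = x := by
  rw [quasiIso_iff_elementwise]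
  constructor
  · rintro ⟨h1, h2⟩ i j l hi hl x hpx hx
    obtain ⟨w, rfl⟩ := h2 i j l hi hl x 0 hx (by rw [hpx, map_zero])
    -- The image of `w` in `Y` is a cycle, hence homologous to the image of a cycle `z`. Subtracting
    -- `z` and the boundary of a lift of `b` moves `w` into the kernel.
    obtain ⟨z, b, hz, hb⟩ := h1 (i + 1) i j rfl hi ((p.f i).hom w) (by rw [hom_d, hpx])
    obtain ⟨b', rfl⟩ : ∃ b', (p.f (i + 1)).hom b' = b := hp _ b
    refine ⟨w - z - (X.d (i + 1) i).hom b', ?_, ?_⟩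
    · rw [map_sub, map_sub, hb, hom_d]
      abel
    · rw [map_sub, map_sub, hz, d_d, sub_zero, sub_zero]
  · intro h
    constructor
    · intro i j l hi hl y hy
      obtain ⟨x, rfl⟩ : ∃ x, (p.f j).hom x = y := hp _ y
      rw [hom_d] at hy
      obtain ⟨w, hw, hwx⟩ := h j l (l - 1) hl (by omega) _ hy (d_d _ _ _ _ _)
      refine ⟨x - w, 0, ?_, ?_⟩
      · rw [map_sub, hwx, sub_self]
      · rw [map_sub, hw, map_zero, sub_zero, add_zero]
    · intro i j l hi hl x b hx hb
      obtain ⟨b, rfl⟩ : ∃ b', (p.f i).hom b' = b := hp _ b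
      rw [hom_d] at hb
      obtain ⟨w, -, hw⟩ := h i j l hi hl (x - (X.d i j).hom b) (by rw [map_sub, hb, sub_self])
        (by rw [map_sub, hx, d_d, sub_zero])
      exact ⟨w + b, by rw [map_add, hw, sub_add_cancel]⟩

end

/-! ### Shifted mapping cones -/

section Cone

variable {X Y X' Y' : ChainComplex (ModuleCat.{u} k) ℤ}

/-- The differential of the shifted mapping cone. -/
noncomputable def twConeD (p : X ⟶ Y) (d i j : ℤ) (h : j + 1 = i) :
    (Y.X (d + i) × X.X (d + i - 1)) →ₗ[k] (Y.X (d + j) × X.X (d + j - 1)) :=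
  LinearMap.prod
    ((d.negOnePow : ℤ) • ((Y.d (d + i) (d + j)).hom ∘ₗ LinearMap.fst k _ _
      - fAt p (d + i - 1) (d + j) (by omega) ∘ₗ LinearMap.snd k _ _))
    (-((d.negOnePow : ℤ) • ((X.d (d + i - 1) (d + j - 1)).hom ∘ₗ LinearMap.snd k _ _)))

lemma twConeD_apply (p : X ⟶ Y) (d i j : ℤ) (h : j + 1 = i)
    (z : Y.X (d + i) × X.X (d + i - 1)) :
    twConeD p d i j h z =
      ((d.negOnePow : ℤ) • ((Y.d (d + i) (d + j)).hom z.1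
        - fAt p (d + i - 1) (d + j) (by omega) z.2),
      -((d.negOnePow : ℤ) • (X.d (d + i - 1) (d + j - 1)).hom z.2)) := rfl

lemma twConeD_comp (p : X ⟶ Y) (d i j l : ℤ) (h : j + 1 = i) (h' : l + 1 = j) :
    twConeD p d j l h' ∘ₗ twConeD p d i j h = 0 := by
  refine LinearMap.ext fun z => ?_
  rw [LinearMap.comp_apply, twConeD_apply, twConeD_apply]
  refine Prod.ext ?_ ?_
  · change _ = (0 : Y.X (d + l))
    dsimp only
    rw [map_zsmul, map_sub, d_d, d_fAt p (a' := d + j - 1) _ (by omega), map_neg, map_zsmul]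
    simp
  · change _ = (0 : X.X (d + l - 1))
    dsimp only
    rw [map_neg, map_zsmul, d_d]
    simp

/-- The mapping cone of `p : X ⟶ Y`, shifted by `d`: maps of degree `d` to it are the pairs of a map
of degree `d` to `Y` and a map of degree `d - 1` to `X`. -/
noncomputable def twCone (p : X ⟶ Y) (d : ℤ) : ChainComplex (ModuleCat.{u} k) ℤ where
  X q := ModuleCat.of k (Y.X (d + q) × X.X (d + q - 1))
  d i j := if h : j + 1 = i then ModuleCat.ofHom (twConeD p d i j h) else 0
  shape i j h := dif_neg h
  d_comp_d' i j l h h' := by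
    have h1 : j + 1 = i := h
    have h2 : l + 1 = j := h'
    rw [dif_pos h1, dif_pos h2, ← ModuleCat.ofHom_comp, twConeD_comp]
    rfl

lemma twCone_d (p : X ⟶ Y) (d i j : ℤ) (h : j + 1 = i) :
    (twCone p d).d i j = ModuleCat.ofHom (twConeD p d i j h) := dif_pos h

/-- The functoriality of the mapping cone. -/
noncomputable def twConeMap {p : X ⟶ Y} {p' : X' ⟶ Y'} (d : ℤ) (φ : X ⟶ X') (ψ : Y ⟶ Y')
    (h : p ≫ ψ = φ ≫ p') : twCone p d ⟶ twCone p' d where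
  f q := ModuleCat.ofHom (LinearMap.prodMap (ψ.f (d + q)).hom (φ.f (d + q - 1)).hom)
  comm' i j hij := by
    have h1 : j + 1 = i := hij
    rw [twCone_d p d i j h1, twCone_d p' d i j h1]
    refine ModuleCat.hom_ext (LinearMap.ext fun z => ?_)
    obtain ⟨y, x⟩ := z
    change twConeD p' d i j h1 ((ψ.f (d + i)).hom y, (φ.f (d + i - 1)).hom x) =
      ((ψ.f (d + j)).hom (twConeD p d i j h1 (y, x)).1,
        (φ.f (d + j - 1)).hom (twConeD p d i j h1 (y, x)).2)
    rw [twConeD_apply, twConeD_apply]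
    refine Prod.ext ?_ ?_
    · dsimp only
      rw [map_zsmul, map_sub, hom_d, fAt_f, f_fAt, h]
    · dsimp only
      rw [map_neg, map_zsmul, hom_d]

lemma twConeMap_apply {p : X ⟶ Y} {p' : X' ⟶ Y'} (d : ℤ) (φ : X ⟶ X') (ψ : Y ⟶ Y')
    (h : p ≫ ψ = φ ≫ p') (q : ℤ) (z : Y.X (d + q) × X.X (d + q - 1)) :
    ((twConeMap d φ ψ h).f q).hom z = ((ψ.f (d + q)).hom z.1, (φ.f (d + q - 1)).hom z.2) := rfl

lemma twConeMap_surjective {p : X ⟶ Y} (hp : ∀ i, Function.Surjective (p.f i)) (d i : ℤ) :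
    Function.Surjective ((twConeMap d (𝟙 X) p (p := 𝟙 X) (p' := p) rfl).f i) := by
  rintro ⟨y, x⟩
  obtain ⟨x', rfl⟩ := hp _ y
  exact ⟨(x', x), rfl⟩

/-- The kernel of this map is the shifted kernel of `p`, sitting in the first coordinate. -/
lemma quasiIso_twConeMap {p : X ⟶ Y} (hp : ∀ i, Function.Surjective (p.f i)) (hq : QuasiIso p)
    (d : ℤ) : QuasiIso (twConeMap d (𝟙 X) p (p := 𝟙 X) (p' := p) rfl) := by
  rw [quasiIso_iff_of_surjective _ (twConeMap_surjective hp d)]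
  rw [quasiIso_iff_of_surjective _ hp] at hq
  rintro i j l hi hl ⟨x', x⟩ h0 hd
  rw [twConeMap_apply] at h0
  obtain ⟨h1, rfl⟩ : (p.f (d + j)).hom x' = 0 ∧ x = 0 :=
    ⟨congrArg Prod.fst h0, congrArg Prod.snd h0⟩
  rw [twCone_d _ d j l hl] at hd
  replace hd : twConeD (𝟙 X) d j l hl (x', 0) = 0 := hd
  rw [twConeD_apply] at hd
  have h2 : (X.d (d + j) (d + l)).hom x' = 0 := by
    have := congrArg (fun z => (d.negOnePow : ℤ) • Prod.fst z) hd
    simpa [-zsmul_eq_mul, negOnePow_smul_smul] using this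
  obtain ⟨w, hw, rfl⟩ := hq (d + i) (d + j) (d + l) (by omega) (by omega) x' h1 h2
  refine ⟨((d.negOnePow : ℤ) • w, 0), ?_, ?_⟩
  · rw [twConeMap_apply]
    refine Prod.ext ?_ ?_
    · change (p.f (d + i)).hom ((d.negOnePow : ℤ) • w) = 0
      rw [map_zsmul, hw, smul_zero]
    · exact map_zero _
  · rw [twCone_d _ d i j hi]
    refine (twConeD_apply _ _ _ _ hi _).trans (Prod.ext ?_ ?_)
    · change (d.negOnePow : ℤ) • ((X.d (d + i) (d + j)).hom ((d.negOnePow : ℤ) • w)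
        - fAt _ _ _ _ 0) = _
      rw [map_zsmul, map_zero, sub_zero, negOnePow_smul_smul]
    · change -((d.negOnePow : ℤ) • (X.d _ _).hom 0) = 0
      rw [map_zero, smul_zero, neg_zero]

/-- The mapping cone of a quasi-isomorphism is acyclic. -/
lemma twCone_acyclic {p : X ⟶ Y} (hp : QuasiIso p) (d i j l : ℤ) (hi : j + 1 = i)
    (hl : l + 1 = j) (z : (twCone p d).X j) (hz : ((twCone p d).d j l).hom z = 0) :
    ∃ w : (twCone p d).X i, ((twCone p d).d i j).hom w = z := by
  rw [quasiIso_iff_elementwise] at hp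
  have hp1 : ∀ a i' j' l', j' + 1 = i' → l' + 1 = j' → ∀ h : a = j',
      ∀ y : Y.X j', (Y.d j' l').hom y = 0 →
        ∃ (x : X.X a) (b : Y.X i'), (∀ a', (X.d a a').hom x = 0) ∧
          y = fAt p a j' h x + (Y.d i' j').hom b := by
    rintro a i' j' l' hi hl rfl y hy
    obtain ⟨x, b, hx, hb⟩ := hp.1 i' a l' hi hl y hy
    refine ⟨x, b, fun a' => ?_, by rw [fAt_rfl]; exact hb⟩
    by_cases h : a' + 1 = a
    · obtain rfl : a' = l' := by omega
      exact hx
    · rw [X.shape _ _ h]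
      rfl
  have hp2 : ∀ a i' j' l' i'', j' + 1 = i' → l' + 1 = j' → a = i' → ∀ h : j' = i'',
      ∀ (x : X.X j') (b : Y.X (i'' + 1)), (X.d j' l').hom x = 0 →
        fAt p j' i'' h x = (Y.d (i'' + 1) i'').hom b → ∃ w : X.X a, (X.d a j').hom w = x := by
    rintro a i' j' l' i'' hi hl rfl rfl x b hx hb
    subst hi
    rw [fAt_rfl] at hb
    exact hp.2 _ _ _ rfl hl x b hx hb
  subst hl hi
  obtain ⟨y, x⟩ := z
  rw [twCone_d _ d _ _ rfl] at hz
  replace hz : twConeD p d (l + 1) l rfl (y, x) = 0 := hz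
  rw [twConeD_apply] at hz
  have hy : (Y.d (d + (l + 1)) (d + l)).hom y
      = fAt p (d + (l + 1) - 1) (d + l) (by omega) x := by
    have := congrArg (fun z => (d.negOnePow : ℤ) • Prod.fst z) hz
    simpa [-zsmul_eq_mul, negOnePow_smul_smul, sub_eq_zero] using this
  have hx : (X.d (d + (l + 1) - 1) (d + l - 1)).hom x = 0 := by
    have := congrArg (fun z => (d.negOnePow : ℤ) • Prod.snd z) hz
    simpa [-zsmul_eq_mul, negOnePow_smul_smul, sub_eq_zero] using this
  -- A cycle of the cone is a pair with `x` a cycle whose image bounds `y`. Injectivity in homology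
  -- gives `w` bounded by `x`; then `y` minus the image of `w` is a cycle, corrected by surjectivity
  -- in homology.
  obtain ⟨w, hw⟩ : ∃ w : X.X (d + (l + 1 + 1) - 1),
      (X.d (d + (l + 1 + 1) - 1) (d + (l + 1) - 1)).hom w = x := by
    refine hp2 _ _ _ _ (d + l) rfl (by omega) (by omega) (by omega) x
      (fAt (𝟙 Y) (d + (l + 1)) _ (by omega) y) hx ?_
    rw [d_fAt (𝟙 Y) (b' := d + l) _ rfl, hy, fAt_rfl]
    rfl
  obtain ⟨v, b, hv, hb⟩ := hp1 (d + (l + 1 + 1) - 1) (d + (l + 1 + 1)) (d + (l + 1)) (d + l)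
    (by omega) (by omega) (by omega)
    (y - fAt p (d + (l + 1 + 1) - 1) (d + (l + 1)) (by omega) w)
    (by rw [map_sub, d_fAt p (a' := d + (l + 1) - 1) _ (by omega), hw, hy, sub_self])
  refine ⟨((d.negOnePow : ℤ) • b, -((d.negOnePow : ℤ) • (w + v))), ?_⟩
  rw [twCone_d _ d _ _ rfl]
  change twConeD p d (l + 1 + 1) (l + 1) rfl
    ((d.negOnePow : ℤ) • b, -((d.negOnePow : ℤ) • (w + v))) = (y, x)
  rw [twConeD_apply]
  refine Prod.ext ?_ ?_
  · dsimp only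
    rw [map_zsmul, map_neg, map_zsmul, sub_neg_eq_add, ← smul_add, negOnePow_smul_smul, map_add]
    rw [sub_eq_iff_eq_add] at hb
    rw [hb]
    abel
  · dsimp only
    rw [map_neg, map_zsmul, smul_neg, neg_neg, negOnePow_smul_smul, map_add, hw, hv, add_zero]

end Cone

end DGModules

/-! ### Twisted lifting -/

section TwistedLifting

variable {k : Type u} [CommRing k]

section Functors

variable {J : Type*} [Category J] {F G : J ⥤ ChainComplex (ModuleCat.{u} k) ℤ}

/-- The objectwise shifted mapping cone. -/
noncomputable def twConeFunctor (p : F ⟶ G) (d : ℤ) : J ⥤ ChainComplex (ModuleCat.{u} k) ℤ where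
  obj τ := twCone (p.app τ) d
  map u := twConeMap d (F.map u) (G.map u) (p.naturality u).symm
  map_id τ := by
    refine HomologicalComplex.hom_ext _ _ fun q => ModuleCat.hom_ext (LinearMap.ext fun z => ?_)
    obtain ⟨y, x⟩ := z
    refine (twConeMap_apply _ _ _ _ _ _).trans ?_
    rw [F.map_id, G.map_id]
    rfl
  map_comp u v := by
    refine HomologicalComplex.hom_ext _ _ fun q => ModuleCat.hom_ext (LinearMap.ext fun z => ?_)
    obtain ⟨y, x⟩ := z
    refine (twConeMap_apply _ _ _ _ _ _).trans ?_
    rw [F.map_comp, G.map_comp]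
    rfl

/-- The canonical morphism from the cone of the identity of `F` to the cone of `p : F ⟶ G`. -/
noncomputable def twConeFunctorMap (p : F ⟶ G) (d : ℤ) :
    twConeFunctor (𝟙 F) d ⟶ twConeFunctor p d where
  app τ := twConeMap d (𝟙 _) (p.app τ) (p := 𝟙 (F.obj τ)) rfl
  naturality τ σ u := by
    refine HomologicalComplex.hom_ext _ _ fun q => ModuleCat.hom_ext (LinearMap.ext fun z => ?_)
    obtain ⟨y, x⟩ := z
    refine Prod.ext ?_ rfl
    exact congrArg (fun f => ModuleCat.Hom.hom (HomologicalComplex.Hom.f f (d + q)) y)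
      (p.naturality u)

/-- Twisted lifting: if `C` has the left lifting property with respect to the acyclic fibration
`p : F ⟶ G`, then a map `g : C → G` of degree `d` whose differential lifts to a cycle `A` of degree
`d - 1` lifts to a map `l : C → F` with differential `A`. -/
lemma exists_twisted_lift {C : J ⥤ ChainComplex (ModuleCat.{u} k) ℤ}
    (hC : ∀ ⦃X Y : J ⥤ ChainComplex (ModuleCat.{u} k) ℤ⦄ (p : X ⟶ Y),
      (∀ τ i, Function.Surjective ((p.app τ).f i)) → (∀ τ, QuasiIso (p.app τ)) →
        ∀ g : C ⟶ Y, ∃ l : C ⟶ X, l ≫ p = g)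
    (p : F ⟶ G) (hp : ∀ τ i, Function.Surjective ((p.app τ).f i)) (hq : ∀ τ, QuasiIso (p.app τ))
    (d : ℤ) (g : ∀ τ a b, d + a = b → ((C.obj τ).X a →ₗ[k] (G.obj τ).X b))
    (A : ∀ τ a b, d + a = b + 1 → ((C.obj τ).X a →ₗ[k] (F.obj τ).X b))
    (hg : ∀ τ σ (u : τ ⟶ σ) a b h x,
      ((G.map u).f b).hom (g τ a b h x) = g σ a b h (((C.map u).f a).hom x))
    (hA : ∀ τ σ (u : τ ⟶ σ) a b h x,
      ((F.map u).f b).hom (A τ a b h x) = A σ a b h (((C.map u).f a).hom x))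
    (h1 : ∀ τ i j b b' (_ : j + 1 = i) (h : d + i = b) (h' : d + j = b') (h'' : d + i = b' + 1) x,
      ((p.app τ).f b').hom (A τ i b' h'' x) =
        ((G.obj τ).d b b').hom (g τ i b h x) -
          (d.negOnePow : ℤ) • g τ j b' h' (((C.obj τ).d i j).hom x))
    (h2 : ∀ τ i j b b' (_ : j + 1 = i) (h : d + i = b + 1) (h' : d + j = b' + 1) x,
      ((F.obj τ).d b b').hom (A τ i b h x) +
        (d.negOnePow : ℤ) • A τ j b' h' (((C.obj τ).d i j).hom x) = 0) :
    ∃ l : ∀ τ a b, d + a = b → ((C.obj τ).X a →ₗ[k] (F.obj τ).X b),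
      (∀ τ σ (u : τ ⟶ σ) a b h x,
        ((F.map u).f b).hom (l τ a b h x) = l σ a b h (((C.map u).f a).hom x)) ∧
      (∀ τ a b h x, ((p.app τ).f b).hom (l τ a b h x) = g τ a b h x) ∧
      ∀ τ i j b b' (_ : j + 1 = i) (h : d + i = b) (h' : d + j = b') (h'' : d + i = b' + 1) x,
        ((F.obj τ).d b b').hom (l τ i b h x) -
          (d.negOnePow : ℤ) • l τ j b' h' (((C.obj τ).d i j).hom x) = A τ i b' h'' x := by
  have hcast : ∀ τ i b b' h h' (e : b = b') x,
      fAt (p.app τ) b b' e (A τ i b h x) = ((p.app τ).f b').hom (A τ i b' h' x) := by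
    rintro τ i b _ h h' rfl x
    rw [fAt_rfl]
  have hcast' : ∀ τ i b b' h h' (e : b = b') x,
      fAt (𝟙 (F.obj τ)) b b' e (A τ i b h x) = A τ i b' h' x := by
    rintro τ i b _ h h' rfl x
    rw [fAt_rfl]
    rfl
  -- `h1` and `h2` say precisely that the pair of `g` and `A` is a chain map to the cone of `p`. A
  -- lift to the cone of the identity has second component `A`, and its first component is the
  -- required `l`.
  let γ : C ⟶ twConeFunctor p d :=
    { app := fun τ =>
        { f := fun q => ModuleCat.ofHom
            (LinearMap.prod (g τ q (d + q) rfl) (A τ q (d + q - 1) (by omega)))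
          comm' := fun i j hij => by
            have hij' : j + 1 = i := hij
            refine ModuleCat.hom_ext (LinearMap.ext fun x => ?_)
            change ((twCone (p.app τ) d).d i j).hom
              (g τ i (d + i) rfl x, A τ i (d + i - 1) (by omega) x) =
              (g τ j (d + j) rfl (((C.obj τ).d i j).hom x),
                A τ j (d + j - 1) (by omega) (((C.obj τ).d i j).hom x))
            rw [twCone_d _ d i j hij']
            refine (twConeD_apply _ _ _ _ hij' _).trans (Prod.ext ?_ ?_)
            · dsimp only
              rw [hcast τ i _ _ _ (by omega), h1 τ i j (d + i) (d + j) hij' rfl rfl,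
                sub_sub_cancel, negOnePow_smul_smul]
            · dsimp only
              rw [eq_neg_of_add_eq_zero_left (h2 τ i j _ (d + j - 1) hij' _ (by omega) x),
                smul_neg, neg_neg, negOnePow_smul_smul] }
      naturality := fun τ σ u => by
        refine HomologicalComplex.hom_ext _ _ fun q =>
          ModuleCat.hom_ext (LinearMap.ext fun x => ?_)
        exact Prod.ext (hg τ σ u _ _ _ x).symm (hA τ σ u _ _ _ x).symm }
  obtain ⟨L, hL⟩ := hC (twConeFunctorMap p d) (fun τ i => twConeMap_surjective (hp τ) d i)
    (fun τ => quasiIso_twConeMap (hp τ) (hq τ) d) γ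
  let L1 : ∀ τ a, (C.obj τ).X a →ₗ[k] (F.obj τ).X (d + a) := fun τ a =>
    LinearMap.fst k _ _ ∘ₗ (show (C.obj τ).X a →ₗ[k]
      ((F.obj τ).X (d + a) × (F.obj τ).X (d + a - 1)) from ((L.app τ).f a).hom)
  have hLτ : ∀ τ a x, ((twConeFunctorMap p d).app τ).f a (((L.app τ).f a).hom x) =
      ((γ.app τ).f a).hom x := fun τ a x =>
    congrArg (fun z : C ⟶ twConeFunctor p d => ((z.app τ).f a).hom x) hL
  have hL1 : ∀ τ a x, ((L.app τ).f a).hom x = (L1 τ a x, A τ a (d + a - 1) (by omega) x) :=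
    fun τ a x => by
      have h3 := congrArg Prod.snd (hLτ τ a x)
      exact Prod.ext rfl h3
  refine ⟨fun τ a b h => fAt (𝟙 (F.obj τ)) (d + a) b h ∘ₗ L1 τ a, ?_, ?_, ?_⟩
  · rintro τ σ u a _ rfl x
    simp only [LinearMap.comp_apply, fAt_rfl]
    have := congrArg (fun z => ModuleCat.Hom.hom (HomologicalComplex.Hom.f z a) x) (L.naturality u)
    exact (congrArg Prod.fst this).symm
  · rintro τ a _ rfl x
    simp only [LinearMap.comp_apply, fAt_rfl]
    exact congrArg Prod.fst (hLτ τ a x)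
  · rintro τ i j _ _ hij rfl rfl h x
    simp only [LinearMap.comp_apply, fAt_rfl]
    have h3 := congrArg (fun z => ModuleCat.Hom.hom z x) ((L.app τ).comm i j)
    replace h3 : ((twCone (𝟙 (F.obj τ)) d).d i j).hom (((L.app τ).f i).hom x) =
      ((L.app τ).f j).hom (((C.obj τ).d i j).hom x) := h3
    rw [hL1, hL1, twCone_d _ d i j hij] at h3
    replace h3 := congrArg Prod.fst ((twConeD_apply _ _ _ _ hij _).symm.trans h3)
    dsimp only at h3
    rw [hcast' τ i _ _ _ h] at h3
    change ((F.obj τ).d _ _).hom (L1 τ i x) - _ • L1 τ j _ = _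
    rw [← h3, negOnePow_smul_smul, sub_sub_cancel]

end Functors

/-- Twisted lifting for a cofibrant dg-module. -/
lemma IsCofibrantDGModule.exists_twisted_lift {C X Y : ChainComplex (ModuleCat.{u} k) ℤ}
    (hC : IsCofibrantDGModule C) (p : X ⟶ Y) (hp : ∀ i, Function.Surjective (p.f i))
    (hq : QuasiIso p) (d : ℤ) (g : ∀ a b, d + a = b → (C.X a →ₗ[k] Y.X b))
    (A : ∀ a b, d + a = b + 1 → (C.X a →ₗ[k] X.X b))
    (h1 : ∀ i j b b' (_ : j + 1 = i) (h : d + i = b) (h' : d + j = b') (h'' : d + i = b' + 1) x,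
      (p.f b').hom (A i b' h'' x) =
        (Y.d b b').hom (g i b h x) - (d.negOnePow : ℤ) • g j b' h' ((C.d i j).hom x))
    (h2 : ∀ i j b b' (_ : j + 1 = i) (h : d + i = b + 1) (h' : d + j = b' + 1) x,
      (X.d b b').hom (A i b h x) + (d.negOnePow : ℤ) • A j b' h' ((C.d i j).hom x) = 0) :
    ∃ l : ∀ a b, d + a = b → (C.X a →ₗ[k] X.X b),
      (∀ a b h x, (p.f b).hom (l a b h x) = g a b h x) ∧
      ∀ i j b b' (_ : j + 1 = i) (h : d + i = b) (h' : d + j = b') (h'' : d + i = b' + 1) x,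
        (X.d b b').hom (l i b h x) - (d.negOnePow : ℤ) • l j b' h' ((C.d i j).hom x)
          = A i b' h'' x := by
  -- A dg-module is a diagram on the category with one object and one morphism.
  let K := Functor.const (Discrete PUnit.{1}) (C := ChainComplex (ModuleCat.{u} k) ℤ)
  obtain ⟨l, -, hl, hl'⟩ := _root_.exists_twisted_lift (C := K.obj C) (F := K.obj X)
    (G := K.obj Y) (fun X' Y' p' hp' hq' g' => by
      obtain ⟨l, hl⟩ := hC (p'.app ⟨⟨⟩⟩) (hp' ⟨⟨⟩⟩) (hq' ⟨⟨⟩⟩) (g'.app ⟨⟨⟩⟩)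
      refine ⟨{ app := fun _ => l, naturality := ?_ }, ?_⟩
      · rintro ⟨⟨⟩⟩ ⟨⟨⟩⟩ f
        obtain rfl : f = 𝟙 _ := Subsingleton.elim _ _
        rw [CategoryTheory.Functor.map_id, CategoryTheory.Functor.map_id]
        exact (Category.id_comp l).trans (Category.comp_id l).symm
      · ext ⟨⟨⟩⟩ : 2
        exact hl)
    (K.map p) (fun _ => hp) (fun _ => hq) d (fun _ => g) (fun _ => A)
    (fun _ _ _ _ _ _ _ => rfl) (fun _ _ _ _ _ _ _ => rfl) (fun _ => h1) (fun _ => h2)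
  exact ⟨l ⟨⟨⟩⟩, hl ⟨⟨⟩⟩, hl' ⟨⟨⟩⟩⟩

end TwistedLifting

/-! ### Homotopies between morphisms of diagrams -/

section DiagramHomotopy

variable {k : Type u} [CommRing k] {n : ℕ}

/-- A null-homotopic morphism of diagrams. -/
def IsNullHomotopic {C X : DGDiagram k n} (e : C ⟶ X) : Prop :=
  ∃ l : ∀ τ a b, 1 + a = b → ((C.obj τ).X a →ₗ[k] (X.obj τ).X b),
    (∀ τ σ (u : τ ⟶ σ) a b h x,
      ((X.map u).f b).hom (l τ a b h x) = l σ a b h (((C.map u).f a).hom x)) ∧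
    ∀ τ i j b (_ : j + 1 = i) (h : 1 + i = b) (h' : 1 + j = i) x,
      ((X.obj τ).d b i).hom (l τ i b h x) + l τ j i h' (((C.obj τ).d i j).hom x) =
        ((e.app τ).f i).hom x

/-- Two lifts along an acyclic fibration are homotopic. -/
lemma IsCofibrantDiagram.isNullHomotopic {C X Y : DGDiagram k n} (hC : IsCofibrantDiagram C)
    {p : X ⟶ Y} (hp : IsProjectiveFibration p) (hq : IsWeakEquiv p) {e : C ⟶ X} (he : e ≫ p = 0) :
    IsNullHomotopic e := by
  obtain ⟨l, hl, -, hl'⟩ := exists_twisted_lift (C := C) hC p hp hq 1 (fun _ _ _ _ => 0)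
    (fun τ a b h => fAt (e.app τ) a b (by omega)) (by simp)
    (by
      rintro τ σ u a b h x
      obtain rfl : a = b := by omega
      rw [fAt_rfl, fAt_rfl]
      exact congrArg (fun z : C.obj τ ⟶ X.obj σ => (z.f a).hom x) (e.naturality u).symm)
    (by
      rintro τ i j b b' hij h h' h'' x
      obtain rfl : i = b' := by omega
      rw [fAt_rfl]
      have h3 : ((p.app τ).f i).hom (((e.app τ).f i).hom x) = 0 :=
        congrArg (fun z : C ⟶ Y => ((z.app τ).f i).hom x) he
      rw [h3]
      simp)
    (by
      rintro τ i j b b' hij h h' x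
      rw [d_fAt _ (a' := j) (b' := b') _ (by omega)]
      simp)
  refine ⟨l, hl, ?_⟩
  intro τ i j b hij h h' x
  have h3 := hl' τ i j b i hij h h' (by omega) x
  rw [fAt_rfl] at h3
  rw [← h3]
  simp

open scoped ZeroObject in
/-- A morphism to the target of a weak equivalence factors through it up to homotopy. -/
lemma IsCofibrantDiagram.exists_isNullHomotopic {C X Y : DGDiagram k n}
    (hC : IsCofibrantDiagram C) {f : X ⟶ Y} (hf : IsWeakEquiv f) (g : C ⟶ Y) :
    ∃ g' : C ⟶ X, IsNullHomotopic (g' ≫ f - g) := by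
  let Z : DGDiagram k n := (Functor.const _).obj 0
  have hZ : ∀ τ i, Subsingleton ((Z.obj τ).X i) := fun τ i =>
    ModuleCat.subsingleton_of_isZero
      ((HomologicalComplex.eval (ModuleCat.{u} k) (ComplexShape.down ℤ) i).map_isZero
        (Limits.isZero_zero _))
  let p : twConeFunctor f 1 ⟶ Z := 0
  have hp : ∀ τ i, Function.Surjective ((p.app τ).f i) := fun τ i y =>
    ⟨0, (hZ τ i).elim _ _⟩
  -- The cone of `f` is acyclic, so its map to zero is an acyclic fibration. The pair of `g` and `0`
  -- is a cycle of degree minus one in the maps to this cone; a map of degree zero with this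
  -- differential consists of a homotopy and of the desired `g'`.
  let A : ∀ τ a b, 0 + a = b + 1 → ((C.obj τ).X a →ₗ[k] ((twConeFunctor f 1).obj τ).X b) :=
    fun τ a b h => LinearMap.prod (fAt (g.app τ) a (1 + b) (by omega)) 0
  have hA1 : ∀ τ a b h x, A τ a b h x = (fAt (g.app τ) a (1 + b) (by omega) x, 0) :=
    fun _ _ _ _ _ => rfl
  have hd : ∀ τ i j (hij : j + 1 = i) z, (((twConeFunctor f 1).obj τ).d i j).hom z =
      (fAt (f.app τ) (1 + i - 1) (1 + j) (by omega) z.2 - ((Y.obj τ).d (1 + i) (1 + j)).hom z.1,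
        ((X.obj τ).d (1 + i - 1) (1 + j - 1)).hom z.2) := by
    intro τ i j hij z
    change ((twCone (f.app τ) 1).d i j).hom z = _
    rw [twCone_d _ 1 i j hij]
    refine (twConeD_apply _ _ _ _ hij _).trans ?_
    simp
  obtain ⟨l, hl, -, hl'⟩ := exists_twisted_lift (C := C) hC p hp
    (fun τ => (quasiIso_iff_of_surjective _ (hp τ)).2 fun i j m hi hm x _ hx => by
      obtain ⟨w, hw⟩ := twCone_acyclic (hf τ) 1 i j m hi hm x hx
      exact ⟨w, (hZ τ i).elim _ _, hw⟩) 0 (fun _ _ _ _ => 0) A (by simp)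
    (by
      rintro τ σ u a b h x
      refine Prod.ext ?_ (map_zero ((X.map u).f (1 + b - 1)).hom)
      change ((Y.map u).f (1 + b)).hom (fAt (g.app τ) a (1 + b) (by omega) x) =
        fAt (g.app σ) a (1 + b) (by omega) (((C.map u).f a).hom x)
      rw [f_fAt, fAt_f, g.naturality])
    (fun τ _ _ _ b' _ _ _ _ _ => (hZ τ b').elim _ _)
    (by
      rintro τ i j b b' hij h h' x
      rw [hd τ b b' (by omega), hA1 τ i b h, hA1 τ j b' h']
      dsimp only
      rw [d_fAt _ (a' := j) (h' := (by omega : j = 1 + b')), map_zero, map_zero]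
      refine Prod.ext ?_ ?_
      · change 0 - _ + ((0 : ℤ).negOnePow : ℤ) • _ = (0 : (Y.obj τ).X (1 + b'))
        simp
      · change 0 + ((0 : ℤ).negOnePow : ℤ) • 0 = (0 : (X.obj τ).X (1 + b' - 1))
        simp)
  let L : ∀ τ a, (C.obj τ).X a →ₗ[k] ((Y.obj τ).X (1 + a) × (X.obj τ).X (1 + a - 1)) :=
    fun τ a => l τ a a (zero_add a)
  have hL : ∀ τ σ (u : τ ⟶ σ) a x, (((Y.map u).f (1 + a)).hom (L τ a x).1,
      ((X.map u).f (1 + a - 1)).hom (L τ a x).2) = L σ a (((C.map u).f a).hom x) :=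
    fun τ σ u a x => hl τ σ u a a (zero_add a) x
  have hL' : ∀ τ j x,
      fAt (f.app τ) (1 + (1 + j) - 1) (1 + j) (by omega) (L τ (1 + j) x).2 -
          ((Y.obj τ).d (1 + (1 + j)) (1 + j)).hom (L τ (1 + j) x).1 -
          (L τ j (((C.obj τ).d (1 + j) j).hom x)).1 = ((g.app τ).f (1 + j)).hom x ∧
      ((X.obj τ).d (1 + (1 + j) - 1) (1 + j - 1)).hom (L τ (1 + j) x).2 =
        (L τ j (((C.obj τ).d (1 + j) j).hom x)).2 := by
    intro τ j x
    have h3 := hl' τ (1 + j) j (1 + j) j (by omega) (zero_add _) (zero_add j) (by omega) x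
    rw [hd τ (1 + j) j (by omega), hA1 τ (1 + j) j (by omega), fAt_rfl, Int.negOnePow_zero,
      Units.val_one, one_smul] at h3
    exact ⟨congrArg Prod.fst h3, sub_eq_zero.1 (congrArg Prod.snd h3)⟩
  let g' : C ⟶ X :=
    { app := fun τ =>
        { f := fun a => ModuleCat.ofHom
            (fAt (𝟙 (X.obj τ)) (1 + a - 1) a (by omega) ∘ₗ LinearMap.snd k _ _ ∘ₗ L τ a)
          comm' := fun i j hij => by
            have hij' : j + 1 = i := hij
            obtain rfl : i = 1 + j := by omega
            refine ModuleCat.hom_ext (LinearMap.ext fun x => ?_)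
            change ((X.obj τ).d (1 + j) j).hom (fAt (𝟙 (X.obj τ)) (1 + (1 + j) - 1) (1 + j) (by omega)
              (L τ (1 + j) x).2) = fAt (𝟙 (X.obj τ)) (1 + j - 1) j (by omega)
                (L τ j (((C.obj τ).d (1 + j) j).hom x)).2
            rw [d_fAt _ (a' := 1 + j - 1) (h' := (by omega : 1 + j - 1 = j)), (hL' τ j x).2] }
      naturality := fun τ σ u => by
        refine HomologicalComplex.hom_ext _ _ fun a =>
          ModuleCat.hom_ext (LinearMap.ext fun x => ?_)
        change fAt (𝟙 (X.obj σ)) (1 + a - 1) a (by omega) (L σ a (((C.map u).f a).hom x)).2 =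
          ((X.map u).f a).hom (fAt (𝟙 (X.obj τ)) (1 + a - 1) a (by omega) (L τ a x).2)
        rw [← hL, fAt_f, f_fAt, Category.id_comp, Category.comp_id] }
  have hg' : ∀ τ a x, ((g'.app τ).f a).hom x =
      fAt (𝟙 (X.obj τ)) (1 + a - 1) a (by omega) (L τ a x).2 := fun _ _ _ => rfl
  refine ⟨g', fun τ a b h => fAt (𝟙 (Y.obj τ)) (1 + a) b h ∘ₗ LinearMap.fst k _ _ ∘ₗ L τ a,
    ?_, ?_⟩
  · rintro τ σ u a b h x
    change ((Y.map u).f b).hom (fAt (𝟙 (Y.obj τ)) (1 + a) b h (L τ a x).1) =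
      fAt (𝟙 (Y.obj σ)) (1 + a) b h (L σ a (((C.map u).f a).hom x)).1
    rw [← hL, fAt_f, f_fAt, Category.id_comp, Category.comp_id]
  · rintro τ i j _ hij rfl rfl x
    change ((Y.obj τ).d _ _).hom (fAt (𝟙 (Y.obj τ)) _ _ rfl (L τ (1 + j) x).1) +
        fAt (𝟙 (Y.obj τ)) _ _ rfl (L τ j (((C.obj τ).d (1 + j) j).hom x)).1 =
      ((f.app τ).f (1 + j)).hom (((g'.app τ).f (1 + j)).hom x) - ((g.app τ).f (1 + j)).hom x
    rw [hg', f_fAt, Category.id_comp, fAt_rfl, fAt_rfl, ← (hL' τ j x).1]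
    change ((Y.obj τ).d _ _).hom (L τ (1 + j) x).1 +
      (L τ j (((C.obj τ).d (1 + j) j).hom x)).1 = _
    abel

/-- Null-homotopic morphisms induce zero in the homology of the dg-hom. -/
lemma IsNullHomotopic.homologyMap_eq {C X : DGDiagram k n} {c c' : C ⟶ X}
    (h : IsNullHomotopic (c - c')) (T : DGDiagram k n) (m : ℤ) :
    HomologicalComplex.homologyMap (homComplexMap c T) m =
      HomologicalComplex.homologyMap (homComplexMap c' T) m := by
  obtain ⟨l, hl, hl'⟩ := h
  -- Precomposition with the homotopy, with the sign which cancels the terms containing the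
  -- differential of `T`.
  let K : ∀ d d', d + 1 = d' → (dgHom X T d →ₗ[k] dgHom C T d') := fun d d' h =>
    { toFun := fun f => ⟨fun τ P => (d.negOnePow : ℤ) •
          (f.1 τ ⟨1 + P.p, P.q, by have := P.eq; omega⟩ ∘ₗ l τ P.p (1 + P.p) rfl), by
        intro τ σ u P
        have h1 := f.2 τ σ u ⟨1 + P.p, P.q, by have := P.eq; omega⟩
        have h2 : ((X.map u).f (1 + P.p)).hom ∘ₗ l τ P.p (1 + P.p) rfl =
          l σ P.p (1 + P.p) rfl ∘ₗ ((C.map u).f P.p).hom := LinearMap.ext (hl τ σ u _ _ rfl)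
        dsimp only at h1
        rw [LinearMap.comp_smul, LinearMap.smul_comp, ← LinearMap.comp_assoc, h1,
          LinearMap.comp_assoc, h2, LinearMap.comp_assoc]⟩
      map_add' := fun f g => by
        ext τ P x
        simp
      map_smul' := fun c f => by
        ext τ P x
        simp [smul_comm c] }
  have key : ∀ d τ (f : ∀ P : DegPair d, (X.obj τ).X P.p →ₗ[k] (T.obj τ).X P.q) p q p' a b (_ : p' + 1 = p) (ha : 1 + p' = a) (hb : b = p) h1 h2 h3 x,
      f ⟨a, q, h1⟩ (l τ p' a ha (((C.obj τ).d p p').hom x)) +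
        f ⟨b, q, h2⟩ (((X.obj τ).d (1 + p) b).hom (l τ p (1 + p) rfl x)) =
        f ⟨p, q, h3⟩ (((c.app τ).f p).hom x) - f ⟨p, q, h3⟩ (((c'.app τ).f p).hom x) := by
    rintro d τ f p q p' a b hp ha rfl h1 h2 h3 x
    obtain rfl : a = b := by omega
    rw [← map_add, ← map_sub, add_comm, hl' τ a p' (1 + a) hp rfl ha x]
    rfl
  let K' : ∀ i j, (homComplex X T).X i ⟶ (homComplex C T).X j := fun i j =>
    if h : i + 1 = j then ModuleCat.ofHom (K i j h) else 0
  have hK' : ∀ i j (h : i + 1 = j), K' i j = ModuleCat.ofHom (K i j h) := fun i j h => dif_pos h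
  refine Homotopy.homologyMap_eq (f := homComplexMap c T) (g := homComplexMap c' T)
    { hom := K'
      zero := fun i j h => dif_neg h
      comm := fun i => ?_ } m
  rw [dNext_eq (i := i) (i' := i - 1) _ (show i - 1 + 1 = i by omega),
    prevD_eq (j := i) (j' := i + 1) _ (show i + 1 = i + 1 from rfl),
    hK' (i - 1) i (by omega), hK' i (i + 1) rfl]
  simp only [homComplex, dif_pos (show i - 1 + 1 = i by omega)]
  refine ModuleCat.hom_ext (LinearMap.ext fun f => Subtype.ext (funext fun τ => funext fun P =>
    LinearMap.ext fun x => ?_))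
  obtain ⟨p, q, hpq⟩ := P
  have h3 := key i τ (f.1 τ) p q (p - 1) (1 + (p - 1)) (1 + p - 1) (by omega) rfl (by omega)
    (by omega) (by omega) hpq x
  change f.1 τ ⟨p, q, hpq⟩ (((c.app τ).f p).hom x) =
    ((i - 1).negOnePow : ℤ) • (((T.obj τ).d (q + 1) q).hom (f.1 τ ⟨1 + p, q + 1, by omega⟩
      (l τ p (1 + p) rfl x)) - (i.negOnePow : ℤ) • f.1 τ ⟨1 + p - 1, q, by omega⟩
        (((X.obj τ).d (1 + p) (1 + p - 1)).hom (l τ p (1 + p) rfl x))) +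
    (((T.obj τ).d (q + 1) q).hom ((i.negOnePow : ℤ) • f.1 τ ⟨1 + p, q + 1, by omega⟩
      (l τ p (1 + p) rfl x)) - ((i + 1).negOnePow : ℤ) • (i.negOnePow : ℤ) •
        f.1 τ ⟨1 + (p - 1), q, by omega⟩ (l τ (p - 1) (1 + (p - 1)) rfl
          (((C.obj τ).d p (p - 1)).hom x))) +
    f.1 τ ⟨p, q, hpq⟩ (((c'.app τ).f p).hom x)
  rw [← sub_eq_iff_eq_add, ← h3, Int.negOnePow_sub, Int.negOnePow_succ, Int.negOnePow_one,
    map_zsmul, smul_sub]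
  simp only [mul_neg, mul_one, Units.val_neg, neg_smul, sub_neg_eq_add, negOnePow_smul_smul]
  abel

lemma homComplexMap_id (C T : DGDiagram k n) : homComplexMap (𝟙 C) T = 𝟙 _ := rfl

lemma homComplexMap_comp {C C' C'' : DGDiagram k n} (a : C ⟶ C') (b : C' ⟶ C'')
    (T : DGDiagram k n) : homComplexMap (a ≫ b) T = homComplexMap b T ≫ homComplexMap a T := rfl

/-- A homotopy inverse on one side of a weak equivalence is a weak equivalence. -/
lemma IsNullHomotopic.isWeakEquiv {C X : DGDiagram k n} {c : C ⟶ X} {c' : X ⟶ C}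
    (h : IsNullHomotopic (c' ≫ c - 𝟙 X)) (hc : IsWeakEquiv c) : IsWeakEquiv c' := by
  obtain ⟨l, -, hl⟩ := h
  intro τ
  have := hc τ
  have hl' : ∀ i j b (_ : j + 1 = i) (h : 1 + i = b) (h' : 1 + j = i) x,
      (((c' ≫ c).app τ).f i).hom x = ((X.obj τ).d b i).hom (l τ i b h x) +
        l τ j i h' (((X.obj τ).d i j).hom x) + x := fun i j b hij h h' x =>
    sub_eq_iff_eq_add.1 (hl τ i j b hij h h' x).symm
  have : QuasiIso ((c' ≫ c).app τ) := by
    rw [quasiIso_iff_elementwise]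
    constructor
    · rintro i j m hi hm y hy
      refine ⟨y, -l τ j i (by omega) y, hy, ?_⟩
      rw [hl' j m i hm (by omega) (by omega), hy, map_neg, map_zero]
      abel
    · rintro i j m hi hm x b hx hb
      refine ⟨b - l τ j i (by omega) x, ?_⟩
      rw [map_sub, ← hb, hl' j m i hm (by omega) (by omega), hx, map_zero]
      abel
  rw [NatTrans.comp_app] at this
  exact quasiIso_of_comp_right (c'.app τ) (c.app τ)

/-- Weak equivalences between cofibrant diagrams induce isomorphisms in the homology of the
dg-hom. -/
lemma IsWeakEquiv.isIso_homologyMap {C X : DGDiagram k n} (hC : IsCofibrantDiagram C)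
    (hX : IsCofibrantDiagram X) {c : C ⟶ X} (hc : IsWeakEquiv c) (T : DGDiagram k n) (m : ℤ) :
    IsIso (HomologicalComplex.homologyMap (homComplexMap c T) m) := by
  obtain ⟨c', h'⟩ := hX.exists_isNullHomotopic hc (𝟙 X)
  -- The argument for `c` applies again to `c'`. On homology, `c'` then has inverses on both sides,
  -- so the one induced by `c` is two-sided.
  obtain ⟨c'', h''⟩ := hC.exists_isNullHomotopic (h'.isWeakEquiv hc) (𝟙 C)
  have e1 := h'.homologyMap_eq T m
  have e2 := h''.homologyMap_eq T m
  rw [homComplexMap_comp, homComplexMap_id, HomologicalComplex.homologyMap_comp,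
    HomologicalComplex.homologyMap_id] at e1 e2
  refine ⟨HomologicalComplex.homologyMap (homComplexMap c' T) m, e1, ?_⟩
  rw [← e2]
  congr 1
  rw [← Category.comp_id (HomologicalComplex.homologyMap (homComplexMap c T) m), ← e2,
    ← Category.assoc, e1, Category.id_comp]

end DiagramHomotopy

/-! ### The differential of the Koszul complex -/

namespace PrunedTree

variable {n : ℕ} {τ σ : PrunedTree n}

/-- The two ways of bracketing a triple factorization. -/
def Factorization.assoc (u : τ ⟶ σ) :
    (Σ F : Factorization u, Factorization F.snd) ≃ (Σ E : Factorization u, Factorization E.fst) where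
  toFun P := ⟨⟨P.2.mid, P.1.fst ≫ P.2.fst, P.2.snd, by
      rw [Category.assoc, P.2.comp, P.1.comp]⟩, ⟨P.1.mid, P.1.fst, P.2.fst, rfl⟩⟩
  invFun P := ⟨⟨P.2.mid, P.2.fst, P.2.snd ≫ P.1.snd, by
      rw [← Category.assoc, P.2.comp, P.1.comp]⟩, ⟨P.1.mid, P.2.snd, P.1.snd, rfl⟩⟩
  left_inv := by
    rintro ⟨⟨a, w, v, h⟩, ⟨b, w', v', h'⟩⟩
    dsimp only at w' v' h'
    subst h'
    rfl
  right_inv := by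
    rintro ⟨⟨a, w, v, h⟩, ⟨b, w', v', h'⟩⟩
    dsimp only at w' v' h'
    subst h'
    rfl

lemma Factorization.sum_assoc {M : Type*} [AddCommMonoid M] (u : τ ⟶ σ)
    (ψ : ∀ {a b : PrunedTree n}, (τ ⟶ a) → (a ⟶ b) → (b ⟶ σ) → M) :
    ∑ F : Factorization u, ∑ G : Factorization F.snd, ψ F.fst G.fst G.snd =
      ∑ E : Factorization u, ∑ H : Factorization E.fst, ψ H.fst H.snd E.snd := by
  rw [Finset.sum_sigma', Finset.sum_sigma']
  exact Fintype.sum_equiv (Factorization.assoc u) _ _ fun _ => rfl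

lemma Factorization.deg_snd_add_one {u : τ ⟶ σ} {F : Factorization u}
    (h : Hom.coeff F.fst ≠ 0) : Hom.deg F.snd + 1 = Hom.deg u := by
  have h1 : Hom.deg F.fst = 1 := by
    by_contra h1
    exact h (Hom.coeff_of_deg_ne h1)
  have := F.deg_add
  omega

lemma Factorization.deg_fst_add_one {u : τ ⟶ σ} {F : Factorization u}
    (h : Hom.coeff F.snd ≠ 0) : Hom.deg F.fst + 1 = Hom.deg u := by
  have h1 : Hom.deg F.snd = 1 := by
    by_contra h1
    exact h (Hom.coeff_of_deg_ne h1)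
  have := F.deg_add
  omega

lemma Factorization.sum_coeff_fst {M : Type*} [AddCommGroup M] (u : τ ⟶ σ)
    (ψ : Factorization u → M) :
    ∑ F : {F : Factorization u // Hom.deg F.fst = 1}, Hom.sgn F.1.fst • ψ F.1 =
      ∑ F : Factorization u, Hom.coeff F.fst • ψ F := by
  classical
  symm
  rw [← Finset.sum_filter_of_ne (p := fun F : Factorization u => Hom.deg F.fst = 1)]
  · rw [Finset.sum_subtype (p := fun F : Factorization u => Hom.deg F.fst = 1) _ (by simp)]
    exact Finset.sum_congr rfl fun F _ => by rw [Hom.coeff, if_pos F.2]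
  · intro F _ h
    by_contra h1
    exact h (by rw [Hom.coeff_of_deg_ne h1, zero_smul])

lemma Factorization.sum_coeff_snd {M : Type*} [AddCommGroup M] (u : τ ⟶ σ)
    (ψ : Factorization u → M) :
    ∑ F : {F : Factorization u // Hom.deg F.snd = 1}, Hom.sgn F.1.snd • ψ F.1 =
      ∑ F : Factorization u, Hom.coeff F.snd • ψ F := by
  classical
  symm
  rw [← Finset.sum_filter_of_ne (p := fun F : Factorization u => Hom.deg F.snd = 1)]
  · rw [Finset.sum_subtype (p := fun F : Factorization u => Hom.deg F.snd = 1) _ (by simp)]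
    exact Finset.sum_congr rfl fun F _ => by rw [Hom.coeff, if_pos F.2]
  · intro F _ h
    by_contra h1
    exact h (by rw [Hom.coeff_of_deg_ne h1, zero_smul])

end PrunedTree

section KoszulDifferential

variable {k : Type u} [CommRing k] {n : ℕ}

open PrunedTree

/-- The element `x ⊗ {u} ⊗ y` of `K(Ω, Ω, S)(φ)` if it has degree `m`, and zero otherwise. -/
noncomputable def koszulEltZ (S : DGDiagram k n) {φ τ σ : PrunedTree n} (u : τ ⟶ σ) (x : σ ⟶ φ)
    (q m : ℤ) : (S.obj τ).X q →ₗ[k] KoszulX S φ m :=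
  if h : Hom.deg u + q = m then koszulElt S u x q m h else 0

variable (S : DGDiagram k n) {φ ψ τ σ : PrunedTree n}

lemma koszulEltZ_eq (u : τ ⟶ σ) (x : σ ⟶ φ) (q m : ℤ) (h : Hom.deg u + q = m) :
    koszulEltZ S u x q m = koszulElt S u x q m h := dif_pos h

lemma koszulMap_elt (f : φ ⟶ ψ) (u : τ ⟶ σ) (x : σ ⟶ φ) (q m : ℤ) (h : Hom.deg u + q = m)
    (y : (S.obj τ).X q) :
    koszulMap S f m (koszulElt S u x q m h y) = koszulElt S u (x ≫ f) q m h y :=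
  koszulLift_elt _ _ _ _ _ _ _

lemma koszulMap_eltZ (f : φ ⟶ ψ) (u : τ ⟶ σ) (x : σ ⟶ φ) (q m : ℤ) (y : (S.obj τ).X q) :
    koszulMap S f m (koszulEltZ S u x q m y) = koszulEltZ S u (x ≫ f) q m y := by
  by_cases h : Hom.deg u + q = m
  · rw [koszulEltZ_eq S u x q m h, koszulEltZ_eq S u _ q m h, koszulMap_elt]
  · simp [koszulEltZ, h]

/-- The values `∑_{u = v w} sgn(v) (x v) ⊗ {w} ⊗ y + ∑_{u = v w} (-1)^(deg u) sgn(w) x ⊗ {v} ⊗ w_* y`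
of the twisting homomorphism. -/
noncomputable def koszulTw (u : τ ⟶ σ) (x : σ ⟶ φ) (q m : ℤ) :
    (S.obj τ).X q →ₗ[k] KoszulX S φ m :=
  ∑ F : Factorization u, Hom.coeff F.snd • koszulEltZ S F.fst (F.snd ≫ x) q m +
    ∑ F : Factorization u, Hom.coeff F.fst • ((Hom.deg u).negOnePow : ℤ) •
      (koszulEltZ S F.snd x q m ∘ₗ ((S.map F.fst).f q).hom)

lemma koszulTw_apply (u : τ ⟶ σ) (x : σ ⟶ φ) (q m : ℤ) (y : (S.obj τ).X q) :
    koszulTw S u x q m y =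
      ∑ F : Factorization u, Hom.coeff F.snd • koszulEltZ S F.fst (F.snd ≫ x) q m y +
        ∑ F : Factorization u, Hom.coeff F.fst • ((Hom.deg u).negOnePow : ℤ) •
          koszulEltZ S F.snd x q m (((S.map F.fst).f q).hom y) := by
  simp only [koszulTw, LinearMap.add_apply, LinearMap.sum_apply, LinearMap.smul_apply,
    LinearMap.comp_apply]

/-- Sums over all factorizations, with coefficients and elements extended by zero, can be reindexed
without carrying degree conditions. -/
lemma koszulD_elt (i j : ℤ) (h : j + 1 = i) (u : τ ⟶ σ) (x : σ ⟶ φ) (q : ℤ)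
    (hq : Hom.deg u + q = i) (y : (S.obj τ).X q) :
    koszulD S φ i j h (koszulElt S u x q i hq y) =
      ((Hom.deg u).negOnePow : ℤ) • koszulEltZ S u x (q - 1) j (((S.obj τ).d q (q - 1)).hom y) +
        koszulTw S u x q j y := by
  rw [koszulD, koszulLift_elt, koszulTw_apply, ← Factorization.sum_coeff_fst,
    ← Factorization.sum_coeff_snd, koszulEltZ_eq S u x (q - 1) j (by omega), add_assoc]
  simp only [LinearMap.add_apply, LinearMap.sum_apply, LinearMap.smul_apply, LinearMap.comp_apply]
  congr 2
  · refine Finset.sum_congr rfl fun F _ => ?_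
    rw [koszulEltZ_eq]
  · refine Finset.sum_congr rfl fun F _ => ?_
    rw [koszulEltZ_eq, mul_comm, mul_smul]

lemma koszulD_eltZ (i j : ℤ) (h : j + 1 = i) (u : τ ⟶ σ) (x : σ ⟶ φ) (q : ℤ)
    (hq : Hom.deg u + q = i) (y : (S.obj τ).X q) :
    koszulD S φ i j h (koszulEltZ S u x q i y) =
      ((Hom.deg u).negOnePow : ℤ) • koszulEltZ S u x (q - 1) j (((S.obj τ).d q (q - 1)).hom y) +
        koszulTw S u x q j y := by
  rw [koszulEltZ_eq S u x q i hq, koszulD_elt]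

/-- The values of the twisting homomorphism on `{u}` only involve morphisms of degree
`deg u - 1`. -/
lemma koszulTw_ext {M : Type*} [AddCommGroup M] [Module k M] {u : τ ⟶ σ} {m : ℤ}
    {f g : KoszulX S φ m →ₗ[k] M}
    (h : ∀ {τ' σ' : PrunedTree n} (v : τ' ⟶ σ') (_ : Hom.deg v + 1 = Hom.deg u) (x : σ' ⟶ φ) (q : ℤ)
      (hq : Hom.deg v + q = m) (y : (S.obj τ').X q),
      f (koszulElt S v x q m hq y) = g (koszulElt S v x q m hq y))
    (x : σ ⟶ φ) (q : ℤ) (y : (S.obj τ).X q) :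
    f (koszulTw S u x q m y) = g (koszulTw S u x q m y) := by
  have h' : ∀ {τ' σ' : PrunedTree n} (v : τ' ⟶ σ') (_ : Hom.deg v + 1 = Hom.deg u) (x : σ' ⟶ φ)
      (q : ℤ) (y : (S.obj τ').X q), f (koszulEltZ S v x q m y) = g (koszulEltZ S v x q m y) := by
    intro τ' σ' v hv x q y
    by_cases hq : Hom.deg v + q = m
    · rw [koszulEltZ_eq S v x q m hq, h v hv]
    · simp [koszulEltZ, hq]
  rw [koszulTw_apply]
  simp only [map_add, map_sum, map_zsmul]
  congr 1
  · refine Finset.sum_congr rfl fun F _ => ?_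
    by_cases hF : Hom.coeff F.snd = 0
    · rw [hF, zero_smul, zero_smul]
    · rw [h' F.fst (Factorization.deg_fst_add_one hF)]
  · refine Finset.sum_congr rfl fun F _ => ?_
    by_cases hF : Hom.coeff F.fst = 0
    · rw [hF, zero_smul, zero_smul]
    · rw [h' F.snd (Factorization.deg_snd_add_one hF)]

lemma koszulMap_tw (f : φ ⟶ ψ) (u : τ ⟶ σ) (x : σ ⟶ φ) (q m : ℤ) (y : (S.obj τ).X q) :
    koszulMap S f m (koszulTw S u x q m y) = koszulTw S u (x ≫ f) q m y := by
  simp only [koszulTw_apply, map_add, map_sum, map_zsmul, koszulMap_eltZ, Category.assoc]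

/-- The twisting homomorphism anticommutes with the internal differential and has square zero. -/
lemma koszulD_tw (i j : ℤ) (h : j + 1 = i) (u : τ ⟶ σ) (x : σ ⟶ φ) (q : ℤ)
    (hq : Hom.deg u + q = i + 1) (y : (S.obj τ).X q) :
    koszulD S φ i j h (koszulTw S u x q i y) =
      -(((Hom.deg u).negOnePow : ℤ) •
        koszulTw S u x (q - 1) j (((S.obj τ).d q (q - 1)).hom y)) := by
  have hs : ∀ d : ℤ, d + 1 = Hom.deg u → (d.negOnePow : ℤ) = -((Hom.deg u).negOnePow : ℤ) := by
    rintro d hd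
    rw [← hd, Int.negOnePow_succ, Units.val_neg, neg_neg]
  set s : ℤ := ((Hom.deg u).negOnePow : ℤ) with hsdef
  have hss : s * s = 1 := negOnePow_mul_self _
  have e1 : ∀ F : Factorization u,
      koszulD S φ i j h (Hom.coeff F.snd • koszulEltZ S F.fst (F.snd ≫ x) q i y) =
        -(s • Hom.coeff F.snd •
          koszulEltZ S F.fst (F.snd ≫ x) (q - 1) j (((S.obj τ).d q (q - 1)).hom y)) +
        ∑ G : Factorization F.fst, (Hom.coeff G.snd * Hom.coeff F.snd) •
          koszulEltZ S G.fst ((G.snd ≫ F.snd) ≫ x) q j y -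
        ∑ G : Factorization F.fst, (s * Hom.coeff G.fst) • Hom.coeff F.snd •
          koszulEltZ S G.snd (F.snd ≫ x) q j (((S.map G.fst).f q).hom y) := by
    intro F
    by_cases hF : Hom.coeff F.snd = 0
    · simp [hF]
    · have hd := Factorization.deg_fst_add_one hF
      rw [map_zsmul, koszulD_eltZ S i j h _ _ _ (by omega), hs _ hd, koszulTw_apply, hs _ hd,
        smul_add, smul_add, Finset.smul_sum, Finset.smul_sum, ← add_assoc, neg_smul, smul_neg,
        smul_comm (Hom.coeff F.snd) s, sub_eq_add_neg (_ + _) (Finset.sum _ _),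
        ← Finset.sum_neg_distrib]
      congr 2
      · refine Finset.sum_congr rfl fun G _ => ?_
        rw [smul_smul, mul_comm, Category.assoc]
      · refine funext fun G => ?_
        simp only [smul_smul, ← neg_smul]
        congr 1
        ring
  have e2 : ∀ F : Factorization u,
      koszulD S φ i j h (Hom.coeff F.fst • s • koszulEltZ S F.snd x q i
          (((S.map F.fst).f q).hom y)) =
        -(Hom.coeff F.fst • koszulEltZ S F.snd x (q - 1) j
          (((S.map F.fst).f (q - 1)).hom (((S.obj τ).d q (q - 1)).hom y))) +
        ∑ G : Factorization F.snd, (s * Hom.coeff F.fst) • Hom.coeff G.snd •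
          koszulEltZ S G.fst (G.snd ≫ x) q j (((S.map F.fst).f q).hom y) -
        ∑ G : Factorization F.snd, (Hom.coeff F.fst * Hom.coeff G.fst) •
          koszulEltZ S G.snd x q j (((S.map (F.fst ≫ G.fst)).f q).hom y) := by
    intro F
    by_cases hF : Hom.coeff F.fst = 0
    · simp [hF]
    · have hd := Factorization.deg_snd_add_one hF
      rw [map_zsmul, map_zsmul, koszulD_eltZ S i j h _ _ _ (by omega), hs _ hd, koszulTw_apply,
        hs _ hd, smul_add, smul_add, smul_add, smul_add, Finset.smul_sum, Finset.smul_sum,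
        Finset.smul_sum, Finset.smul_sum, ← add_assoc, sub_eq_add_neg (_ + _) (Finset.sum _ _), ← Finset.sum_neg_distrib,
        hom_d]
      congr 2
      · simp only [smul_smul, ← neg_smul]
        congr 1
        linear_combination (-Hom.coeff F.fst) * hss
      · refine Finset.sum_congr rfl fun G _ => ?_
        simp only [smul_smul]
        congr 1
        ring
      · refine funext fun G => ?_
        have h3 : ((S.map (F.fst ≫ G.fst)).f q).hom y =
            ((S.map G.fst).f q).hom (((S.map F.fst).f q).hom y) := by
          rw [S.map_comp]
          rfl
        rw [h3]
        simp only [smul_smul, ← neg_smul]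
        congr 1
        linear_combination (-Hom.coeff F.fst * Hom.coeff G.fst) * hss
  -- Two mergings moved to the same side are summed over the factorizations of their composite,
  -- where `sum_coeff_mul_coeff` applies. In `t23` one merging goes to each side; the two orders of
  -- doing this differ by a sign, as each step lowers `deg u` by one.
  have t22 : ∑ F : Factorization u, ∑ G : Factorization F.fst,
      (Hom.coeff G.snd * Hom.coeff F.snd) •
        koszulEltZ S G.fst ((G.snd ≫ F.snd) ≫ x) q j y = 0 := by
    rw [← Factorization.sum_assoc u fun a b c => (Hom.coeff b * Hom.coeff c) •
      koszulEltZ S a ((b ≫ c) ≫ x) q j y]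
    refine Finset.sum_eq_zero fun F _ => ?_
    have : ∀ G : Factorization F.snd, (Hom.coeff G.fst * Hom.coeff G.snd) •
        koszulEltZ S F.fst ((G.fst ≫ G.snd) ≫ x) q j y =
        (Hom.coeff G.fst * Hom.coeff G.snd) • koszulEltZ S F.fst (F.snd ≫ x) q j y :=
      fun G => by rw [G.comp]
    rw [Finset.sum_congr rfl fun G _ => this G, ← Finset.sum_smul, sum_coeff_mul_coeff, zero_smul]
  have t33 : ∑ F : Factorization u, ∑ G : Factorization F.snd,
      (Hom.coeff F.fst * Hom.coeff G.fst) •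
        koszulEltZ S G.snd x q j (((S.map (F.fst ≫ G.fst)).f q).hom y) = 0 := by
    rw [Factorization.sum_assoc u fun a b c => (Hom.coeff a * Hom.coeff b) •
      koszulEltZ S c x q j (((S.map (a ≫ b)).f q).hom y)]
    refine Finset.sum_eq_zero fun E _ => ?_
    have : ∀ H : Factorization E.fst, (Hom.coeff H.fst * Hom.coeff H.snd) •
        koszulEltZ S E.snd x q j (((S.map (H.fst ≫ H.snd)).f q).hom y) =
        (Hom.coeff H.fst * Hom.coeff H.snd) •
          koszulEltZ S E.snd x q j (((S.map E.fst).f q).hom y) :=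
      fun G => by rw [G.comp]
    rw [Finset.sum_congr rfl fun G _ => this G, ← Finset.sum_smul, sum_coeff_mul_coeff, zero_smul]
  have t23 := Factorization.sum_assoc u fun a b c => (s * Hom.coeff a) • Hom.coeff c •
    koszulEltZ S b (c ≫ x) q j (((S.map a).f q).hom y)
  rw [koszulTw_apply, map_add, map_sum, map_sum, Finset.sum_congr rfl fun F _ => e1 F,
    Finset.sum_congr rfl fun F _ => e2 F, koszulTw_apply]
  simp only [Finset.sum_add_distrib, Finset.sum_sub_distrib, Finset.sum_neg_distrib, t22, t33,
    ← hsdef]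
  rw [t23, smul_add, Finset.smul_sum, Finset.smul_sum]
  have e3 : ∀ F : Factorization u, s • Hom.coeff F.fst • s • koszulEltZ S F.snd x (q - 1) j
      (((S.map F.fst).f (q - 1)).hom (((S.obj τ).d q (q - 1)).hom y)) =
      Hom.coeff F.fst • koszulEltZ S F.snd x (q - 1) j
      (((S.map F.fst).f (q - 1)).hom (((S.obj τ).d q (q - 1)).hom y)) := by
    intro F
    simp only [smul_smul]
    congr 1
    linear_combination (Hom.coeff F.fst) * hss
  rw [Finset.sum_congr rfl fun F _ => e3 F]
  abel

/-- The differential of the Koszul complex has square zero. -/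
theorem koszulSquareZero : KoszulSquareZero S := by
  intro φ i j l h h'
  refine koszul_hom_ext fun {τ σ} u x q hq y => ?_
  rw [LinearMap.comp_apply, koszulD_elt, map_add, map_zsmul, koszulD_tw S j l h' u x q (by omega),
    koszulD_eltZ S j l h' _ _ _ (by omega), d_d, map_zero, smul_zero, zero_add, add_neg_cancel]
  rfl

end KoszulDifferential

/-! ### The augmentation of the Koszul complex -/

namespace PrunedTree

variable {n : ℕ} {τ σ : PrunedTree n}

/-- The morphisms of degree zero are the identities. -/
lemma Hom.exists_eq_of_deg_eq_zero (f : τ ⟶ σ) (h : Hom.deg f = 0) :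
    ∃ e : τ = σ, f = eqToHom e := by
  have h1 : (⟨τ, 𝟙 τ, f, Category.id_comp f⟩ : Factorization f) =
      ⟨σ, f, 𝟙 σ, Category.comp_id f⟩ :=
    Factorization.eq_of_deg_fst_eq_zero (Hom.deg_id τ) h
  injection h1 with h2 h3
  subst h2
  exact ⟨rfl, (eq_of_heq h3).symm⟩

end PrunedTree

section KoszulAugmentation

variable {k : Type u} [CommRing k] {n : ℕ}

open PrunedTree

variable (S : DGDiagram k n) {φ ψ τ σ : PrunedTree n}

lemma koszulAug_elt (u : τ ⟶ σ) (x : σ ⟶ φ) (q m : ℤ) (h : Hom.deg u + q = m)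
    (hu : Hom.deg u = 0) (y : (S.obj τ).X q) :
    koszulAug S φ m (koszulElt S u x q m h y) = fAt (S.map (u ≫ x)) q m (by omega) y := by
  rw [koszulAug, koszulLift_elt, dif_pos hu]
  rfl

lemma koszulAug_elt_of_ne (u : τ ⟶ σ) (x : σ ⟶ φ) (q m : ℤ) (h : Hom.deg u + q = m)
    (hu : Hom.deg u ≠ 0) (y : (S.obj τ).X q) :
    koszulAug S φ m (koszulElt S u x q m h y) = 0 := by
  rw [koszulAug, koszulLift_elt, dif_neg hu]
  rfl

/-- For `deg u = 1` only the two factorizations through an identity contribute, and the sign of the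
action term makes them cancel. In other degrees no term contains a morphism of degree zero. -/
lemma koszulAug_tw (u : τ ⟶ σ) (x : σ ⟶ φ) (q m : ℤ) (h : Hom.deg u + q = m + 1)
    (y : (S.obj τ).X q) : koszulAug S φ m (koszulTw S u x q m y) = 0 := by
  by_cases hu : Hom.deg u = 1
  · obtain rfl : q = m := by omega
    have e1 : ∀ F : Factorization u, F ≠ ⟨τ, 𝟙 τ, u, Category.id_comp u⟩ →
        koszulAug S φ q (Hom.coeff F.snd • koszulEltZ S F.fst (F.snd ≫ x) q q y) = 0 := by
      intro F hF
      rw [Hom.coeff_of_deg_ne, zero_smul, map_zero]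
      intro h1
      refine hF (Factorization.eq_of_deg_fst_eq_zero ?_ (Hom.deg_id τ))
      have := F.deg_add
      omega
    have e2 : ∀ F : Factorization u, F ≠ ⟨σ, u, 𝟙 σ, Category.comp_id u⟩ →
        koszulAug S φ q (Hom.coeff F.fst • ((Hom.deg u).negOnePow : ℤ) •
          koszulEltZ S F.snd x q q (((S.map F.fst).f q).hom y)) = 0 := by
      intro F hF
      rw [Hom.coeff_of_deg_ne, zero_smul, map_zero]
      intro h1
      refine hF (Factorization.eq_of_deg_snd_eq_zero ?_ (Hom.deg_id σ))
      have := F.deg_add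
      omega
    rw [koszulTw_apply, map_add, map_sum, map_sum, Fintype.sum_eq_single _ e1,
      Fintype.sum_eq_single _ e2, koszulEltZ_eq S _ _ _ _ (by simp),
      koszulEltZ_eq S _ _ _ _ (by simp), map_zsmul, map_zsmul, map_zsmul,
      koszulAug_elt S _ _ _ _ _ (Hom.deg_id τ), koszulAug_elt S _ _ _ _ _ (Hom.deg_id σ),
      fAt_rfl, fAt_rfl, hu, Int.negOnePow_one, Category.id_comp, Category.id_comp, S.map_comp]
    simp
  · have := koszulTw_ext S (u := u) (f := koszulAug S φ m) (g := 0)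
      (fun v hv x q hq y => koszulAug_elt_of_ne S v x q m hq (by omega) y) x q y
    exact this

lemma koszulAug_koszulD (i j : ℤ) (h : j + 1 = i) :
    koszulAug S φ j ∘ₗ koszulD S φ i j h = ((S.obj φ).d i j).hom ∘ₗ koszulAug S φ i := by
  refine koszul_hom_ext fun {τ σ} u x q hq y => ?_
  rw [LinearMap.comp_apply, LinearMap.comp_apply, koszulD_elt, map_add, map_zsmul,
    koszulAug_tw S u x q j (by omega), koszulEltZ_eq S _ _ _ _ (by omega), add_zero]
  by_cases hu : Hom.deg u = 0
  · have hs : ((Hom.deg u).negOnePow : ℤ) = 1 := by rw [hu, Int.negOnePow_zero, Units.val_one]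
    rw [koszulAug_elt S _ _ _ _ _ hu, koszulAug_elt S _ _ _ _ _ hu,
      d_fAt _ (a' := q - 1) (h' := (by omega : q - 1 = j)), hs, one_smul]
  · rw [koszulAug_elt_of_ne S _ _ _ _ _ hu, koszulAug_elt_of_ne S _ _ _ _ _ hu]
    simp

lemma koszulAug_koszulMap (f : φ ⟶ ψ) (m : ℤ) :
    koszulAug S ψ m ∘ₗ koszulMap S f m = ((S.map f).f m).hom ∘ₗ koszulAug S φ m := by
  refine koszul_hom_ext fun {τ σ} u x q hq y => ?_
  rw [LinearMap.comp_apply, LinearMap.comp_apply, koszulMap_elt]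
  by_cases hu : Hom.deg u = 0
  · rw [koszulAug_elt S _ _ _ _ _ hu, koszulAug_elt S _ _ _ _ _ hu, f_fAt, ← S.map_comp,
      Category.assoc]
  · rw [koszulAug_elt_of_ne S _ _ _ _ _ hu, koszulAug_elt_of_ne S _ _ _ _ _ hu, map_zero]

variable (hK : KoszulSquareZero S)

lemma koszulObj_d (φ : PrunedTree n) (i j : ℤ) (h : j + 1 = i) :
    (koszulObj S hK φ).d i j = ModuleCat.ofHom (koszulD S φ i j h) := dif_pos h

/-- The augmentation, as a morphism of diagrams. -/
noncomputable def koszulAugmentation : koszul S hK ⟶ S where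
  app φ :=
    { f := fun m => ModuleCat.ofHom (koszulAug S φ m)
      comm' := fun i j hij => by
        have h : j + 1 = i := hij
        change _ = (koszulObj S hK φ).d i j ≫ _
        rw [koszulObj_d S hK φ i j h]
        exact ModuleCat.hom_ext (koszulAug_koszulD S i j h).symm }
  naturality φ ψ f := HomologicalComplex.hom_ext _ _ fun m =>
    ModuleCat.hom_ext (koszulAug_koszulMap S f m)

/-- The inclusion `y ↦ 1 ⊗ {1} ⊗ y` of `S(φ)`. -/
noncomputable def koszulUnit (φ : PrunedTree n) (m : ℤ) : (S.obj φ).X m →ₗ[k] KoszulX S φ m :=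
  koszulElt S (𝟙 φ) (𝟙 φ) m m (by simp)

lemma koszulAug_unit (m : ℤ) (y : (S.obj φ).X m) : koszulAug S φ m (koszulUnit S φ m y) = y := by
  rw [koszulUnit, koszulAug_elt S _ _ _ _ _ (Hom.deg_id φ), fAt_rfl]
  simp

lemma koszulTw_of_deg_eq_zero {u : τ ⟶ σ} (hu : Hom.deg u = 0) (x : σ ⟶ φ) (q m : ℤ)
    (y : (S.obj τ).X q) : koszulTw S u x q m y = 0 :=
  koszulTw_ext S (f := LinearMap.id) (g := 0) (fun v hv _ _ _ _ => by
    have := Hom.deg_nonneg v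
    omega) x q y

lemma koszulD_unit (i j : ℤ) (h : j + 1 = i) (y : (S.obj φ).X i) :
    koszulD S φ i j h (koszulUnit S φ i y) = koszulUnit S φ j (((S.obj φ).d i j).hom y) := by
  obtain rfl : j = i - 1 := by omega
  have hs : ((Hom.deg (𝟙 φ)).negOnePow : ℤ) = 1 := by
    rw [Hom.deg_id, Int.negOnePow_zero, Units.val_one]
  rw [koszulUnit, koszulD_elt, koszulTw_of_deg_eq_zero S (Hom.deg_id φ),
    koszulEltZ_eq S _ _ _ _ (by simp), hs, one_smul, add_zero]
  rfl

/-- The lowest step of the filtration is the copy of `S` itself: degrees are nonnegative, so both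
factors are identities. -/
lemma koszulElt_eq_unit (u : τ ⟶ σ) (x : σ ⟶ φ) (q m : ℤ) (h : Hom.deg u + q = m)
    (hux : Hom.deg (u ≫ x) = 0) (y : (S.obj τ).X q) :
    koszulElt S u x q m h y = koszulUnit S φ m (koszulAug S φ m (koszulElt S u x q m h y)) := by
  rw [Hom.deg_comp] at hux
  have hu := Hom.deg_nonneg u
  have hx := Hom.deg_nonneg x
  obtain ⟨rfl, rfl⟩ := Hom.exists_eq_of_deg_eq_zero u (by omega)
  obtain ⟨rfl, rfl⟩ := Hom.exists_eq_of_deg_eq_zero x (by omega)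
  obtain rfl : q = m := by
    rw [eqToHom_refl, Hom.deg_id] at h
    omega
  exact congrArg (koszulUnit S τ q) (koszulAug_unit S q y).symm

end KoszulAugmentation

/-! ### Acyclicity of the Koszul complex -/

section KoszulAcyclic

variable {k : Type u} [CommRing k] {n : ℕ}

open PrunedTree

open Classical in
/-- A contraction of the interval of factorizations of `f`, if `f` has positive degree, and zero
otherwise. -/
noncomputable def PrunedTree.contraction {τ φ : PrunedTree n} (f : τ ⟶ φ) :
    Factorization f → Factorization f → ℤ :=
  if hf : Hom.deg f ≠ 0 then (Factorization.exists_contraction hf).choose else 0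

lemma PrunedTree.deg_fst_of_contraction_ne_zero {τ φ : PrunedTree n} {f : τ ⟶ φ}
    {F G : Factorization f} (h : contraction f F G ≠ 0) :
    Hom.deg G.fst = Hom.deg F.fst + 1 := by
  by_cases hf : Hom.deg f ≠ 0
  · rw [contraction, dif_pos hf] at h
    exact (Factorization.exists_contraction hf).choose_spec.1 F G h
  · rw [contraction, dif_neg hf] at h
    exact absurd rfl h

open Classical in
lemma PrunedTree.contraction_spec {τ φ : PrunedTree n} {f : τ ⟶ φ} (hf : Hom.deg f ≠ 0)
    (F H : Factorization f) :
    ∑ G, Factorization.coeff F G * contraction f G H +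
      ∑ G, contraction f F G * Factorization.coeff G H = if F = H then 1 else 0 := by
  rw [contraction, dif_pos hf]
  exact (Factorization.exists_contraction hf).choose_spec.2 F H

lemma PrunedTree.contraction_of_deg_eq_zero {τ φ : PrunedTree n} {f : τ ⟶ φ}
    (hf : Hom.deg f = 0) (F G : Factorization f) : contraction f F G = 0 := by
  rw [contraction, dif_neg (not_not.2 hf)]
  rfl

variable (S : DGDiagram k n) {φ τ σ : PrunedTree n}

/-- The homotopy which contracts the Koszul complex up to terms of lower filtration. -/
noncomputable def koszulH (φ : PrunedTree n) (i j : ℤ) : KoszulX S φ i →ₗ[k] KoszulX S φ j :=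
  koszulLift S fun u x q _ => ∑ G : Factorization (u ≫ x),
    contraction (u ≫ x) ⟨_, u, x, rfl⟩ G • koszulEltZ S G.fst G.snd q j

lemma koszulH_elt {f : τ ⟶ φ} (F : Factorization f) (q i j : ℤ) (h : Hom.deg F.fst + q = i)
    (y : (S.obj τ).X q) :
    koszulH S φ i j (koszulElt S F.fst F.snd q i h y) =
      ∑ G, contraction f F G • koszulEltZ S G.fst G.snd q j y := by
  obtain ⟨m, u, x, rfl⟩ := F
  rw [koszulH, koszulLift_elt]
  simp only [LinearMap.sum_apply, LinearMap.smul_apply]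

lemma koszulH_eltZ {f : τ ⟶ φ} (F : Factorization f) (q i j : ℤ) (h : Hom.deg F.fst + q = i)
    (y : (S.obj τ).X q) :
    koszulH S φ i j (koszulEltZ S F.fst F.snd q i y) =
      ∑ G, contraction f F G • koszulEltZ S G.fst G.snd q j y := by
  rw [koszulEltZ_eq S _ _ _ _ h, koszulH_elt]

/-- The filtration by the degree of the composite `x u` of `x ⊗ {u} ⊗ y`. -/
noncomputable def koszulFil (φ : PrunedTree n) (m : ℤ) (N : ℕ) : Submodule k (KoszulX S φ m) :=
  Submodule.span k {z | ∃ (τ σ : PrunedTree n) (u : τ ⟶ σ) (x : σ ⟶ φ) (q : ℤ)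
    (h : Hom.deg u + q = m) (y : (S.obj τ).X q), Hom.deg (u ≫ x) < N ∧ z = koszulElt S u x q m h y}

lemma koszulEltZ_mem_fil {N : ℕ} (u : τ ⟶ σ) (x : σ ⟶ φ) (q m : ℤ) (y : (S.obj τ).X q)
    (h : Hom.deg (u ≫ x) < N) : koszulEltZ S u x q m y ∈ koszulFil S φ m N := by
  by_cases hq : Hom.deg u + q = m
  · rw [koszulEltZ_eq S _ _ _ _ hq]
    exact Submodule.subset_span ⟨τ, σ, u, x, q, hq, y, h, rfl⟩
  · simp [koszulEltZ, hq]

lemma exists_mem_fil {m : ℤ} (z : KoszulX S φ m) : ∃ N, z ∈ koszulFil S φ m N := by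
  classical
  induction z using DirectSum.induction_on with
  | zero => exact ⟨0, zero_mem _⟩
  | of I y =>
    refine ⟨(Hom.deg (I.u ≫ I.x)).toNat + 1, Submodule.subset_span
      ⟨I.src, I.tgt, I.u, I.x, I.q, I.deg_eq, y, ?_, rfl⟩⟩
    have := Int.self_le_toNat (Hom.deg (I.u ≫ I.x))
    push_cast
    omega
  | add z w hz hw =>
    obtain ⟨N, hN⟩ := hz
    obtain ⟨M, hM⟩ := hw
    have hmono : ∀ {N M : ℕ}, N ≤ M → koszulFil S φ m N ≤ koszulFil S φ m M := by
      intro N M h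
      refine Submodule.span_mono ?_
      rintro z ⟨τ, σ, u, x, q, hq, y, hux, rfl⟩
      exact ⟨τ, σ, u, x, q, hq, y, lt_of_lt_of_le hux (by exact_mod_cast h), rfl⟩
    exact ⟨max N M, add_mem (hmono (le_max_left _ _) hN) (hmono (le_max_right _ _) hM)⟩

lemma koszulH_mem_fil {i j : ℤ} {N : ℕ} {z : KoszulX S φ i} (hz : z ∈ koszulFil S φ i N) :
    koszulH S φ i j z ∈ koszulFil S φ j N := by
  refine Submodule.span_le (p := (koszulFil S φ j N).comap (koszulH S φ i j)) |>.2 ?_ hz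
  rintro _ ⟨τ, σ, u, x, q, hq, y, hux, rfl⟩
  have := koszulH_elt S (⟨σ, u, x, rfl⟩ : Factorization (u ≫ x)) q i j hq y
  change koszulH S φ i j _ ∈ koszulFil S φ j N
  rw [this]
  refine sum_mem fun G _ => zsmul_mem (koszulEltZ_mem_fil S _ _ _ _ _ ?_) _
  rwa [G.comp]

/-- The part of the differential which lowers the filtration. -/
lemma sum_action_mem_fil {N : ℕ} (u : τ ⟶ σ) (x : σ ⟶ φ) (q m : ℤ) (y : (S.obj τ).X q) (s : ℤ)
    (h : Hom.deg (u ≫ x) ≤ N) :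
    ∑ F : Factorization u, Hom.coeff F.fst • s • koszulEltZ S F.snd x q m
      (((S.map F.fst).f q).hom y) ∈ koszulFil S φ m N := by
  refine sum_mem fun F _ => ?_
  by_cases hF : Hom.coeff F.fst = 0
  · rw [hF, zero_smul]
    exact zero_mem _
  · have := Factorization.deg_snd_add_one hF
    rw [Hom.deg_comp] at h
    exact zsmul_mem (zsmul_mem (koszulEltZ_mem_fil S _ _ _ _ _ (by rw [Hom.deg_comp]; omega)) _) _

/-- On the terms with a fixed composite `f`, moving mergings to `x` is the interval differential,
which `koszulH` contracts. The internal differential cancels, as the contraction raises `deg u` by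
one and flips its sign; the action on `S` lowers the filtration. -/
lemma koszul_homotopy_mem_fil {i j l : ℤ} (h : j + 1 = i) (h' : l + 1 = j) {N : ℕ} (hN : 1 ≤ N)
    {z : KoszulX S φ j} (hz : z ∈ koszulFil S φ j (N + 1)) :
    koszulD S φ i j h (koszulH S φ j i z) + koszulH S φ l j (koszulD S φ j l h' z) - z ∈
      koszulFil S φ j N := by
  classical
  let T : KoszulX S φ j →ₗ[k] KoszulX S φ j :=
    koszulD S φ i j h ∘ₗ koszulH S φ j i + koszulH S φ l j ∘ₗ koszulD S φ j l h' - LinearMap.id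
  refine Submodule.span_le (p := (koszulFil S φ j N).comap T) |>.2 ?_ hz
  rintro _ ⟨τ, σ, u, x, q, hq, y, hux, rfl⟩
  obtain ⟨f, hf⟩ : ∃ f, f = u ≫ x := ⟨_, rfl⟩
  rw [← hf] at hux
  let F : Factorization f := ⟨σ, u, x, hf.symm⟩
  change koszulD S φ i j h (koszulH S φ j i (koszulElt S F.fst F.snd q j hq y)) +
    koszulH S φ l j (koszulD S φ j l h' (koszulElt S F.fst F.snd q j hq y)) -
      koszulElt S F.fst F.snd q j hq y ∈ koszulFil S φ j N
  set s : ℤ := ((Hom.deg u).negOnePow : ℤ) with hsdef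
  have hf0 := Hom.deg_nonneg f
  have hFq : Hom.deg F.fst + q = j := hq
  have hFf : Hom.deg f = Hom.deg F.fst + Hom.deg F.snd := F.deg_add.symm
  have key : ∀ (G : Factorization f) (m : ℤ) (s : ℤ), s = ((Hom.deg G.fst).negOnePow : ℤ) →
      koszulTw S G.fst G.snd q m y = ∑ E, Factorization.coeff G E • koszulEltZ S E.fst E.snd q m y +
        ∑ E : Factorization G.fst, Hom.coeff E.fst • s • koszulEltZ S E.snd G.snd q m
          (((S.map E.fst).f q).hom y) := by
    rintro G m _ rfl
    rw [koszulTw_apply,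
      ← Factorization.sum_refineFst G fun E => koszulEltZ S E.fst E.snd q m y]
    rfl
  have e1 : koszulD S φ i j h (koszulH S φ j i (koszulElt S F.fst F.snd q j hq y)) =
      -(s • ∑ G, contraction f F G • koszulEltZ S G.fst G.snd (q - 1) j
        (((S.obj τ).d q (q - 1)).hom y)) +
      ∑ E, (∑ G, contraction f F G * Factorization.coeff G E) • koszulEltZ S E.fst E.snd q j y +
      ∑ G, contraction f F G • ∑ E : Factorization G.fst, Hom.coeff E.fst • (-s) •
        koszulEltZ S E.snd G.snd q j (((S.map E.fst).f q).hom y) := by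
    rw [koszulH_elt, map_sum]
    simp only [Finset.sum_smul]
    rw [Finset.sum_comm, Finset.smul_sum, ← Finset.sum_neg_distrib, ← Finset.sum_add_distrib,
      ← Finset.sum_add_distrib]
    refine Finset.sum_congr rfl fun G _ => ?_
    by_cases hG : contraction f F G = 0
    · simp [hG]
    · have hd := deg_fst_of_contraction_ne_zero hG
      have hs : ((Hom.deg G.fst).negOnePow : ℤ) = -s := by
        rw [hd, Int.negOnePow_succ, Units.val_neg]
      rw [map_zsmul, koszulD_eltZ S i j h _ _ _ (by omega), key G j (-s) hs.symm, hs]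
      simp only [smul_add, Finset.smul_sum, smul_smul, neg_smul, smul_neg, mul_comm s, add_assoc]
  have e2 : koszulH S φ l j (koszulD S φ j l h' (koszulElt S F.fst F.snd q j hq y)) =
      s • ∑ G, contraction f F G • koszulEltZ S G.fst G.snd (q - 1) j
        (((S.obj τ).d q (q - 1)).hom y) +
      ∑ E, (∑ G, Factorization.coeff F G * contraction f G E) • koszulEltZ S E.fst E.snd q j y +
      koszulH S φ l j (∑ E : Factorization F.fst, Hom.coeff E.fst • s •
        koszulEltZ S E.snd F.snd q l (((S.map E.fst).f q).hom y)) := by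
    rw [koszulD_elt, key F l s rfl, map_add, map_add, map_zsmul,
      koszulH_eltZ S F _ _ _ (by omega), ← add_assoc, map_sum]
    congr 2
    simp only [Finset.sum_smul]
    rw [Finset.sum_comm]
    refine Finset.sum_congr rfl fun G _ => ?_
    by_cases hG : Factorization.coeff F G = 0
    · simp [hG]
    · have hd := (Factorization.covers_of_coeff_ne_zero hG).deg_fst
      rw [map_zsmul, koszulH_eltZ S G _ _ _ (by omega), Finset.smul_sum]
      simp only [smul_smul]
  have m2 : koszulH S φ l j (∑ E : Factorization F.fst, Hom.coeff E.fst • s •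
        koszulEltZ S E.snd F.snd q l (((S.map E.fst).f q).hom y)) ∈ koszulFil S φ j N :=
    koszulH_mem_fil S (sum_action_mem_fil S F.fst F.snd q l y s (by rw [F.comp]; omega))
  have m1 : ∑ G, contraction f F G • ∑ E : Factorization G.fst, Hom.coeff E.fst • (-s) •
        koszulEltZ S E.snd G.snd q j (((S.map E.fst).f q).hom y) ∈ koszulFil S φ j N :=
    sum_mem fun G _ => zsmul_mem
      (sum_action_mem_fil S G.fst G.snd q j y (-s) (by rw [G.comp]; omega)) _
  -- For composites of degree zero the contraction is zero by convention, but the element itself is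
  -- in the smaller step, because `1 ≤ N`.
  by_cases hf1 : Hom.deg f = 0
  · have m3 : koszulElt S F.fst F.snd q j hq y ∈ koszulFil S φ j N :=
      Submodule.subset_span ⟨τ, σ, u, x, q, hq, y, by rw [← hf]; omega, rfl⟩
    rw [e1, e2]
    simp only [contraction_of_deg_eq_zero hf1, zero_mul, mul_zero, zero_smul, Finset.sum_const_zero,
      smul_zero, neg_zero, zero_add]
    exact sub_mem m2 m3
  · have e3 : ∑ E, (∑ G, contraction f F G * Factorization.coeff G E) •
        koszulEltZ S E.fst E.snd q j y +
        ∑ E, (∑ G, Factorization.coeff F G * contraction f G E) •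
          koszulEltZ S E.fst E.snd q j y = koszulElt S F.fst F.snd q j hq y := by
      rw [← Finset.sum_add_distrib, ← koszulEltZ_eq S _ _ _ _ hq]
      simp only [← add_smul]
      rw [Fintype.sum_eq_single F]
      · rw [add_comm, contraction_spec hf1, if_pos rfl, one_smul]
      · intro E hE
        rw [add_comm (Finset.sum _ _), contraction_spec hf1, if_neg hE.symm, zero_smul]
    rw [e1, e2, ← e3]
    convert add_mem m1 m2 using 1
    abel

variable (hK : KoszulSquareZero S)

/-- On a cycle the homotopy formula changes the cycle by a boundary and lowers the filtration by
one; this is iterated down to composites of degree zero. -/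
lemma koszul_cycle {i j l : ℤ} (h : j + 1 = i) (h' : l + 1 = j) (N : ℕ) (z : KoszulX S φ j)
    (hz : z ∈ koszulFil S φ j (N + 1)) (hd : koszulD S φ j l h' z = 0) :
    ∃ w, z - koszulD S φ i j h w ∈ koszulFil S φ j 1 := by
  induction N generalizing z with
  | zero => exact ⟨0, by rwa [map_zero, sub_zero]⟩
  | succ N ih =>
    have h1 := koszul_homotopy_mem_fil S h h' (Nat.succ_pos N) hz
    rw [hd, map_zero, add_zero] at h1
    have h2 : z - koszulD S φ i j h (koszulH S φ j i z) ∈ koszulFil S φ j (N + 1) := by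
      rw [← neg_sub]
      exact neg_mem h1
    obtain ⟨w, hw⟩ := ih _ h2 (by
      rw [map_sub, hd, zero_sub, neg_eq_zero]
      exact congrArg (fun g => g (koszulH S φ j i z)) (koszulSquareZero S φ i j l h h'))
    refine ⟨koszulH S φ j i z + w, ?_⟩
    rwa [map_add, ← sub_sub]

lemma eq_unit_of_mem_fil {m : ℤ} {z : KoszulX S φ m} (hz : z ∈ koszulFil S φ m 1) :
    z = koszulUnit S φ m (koszulAug S φ m z) := by
  have : koszulFil S φ m 1 ≤
      LinearMap.eqLocus LinearMap.id (koszulUnit S φ m ∘ₗ koszulAug S φ m) := by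
    refine Submodule.span_le.2 ?_
    rintro _ ⟨τ, σ, u, x, q, hq, y, hux, rfl⟩
    refine koszulElt_eq_unit S u x q m hq ?_ y
    have := Hom.deg_nonneg (u ≫ x)
    push_cast at hux
    omega
  exact this hz

lemma isProjectiveFibration_koszulAugmentation :
    IsProjectiveFibration (koszulAugmentation S hK) :=
  fun φ m y => ⟨koszulUnit S φ m y, koszulAug_unit S m y⟩

/-- The augmentation of the Koszul complex is a weak equivalence. -/
theorem isWeakEquiv_koszulAugmentation : IsWeakEquiv (koszulAugmentation S hK) := by
  intro φ
  rw [quasiIso_iff_of_surjective _ (isProjectiveFibration_koszulAugmentation S hK φ)]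
  intro i j l h h' z hz hd
  change KoszulX S φ j at z
  change koszulAug S φ j z = 0 at hz
  change ((koszulObj S hK φ).d j l).hom z = 0 at hd
  change ∃ w : KoszulX S φ i, koszulAug S φ i w = 0 ∧ ((koszulObj S hK φ).d i j).hom w = z
  rw [koszulObj_d S hK φ j l h'] at hd
  rw [koszulObj_d S hK φ i j h]
  obtain ⟨N, hN⟩ := exists_mem_fil S z
  obtain ⟨w, hw⟩ := koszul_cycle S h h' N z
    (Submodule.span_mono (by
      rintro z ⟨τ, σ, u, x, q, hq, y, hux, rfl⟩
      exact ⟨τ, σ, u, x, q, hq, y, by push_cast; omega, rfl⟩) hN) hd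
  have hε : koszulAug S φ j (koszulD S φ i j h w) =
      ((S.obj φ).d i j).hom (koszulAug S φ i w) :=
    congrArg (fun g => g w) (koszulAug_koszulD S i j h)
  -- The unit is a chain map splitting the augmentation over each `φ`, so `w` can be corrected to
  -- lie in the kernel.
  refine ⟨w - koszulUnit S φ i (koszulAug S φ i w), ?_, ?_⟩
  · rw [map_sub, koszulAug_unit, sub_self]
  · change koszulD S φ i j h _ = z
    have h1 := eq_unit_of_mem_fil S hw
    rw [map_sub, hz, zero_sub, hε] at h1
    rw [map_sub, koszulD_unit, sub_eq_iff_eq_add, ← sub_eq_iff_eq_add', ← neg_sub z, h1, map_neg,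
      neg_neg]

end KoszulAcyclic

/-! ### Cofibrancy of the Koszul complex -/

section KoszulCofibrant

variable {k : Type u} [CommRing k] {n : ℕ}

open PrunedTree

/-- The families of maps `S(τ)_a → X(σ)_b` of degree `deg u`, for `u : τ ⟶ σ`. -/
abbrev KoszulFamily (S X : DGDiagram k n) : Type u :=
  ∀ ⦃τ σ : PrunedTree n⦄ (u : τ ⟶ σ) (a b : ℤ), Hom.deg u + a = b →
    ((S.obj τ).X a →ₗ[k] (X.obj σ).X b)

variable {S X Y : DGDiagram k n} {φ ψ τ σ : PrunedTree n}

/-- The natural map `x ⊗ {u} ⊗ y ↦ x_* l(u)(y)`. -/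
noncomputable def koszulExtend (l : KoszulFamily S X) (φ : PrunedTree n) (m : ℤ) :
    KoszulX S φ m →ₗ[k] (X.obj φ).X m :=
  koszulLift S fun u x q h => ((X.map x).f m).hom ∘ₗ l u q m h

lemma koszulExtend_elt (l : KoszulFamily S X) (u : τ ⟶ σ) (x : σ ⟶ φ) (q m : ℤ)
    (h : Hom.deg u + q = m) (y : (S.obj τ).X q) :
    koszulExtend l φ m (koszulElt S u x q m h y) = ((X.map x).f m).hom (l u q m h y) := by
  rw [koszulExtend, koszulLift_elt]
  rfl

lemma map_map_apply (X : DGDiagram k n) (x : τ ⟶ σ) (f : σ ⟶ φ) (m : ℤ) (y : (X.obj τ).X m) :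
    ((X.map (x ≫ f)).f m).hom y = ((X.map f).f m).hom (((X.map x).f m).hom y) := by
  rw [X.map_comp]
  rfl

lemma koszulExtend_koszulMap (l : KoszulFamily S X) (f : φ ⟶ ψ) (m : ℤ) :
    koszulExtend l ψ m ∘ₗ koszulMap S f m = ((X.map f).f m).hom ∘ₗ koszulExtend l φ m := by
  refine koszul_hom_ext fun u x q h y => ?_
  rw [LinearMap.comp_apply, LinearMap.comp_apply, koszulMap_elt, koszulExtend_elt,
    koszulExtend_elt, map_map_apply]

/-- The conditions on the value at `u` involve only values in degree `deg u - 1`; this makes the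
recursion on the degree possible. -/
lemma koszulExtend_tw_congr {l l' : KoszulFamily S X} {u : τ ⟶ σ}
    (h : ∀ {τ' σ' : PrunedTree n} (v : τ' ⟶ σ'), Hom.deg v + 1 = Hom.deg u → l v = l' v)
    (x : σ ⟶ φ) (q m : ℤ) (y : (S.obj τ).X q) :
    koszulExtend l φ m (koszulTw S u x q m y) = koszulExtend l' φ m (koszulTw S u x q m y) :=
  koszulTw_ext S (fun v hv x q hq y => by rw [koszulExtend_elt, koszulExtend_elt, h v hv]) x q y

variable {hK : KoszulSquareZero S}

/-- The components of a morphism of diagrams with source the Koszul complex. -/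
noncomputable def koszulHom (g : koszul S hK ⟶ Y) (φ : PrunedTree n) (m : ℤ) :
    KoszulX S φ m →ₗ[k] (Y.obj φ).X m := ((g.app φ).f m).hom

lemma koszulHom_koszulMap (g : koszul S hK ⟶ Y) (f : φ ⟶ ψ) (m : ℤ) (z : KoszulX S φ m) :
    koszulHom g ψ m (koszulMap S f m z) = ((Y.map f).f m).hom (koszulHom g φ m z) :=
  congrArg (fun a : (koszul S hK).obj φ ⟶ Y.obj ψ => (a.f m).hom z) (g.naturality f)

lemma d_koszulHom (g : koszul S hK ⟶ Y) (i j : ℤ) (h : j + 1 = i) (z : KoszulX S φ i) :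
    ((Y.obj φ).d i j).hom (koszulHom g φ i z) = koszulHom g φ j (koszulD S φ i j h z) :=
  (hom_d (g.app φ) i j z).trans (congrArg (fun a => koszulHom g φ j (ModuleCat.Hom.hom a z))
    (koszulObj_d S hK φ i j h))

/-- The conditions on `l(u)` under which `koszulExtend l` commutes with the differentials and lifts
`g` on the elements `x ⊗ {u} ⊗ y`. -/
structure IsKoszulSolution (p : X ⟶ Y) (g : koszul S hK ⟶ Y) (l : KoszulFamily S X) (u : τ ⟶ σ)
    (s : ∀ a b : ℤ, Hom.deg u + a = b → ((S.obj τ).X a →ₗ[k] (X.obj σ).X b)) : Prop where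
  lift : ∀ a b h y, ((p.app σ).f b).hom (s a b h y) =
    koszulHom g σ b (koszulElt S u (𝟙 σ) a b h y)
  comm : ∀ i j b b' (_ : j + 1 = i) (h : Hom.deg u + i = b) (h' : Hom.deg u + j = b')
    (_ : Hom.deg u + i = b' + 1) y,
    ((X.obj σ).d b b').hom (s i b h y) -
        ((Hom.deg u).negOnePow : ℤ) • s j b' h' (((S.obj τ).d i j).hom y) =
      koszulExtend l σ b' (koszulTw S u (𝟙 σ) i b' y)

variable {p : X ⟶ Y} {g : koszul S hK ⟶ Y} {l : KoszulFamily S X}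

lemma IsKoszulSolution.lift_elt {u : τ ⟶ σ} (h : IsKoszulSolution p g l u (l u)) (x : σ ⟶ φ)
    (q m : ℤ) (hq : Hom.deg u + q = m) (y : (S.obj τ).X q) :
    ((p.app φ).f m).hom (koszulExtend l φ m (koszulElt S u x q m hq y)) =
      koszulHom g φ m (koszulElt S u x q m hq y) := by
  have h1 : ((p.app φ).f m).hom (((X.map x).f m).hom (l u q m hq y)) =
      ((Y.map x).f m).hom (((p.app σ).f m).hom (l u q m hq y)) :=
    congrArg (fun a : X.obj σ ⟶ Y.obj φ => (a.f m).hom (l u q m hq y)) (p.naturality x)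
  rw [koszulExtend_elt, h1, h.lift, ← koszulHom_koszulMap, koszulMap_elt, Category.id_comp]

lemma IsKoszulSolution.comm_elt {u : τ ⟶ σ} (h : IsKoszulSolution p g l u (l u)) (x : σ ⟶ φ)
    (q i j : ℤ) (hij : j + 1 = i) (hq : Hom.deg u + q = i) (y : (S.obj τ).X q) :
    ((X.obj φ).d i j).hom (koszulExtend l φ i (koszulElt S u x q i hq y)) =
      koszulExtend l φ j (koszulD S φ i j hij (koszulElt S u x q i hq y)) := by
  have h1 := h.comm q (q - 1) i j (by omega) hq (by omega) (by omega) y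
  rw [koszulExtend_elt, hom_d, eq_add_of_sub_eq' h1, koszulD_elt, map_add, map_add, map_zsmul,
    map_zsmul, koszulEltZ_eq S _ _ _ _ (by omega), koszulExtend_elt]
  congr 1
  have h2 := congrArg (fun a => a (koszulTw S u (𝟙 σ) q j y)) (koszulExtend_koszulMap l x j)
  simp only [LinearMap.comp_apply, koszulMap_tw, Category.id_comp] at h2
  exact h2.symm

/-- The solutions exist if they are known in lower degree. -/
lemma exists_isKoszulSolution (hS : IsDGCofibrant S) (hp : IsProjectiveFibration p)
    (hq : IsWeakEquiv p) (u : τ ⟶ σ)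
    (hl : ∀ {τ' σ' : PrunedTree n} (v : τ' ⟶ σ'), Hom.deg v + 1 = Hom.deg u →
      IsKoszulSolution p g l v (l v)) :
    ∃ s, IsKoszulSolution p g l u s := by
  have hlift : ∀ a b y, ((p.app σ).f b).hom (koszulExtend l σ b (koszulTw S u (𝟙 σ) a b y)) =
      koszulHom g σ b (koszulTw S u (𝟙 σ) a b y) := fun a b y =>
    koszulTw_ext S (f := ((p.app σ).f b).hom ∘ₗ koszulExtend l σ b)
      (g := koszulHom g σ b)
      (fun v hv x q hq y => (hl v hv).lift_elt x q b hq y) (𝟙 σ) a y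
  have hcomm : ∀ a b b' (hb : b' + 1 = b) y,
      ((X.obj σ).d b b').hom (koszulExtend l σ b (koszulTw S u (𝟙 σ) a b y)) =
        koszulExtend l σ b' (koszulD S σ b b' hb (koszulTw S u (𝟙 σ) a b y)) :=
    fun a b b' hb y =>
      koszulTw_ext S (f := ((X.obj σ).d b b').hom ∘ₗ koszulExtend l σ b)
        (g := koszulExtend l σ b' ∘ₗ koszulD S σ b b' hb)
        (fun v hv x q hq y => (hl v hv).comm_elt x q b b' hb hq y) (𝟙 σ) a y
  -- The differential that `s` must have is the value of the family, already known in lower degree,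
  -- on the twisting of `{u}`. Its cycle condition comes from `koszulD_tw`.
  obtain ⟨s, hs, hs'⟩ := (hS τ).exists_twisted_lift (p.app σ) (hp σ) (hq σ) (Hom.deg u)
    (fun a b h => koszulHom g σ b ∘ₗ koszulElt S u (𝟙 σ) a b h)
    (fun a b _ => koszulExtend l σ b ∘ₗ koszulTw S u (𝟙 σ) a b)
    (by
      intro i j b b' hij h h' h'' y
      obtain rfl : j = i - 1 := by omega
      rw [LinearMap.comp_apply, LinearMap.comp_apply, LinearMap.comp_apply, hlift,
        d_koszulHom g b b' (by omega), koszulD_elt, koszulEltZ_eq S _ _ _ _ h', map_add,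
        map_zsmul, add_sub_cancel_left])
    (by
      intro i j b b' hij h h' y
      obtain rfl : j = i - 1 := by omega
      rw [LinearMap.comp_apply, LinearMap.comp_apply, hcomm i b b' (by omega),
        koszulD_tw S b b' _ u (𝟙 σ) i h, map_neg, map_zsmul, neg_add_cancel])
  exact ⟨s, hs, hs'⟩

open Classical in
/-- The choice of a solution, if there is one. -/
noncomputable def koszulStep (p : X ⟶ Y) (g : koszul S hK ⟶ Y) (l : KoszulFamily S X) :
    KoszulFamily S X := fun _ _ u =>
  if h : ∃ s, IsKoszulSolution p g l u s then h.choose else fun _ _ _ => 0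

/-- The Koszul complex of a dg-cofibrant diagram is cofibrant. -/
theorem isCofibrantDiagram_koszul (hS : IsDGCofibrant S) : IsCofibrantDiagram (koszul S hK) := by
  intro X Y p hp hq g
  -- Each step recomputes the whole family, but on morphisms of degree `N` only the value at stage
  -- `N + 1` is retained in `l`. The zero family at the start is never used as a solution.
  let prev : ℕ → KoszulFamily S X := fun N =>
    Nat.rec (fun _ _ _ _ _ _ => 0) (fun _ l => koszulStep p g l) N
  let seq : ℕ → KoszulFamily S X := fun N => prev (N + 1)
  let l : KoszulFamily S X := fun τ σ u => seq (Hom.deg u).toNat u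
  have hstep : ∀ (N : ℕ) {τ σ : PrunedTree n} (u : τ ⟶ σ), (Hom.deg u).toNat = N →
      (∀ {τ' σ' : PrunedTree n} (v : τ' ⟶ σ'), Hom.deg v + 1 = Hom.deg u → prev N v = l v) →
      (∀ {τ' σ' : PrunedTree n} (v : τ' ⟶ σ'), Hom.deg v + 1 = Hom.deg u →
        IsKoszulSolution p g l v (l v)) → IsKoszulSolution p g l u (l u) := by
    intro N τ σ u hN hprev hv
    have hiff : ∀ s, IsKoszulSolution p g (prev N) u s ↔ IsKoszulSolution p g l u s := fun s =>
      ⟨fun h => ⟨h.lift, fun i j b b' hij h1 h2 h3 y =>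
        (h.comm i j b b' hij h1 h2 h3 y).trans (koszulExtend_tw_congr hprev _ _ _ _)⟩,
      fun h => ⟨h.lift, fun i j b b' hij h1 h2 h3 y =>
        (h.comm i j b b' hij h1 h2 h3 y).trans (koszulExtend_tw_congr hprev _ _ _ _).symm⟩⟩
    obtain ⟨s, hs⟩ := exists_isKoszulSolution hS hp hq u hv
    have hex : ∃ s, IsKoszulSolution p g (prev N) u s := ⟨s, (hiff s).2 hs⟩
    have hl : l u = hex.choose := by
      change prev ((Hom.deg u).toNat + 1) u = _
      rw [hN]
      exact dif_pos hex
    rw [hl]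
    exact (hiff _).1 hex.choose_spec
  have hsol : ∀ (N : ℕ) {τ σ : PrunedTree n} (u : τ ⟶ σ), Hom.deg u = N →
      IsKoszulSolution p g l u (l u) := by
    intro N
    induction N with
    | zero =>
      intro τ σ u hu
      have hv : ∀ {τ' σ' : PrunedTree n} (v : τ' ⟶ σ'), Hom.deg v + 1 ≠ Hom.deg u := by
        intro τ' σ' v
        have := Hom.deg_nonneg v
        omega
      exact hstep 0 u (by rw [hu]; rfl) (fun v h => absurd h (hv v)) fun v h => absurd h (hv v)
    | succ N ih =>
      intro τ σ u hu
      refine hstep (N + 1) u (by rw [hu]; rfl) (fun v hv => ?_)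
        fun v hv => ih v (by push_cast at hu; omega)
      have : (Hom.deg v).toNat = N := by
        push_cast at hu
        omega
      change seq N v = seq (Hom.deg v).toNat v
      rw [this]
  have hsol' : ∀ {τ σ : PrunedTree n} (u : τ ⟶ σ), IsKoszulSolution p g l u (l u) := fun u =>
    hsol (Hom.deg u).toNat u (Int.toNat_of_nonneg (Hom.deg_nonneg u)).symm
  refine ⟨{ app := fun φ =>
              { f := fun m => ModuleCat.ofHom (koszulExtend l φ m)
                comm' := fun i j hij => ?_ }
            naturality := fun φ ψ f => HomologicalComplex.hom_ext _ _ fun m =>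
              ModuleCat.hom_ext (koszulExtend_koszulMap l f m) }, ?_⟩
  · have h : j + 1 = i := hij
    change _ = (koszulObj S hK φ).d i j ≫ _
    rw [koszulObj_d S hK φ i j h]
    exact ModuleCat.hom_ext (koszul_hom_ext fun u x q hq y => (hsol' u).comm_elt x q i j h hq y)
  · ext φ m : 4
    exact koszul_hom_ext fun u x q hq y => (hsol' u).lift_elt x q m hq y

end KoszulCofibrant

/-! ### The main theorem -/

section Main

variable {k : Type u} [CommRing k] {n : ℕ}

open PrunedTree

variable {S T : DGDiagram k n} (hK : KoszulSquareZero S)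

lemma isOverAug_iff {Q : DGDiagram k n} (q : Q ⟶ S) (c : Q ⟶ koszul S hK) :
    IsOverAug hK q c ↔ c ≫ koszulAugmentation S hK = q := by
  constructor
  · intro h
    ext φ m : 4
    exact LinearMap.ext fun z => h φ m z
  · rintro rfl φ m z
    rfl

/-- If `S` and `T` are elementary, then natural maps `K(Ω, Ω, S) → T` vanish on boundaries. -/
lemma dgHom_koszulD_eq_zero (hS : IsElementary S) (hT : IsElementary T) {d : ℤ}
    (f : dgHom (koszul S hK) T d) (φ : PrunedTree n) (i : ℤ) (P : DegPair d) (h : P.p + 1 = i) :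
    f.1 φ P ∘ₗ koszulD S φ i P.p h = 0 := by
  refine koszul_hom_ext fun {τ σ} u x q hq y => ?_
  let L : KoszulX S φ P.p →ₗ[k] (T.obj φ).X P.q := f.1 φ P
  change L (koszulD S φ i P.p h (koszulElt S u x q i hq y)) = 0
  rw [koszulD_elt, hS.d_eq_zero, koszulTw_apply]
  have h1 : ∀ F : Factorization u,
      L (Hom.coeff F.snd • koszulEltZ S F.fst (F.snd ≫ x) q P.p y) = 0 := by
    intro F
    by_cases hF : Hom.coeff F.snd = 0
    · rw [hF, zero_smul, map_zero]
    · have hd := Factorization.deg_fst_add_one hF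
      have hd' := F.deg_add
      have hx := Hom.deg_nonneg x
      -- The term is the image, under the morphism `F.snd ≫ x` of positive degree, of an element
      -- over `F.mid`; by naturality `f` sends it into the image of the zero map on `T`.
      have h2 := congrArg (fun a => a (koszulEltZ S F.fst (𝟙 _) q P.p y))
        (f.2 _ _ (F.snd ≫ x) P)
      rw [hT.map_eq_zero (F.snd ≫ x) (by rw [Hom.deg_comp]; omega)] at h2
      have h3 : L (koszulMap S (F.snd ≫ x) P.p (koszulEltZ S F.fst (𝟙 _) q P.p y)) = 0 := h2.symm
      rw [koszulMap_eltZ, Category.id_comp] at h3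
      rw [map_zsmul, h3, smul_zero]
  have h2 : ∀ F : Factorization u, Hom.coeff F.fst • ((Hom.deg u).negOnePow : ℤ) •
      koszulEltZ S F.snd x q P.p (((S.map F.fst).f q).hom y) = 0 := by
    intro F
    by_cases hF : Hom.coeff F.fst = 0
    · rw [hF, zero_smul]
    · have hd := Factorization.deg_snd_add_one hF
      have hd' := F.deg_add
      rw [hS.map_eq_zero F.fst (by omega)]
      simp
  rw [Finset.sum_congr rfl fun F _ => h2 F, map_add, map_add, map_sum,
    Finset.sum_congr rfl fun F _ => h1 F]
  simp

end Main

theorem mainTheorem4 {k : Type u} [CommRing k] (n : ℕ) (S T : DGDiagram k n)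
    (hS : IsDGCofibrant S) (hT : IsDGCofibrant T) :
    ∃ hK : KoszulSquareZero S,
      (∃ (Q : DGDiagram k n) (q : Q ⟶ S), IsCofibrantReplacement q) ∧
      (∀ (Q : DGDiagram k n) (q : Q ⟶ S), IsCofibrantReplacement q →
        (∃ c : Q ⟶ koszul S hK, IsOverAug hK q c) ∧
        ∃ e : ∀ i : ℤ, extVia Q T i ≅ (homComplex (koszul S hK) T).homology (-i),
          ∀ c : Q ⟶ koszul S hK, IsOverAug hK q c → ∀ i : ℤ,
            HomologicalComplex.homologyMap (homComplexMap c T) (-i) = (e i).inv) ∧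
      (IsElementary S → IsElementary T →
        ∀ i j : ℤ, (homComplex (koszul S hK) T).d i j = 0) := by
  have hK := koszulSquareZero S
  have hfib := isProjectiveFibration_koszulAugmentation S hK
  have hweq := isWeakEquiv_koszulAugmentation S hK
  have hcof : IsCofibrantDiagram (koszul S hK) := isCofibrantDiagram_koszul hS
  refine ⟨hK, ⟨koszul S hK, koszulAugmentation S hK, hcof, hweq⟩, fun Q q hq => ?_,
    fun hS' hT' i j => ?_⟩
  · obtain ⟨c, hc⟩ := hq.cofibrant (koszulAugmentation S hK) hfib hweq q
    refine ⟨⟨c, (isOverAug_iff hK q c).2 hc⟩, ?_⟩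
    have hcw : IsWeakEquiv c := by
      intro φ
      have h1 := hq.weakEquiv φ
      have h2 := hweq φ
      rw [← hc, NatTrans.comp_app] at h1
      exact quasiIso_of_comp_right (c.app φ) ((koszulAugmentation S hK).app φ)
    have hiso := fun m => hcw.isIso_homologyMap hq.cofibrant hcof T m
    refine ⟨fun i => (asIso (HomologicalComplex.homologyMap (homComplexMap c T) (-i))).symm,
      fun c' hc' i => ?_⟩
    rw [isOverAug_iff] at hc'
    -- Two morphisms over the augmentation differ by one that the acyclic fibration kills, hence by
    -- a null-homotopic one; so the isomorphism does not depend on the choice.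
    exact (hq.cofibrant.isNullHomotopic hfib hweq (e := c' - c)
      (by rw [Preadditive.sub_comp, hc, hc', sub_self])).homologyMap_eq T (-i)
  · by_cases h : j + 1 = i
    · change (if h : j + 1 = i then ModuleCat.ofHom (dgHomD (koszul S hK) T i j h) else 0) = 0
      rw [dif_pos h]
      refine ModuleCat.hom_ext (LinearMap.ext fun f => Subtype.ext (funext fun τ =>
        funext fun P => LinearMap.ext fun z => ?_))
      change ((T.obj τ).d (P.q + 1) P.q).hom _ - (i.negOnePow : ℤ) • f.1 τ ⟨P.p - 1, P.q, _⟩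
        (((koszulObj S hK τ).d P.p (P.p - 1)).hom z) = 0
      rw [hT'.d_eq_zero, koszulObj_d S hK τ P.p (P.p - 1) (by omega)]
      have h1 := congrArg (fun a => a z) (dgHom_koszulD_eq_zero hK hS' hT' f τ P.p
        ⟨P.p - 1, P.q, by have := P.eq; omega⟩ (by dsimp only; omega))
      have h2 : f.1 τ ⟨P.p - 1, P.q, by have := P.eq; omega⟩
        ((koszulD S τ P.p (P.p - 1) (by omega)) z) = 0 := h1
      refine (congrArg (fun a => _ - (i.negOnePow : ℤ) • a) h2).trans ?_
      simp
    · exact (homComplex (koszul S hK) T).shape i j h
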